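/- Let $V_\omega$ be a random potential on $\mathbb{R}$, jointly measurable in $(x,\omega)$, with $\sup_{n\ge 1}\mathbb{E}\big[\int_{I_n}|V(x)|\,dx\big]<\infty$, where $I_n=(n-1,n]$. For $L\in\mathbb{N}$, $L\ge 1$, let $H_L^{\pm}=-\frac{d^2}{dx^2}+V_\omega$ on $L^2([0,L])$ with periodic ($+$) or anti-periodic ($-$) boundary conditions, defined through its quadratic form on $H^1[0,L]$. Let $(\varphi_{j,L}^{\pm})_j$ be a complete orthonormal system of eigenfunctions of $H_L^\pm$ (represented by continuous functions), jointly measurable in $(x,\omega)$, with eigenvalues $E_{j,L}^\pm$. For $J\subset\mathbb{R}$ put $$Q_L^\pm(n,m;J)=\sum_{j:\,E_{j,L}^\pm\in J}\Phi_{j,L}^\pm(n)\,\Phi_{j,L}^\pm(m),\qquad \Phi_{j,L}^\pm(n)=\Big(\int_{I_n}|\varphi_{j,L}^\pm(x)|^2dx\Big)^{1/2},$$ and let $\operatorname{dist}(n,m)=\min\{|n-m|,\,L-|n-m|\}$ be the distance on the torus of length $L$. Assume eigenfunction-correlator localization (ECL) on $J$: there are $C,\ell\in(0,\infty)$ and $\xi\in(0,1]$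 such that, for both boundary conditions, all $L\ge1$ and all $1\le n,m\le L$, $$\mathbb{E}\big[Q_L^\pm(n,m;J)\big]\le C\exp\Big(-\frac{\operatorname{dist}(n,m)^\xi}{\ell^\xi}\Big).$$ For $N$ distinct indices $j_1,\dots,j_N$ put $\sharp_N=(-1)^{N+1}$ and let $$\Psi(x_1,\dots,x_N)=\frac1{\sqrt{N!}}\det\big(\varphi^{\sharp_N}_{j_\alpha,L}(x_\beta)\big)_{\alpha,\beta=1}^N\prod_{1\le j<k\le N}\operatorname{sign}(x_j-x_k)$$ be the corresponding Tonks-Girardeau eigenstate, and let $\gamma_\Psi$ be the operator on $L^2([0,L])$ with kernel $$\gamma_\Psi(x,y)=N\int_{[0,L]^{N-1}}\Psi(x,x_2,\dots,x_N)\overline{\Psi(y,x_2,\dots,x_N)}\,dx_2\cdots dx_N$$ ($\gamma_\Psi=0$ if $N=0$). Then there is a constant $A\in(0,\infty)$, independent of $L$, of $N$ and of the choice of the indices, such that for every $L\ge1$ and every selection $\{j_1,\dots,j_N\}$ that depends measurably on $\omega$ (also the number $N\geq 0$ may depend on $\omega$) and satisfies $E^{\sharp_N}_{j_\alpha,L}\in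 J$ for all $\alpha$ almost surely, $$\mathbb{E}\big[\|1_{I_n}\gamma_\Psi 1_{I_m}\|_2^{\sigma}\big]\le A\exp\Big(-\frac23(1-\sigma)\frac{\operatorname{dist}(n,m)^\xi}{(2\ell)^\xi}\Big)$$ for all $1\le n,m\le L$ and all $2/5\le\sigma<1$, where $\|\cdot\|_2$ is the Hilbert-Schmidt norm on $L^2([0,L])$. -/

import Mathlib

open MeasureTheory
open scoped ENNReal NNReal

noncomputable section

namespace TonksGirardeau

/-- The basic interval `I_n = (n - 1, n]`. -/
def cell (n : ℕ) : Set ℝ := Set.Ioc ((n : ℝ) - 1) n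

/-- Distance on the one-dimensional torus of length `L`, for `1 ≤ n, m ≤ L`. -/
def torusDist (L n m : ℕ) : ℝ := min |(n : ℝ) - m| (L - |(n : ℝ) - m|)

/-- `f ∈ H¹[0,L]` (given by its absolutely continuous representative) with weak derivative
`f' ∈ L²(0,L)`. -/
structure IsH1 (L : ℝ) (f f' : ℝ → ℂ) : Prop where
  memLp_deriv : MemLp f' 2 (volume.restrict (Set.Ioc 0 L))
  eq_integral : ∀ x ∈ Set.Icc 0 L, f x = f 0 + ∫ t in (0 : ℝ)..x, f' t

/-- The form domain of the one-particle operator: `H¹[0,L]` with `f L = s f 0`, that is, periodic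
boundary conditions for `s = 1` and anti-periodic ones for `s = -1`. -/
structure InFormDomain (s : ℤˣ) (L : ℝ) (f f' : ℝ → ℂ) : Prop extends IsH1 L f f' where
  boundary : f L = ((s : ℤ) : ℂ) * f 0

/-- `f` satisfies `H f = E f`, where `H = -d²/dx² + V` on `L²([0,L])` with (anti-)periodic boundary
conditions is defined through its quadratic form: `h(ψ, f) = E ⟨ψ, f⟩` for all `ψ` in the form
domain. -/
def IsFormEigenfunction (V : ℝ → ℝ) (s : ℤˣ) (L E : ℝ) (f : ℝ → ℂ) : Prop :=
  ∃ f' : ℝ → ℂ, InFormDomain s L f f' ∧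
    ∀ ψ ψ' : ℝ → ℂ, InFormDomain s L ψ ψ' →
      (∫ x in Set.Ioc 0 L, (star (ψ' x) * f' x + (V x : ℂ) * (star (ψ x) * f x)))
        = (E : ℂ) * ∫ x in Set.Ioc 0 L, star (ψ x) * f x

/-- `(φ j)` is a complete orthonormal system of `L²([0,L])` consisting of eigenfunctions of the
one-particle operator, with eigenvalues `E j` (repeated according to multiplicity). -/
structure IsEigenbasis (V : ℝ → ℝ) (s : ℤˣ) (L : ℝ) (E : ℕ → ℝ) (φ : ℕ → ℝ → ℂ) : Prop where
  eigen : ∀ j, IsFormEigenfunction V s L (E j) (φ j)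
  basis : ∃ b : HilbertBasis ℕ ℂ (Lp ℂ 2 (volume.restrict (Set.Ioc (0 : ℝ) L))),
    ∀ j, (b j : ℝ → ℂ) =ᵐ[volume.restrict (Set.Ioc (0 : ℝ) L)] φ j

/-- `(∫_{I_n} |f|²)^{1/2}`. -/
def localNorm (f : ℝ → ℂ) (n : ℕ) : ℝ≥0∞ := (∫⁻ x in cell n, ‖f x‖ₑ ^ 2) ^ (1 / 2 : ℝ)

/-- The eigenfunction correlator `Q(n, m; J)`, a sum of non-negative terms in `[0,∞]`. -/
def correlator (E : ℕ → ℝ) (φ : ℕ → ℝ → ℂ) (J : Set ℝ) (n m : ℕ) : ℝ≥0∞ :=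
  ∑' j : {j : ℕ // E j ∈ J}, localNorm (φ j) n * localNorm (φ j) m

/-- Eigenfunction correlator localization on `J` with constants `C`, `ℓ`, `ξ`, for both boundary
conditions. Energies and eigenfunctions are indexed by boundary condition, length, `ω` and label. -/
def ECL {Ω : Type*} [MeasurableSpace Ω] (P : Measure Ω) (E : ℤˣ → ℕ → Ω → ℕ → ℝ)
    (φ : ℤˣ → ℕ → Ω → ℕ → ℝ → ℂ) (J : Set ℝ) (C ℓ ξ : ℝ) : Prop :=
  ∀ (s : ℤˣ) (L n m : ℕ), 1 ≤ n → n ≤ L → 1 ≤ m → m ≤ L →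
    ∫⁻ ω, correlator (E s L ω) (φ s L ω) J n m ∂P
      ≤ ENNReal.ofReal (C * Real.exp (-(torusDist L n m ^ ξ / ℓ ^ ξ)))

/-- The boundary condition for `N` particles: `(-1)^(N+1)`, i.e. periodic for odd `N` and
anti-periodic for even `N`. -/
def bcSign (N : ℕ) : ℤˣ := (-1) ^ (N + 1)

/-- The Tonks-Girardeau wave function built from the one-particle functions `u 0, …, u (N - 1)`. -/
def waveFunction {N : ℕ} (u : Fin N → ℝ → ℂ) (x : Fin N → ℝ) : ℂ :=
  (1 / (Real.sqrt (N.factorial : ℝ) : ℂ)) * (Matrix.of fun a b : Fin N => u a (x b)).det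
    * ∏ a : Fin N, ∏ b ∈ Finset.Ioi a, (Real.sign (x a - x b) : ℂ)

/-- The kernel of the reduced one-particle density matrix
`γ(x,y) = N ∫_{[0,L]^{N-1}} Ψ(x,x₂,…,x_N) conj Ψ(y,x₂,…,x_N)` (zero for `N = 0`). -/
def reducedKernel (L : ℝ) : (N : ℕ) → ((Fin N → ℝ) → ℂ) → ℝ → ℝ → ℂ
  | 0, _, _, _ => 0
  | N + 1, Ψ, x, y => ((N + 1 : ℕ) : ℂ) *
      ∫ z in Set.pi Set.univ (fun _ : Fin N => Set.Ioc 0 L),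
        Ψ (Fin.cons x z : Fin (N + 1) → ℝ) * star (Ψ (Fin.cons y z : Fin (N + 1) → ℝ))

/-- The kernel `γ_Ψ` for the state `Ψ` composed of the one-particle functions `φ j`, `j ∈ S`.
(The order of the functions only affects the sign of `Ψ`.) -/
def gammaKernel (L : ℝ) (φ : ℕ → ℝ → ℂ) (S : Finset ℕ) : ℝ → ℝ → ℂ :=
  reducedKernel L S.card (waveFunction fun a => φ (S.orderEmbOfFin rfl a))

/-- The Hilbert-Schmidt norm `‖1_n γ 1_m‖₂` of the localized integral operator with kernel `γ`. -/
def localHS (γ : ℝ → ℝ → ℂ) (n m : ℕ) : ℝ≥0∞ :=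
  (∫⁻ x in cell n, ∫⁻ y in cell m, ‖γ x y‖ₑ ^ 2) ^ (1 / 2 : ℝ)

end TonksGirardeau

end

/-! Integrating out all particles but one in the product of two determinants turns the kernel at
`(x, y)`, up to sign, into a single determinant: the overlap matrix `F i j = ∫ u i * star (u j) *
flip`, bordered by the column `u i x` and the row `star (u j y)`
(`norm_reducedKernel_waveFunction`). Here `flip` is `-1` strictly between `x` and `y` and `1`
elsewhere. The rows of `F` have norm at most one, so a Hadamard-type inequality bounds bordered
determinants by the norms of the borders, uniformly in the particle number (`norm_bordered_le`).

Decay comes from decoupling. For `i ≠ j` orthogonality makes the entry equal both to twice the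
overlap outside `(x, y)` and to minus twice the overlap inside it, so it may be computed on
whichever arc of the torus lies farther from the two functions. Each function has at least a third
of its mass near `n`, near `m`, or in the middle; this defines three groups. If `F` were block
diagonal, a determinant bordered by a column from one block and a row from another would vanish.
Removing a coupling of trace norm `T` changes the determinant by at most `T` times a bound on
determinants with one more border (`norm_bordered_add_sub_le`).

Let `Z k` be the sum of the correlators over suitable pairs of cells at distance at least `k/5` of
`d = dist(n, m)` (`farSum`). The two end groups are coupled directly with strength of order `Z 3 +
(Z 2) ^ 2` (`nucLE_far`). The coupling to the middle group is only of order `Z 2`, but passing from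
one end to the other uses it twice, so it enters squared (`norm_bordered₁_decouple`). Hence the
Hilbert-Schmidt norm is at most a constant times `(2 + Q(n,n) + Q(m,m)) * min 1 (Z 3 + (Z 2) ^ 2)`
(`OrthoFamily.localHS_le`).

In expectation, giving up `k/5` for `k/6` pays for the sum over cells: `E[Z k]` is of order `exp(-(k
d / (6 ℓ)) ^ ξ)`. With `r = (d / (2 ℓ)) ^ ξ` these rates are `r` for `k = 3` and at least `2 r / 3`
for `k = 2`, because `ξ ≤ 1`. Hölder's inequality gives decay `exp(-2 r / 5)` for the moment of
order `2/5`, and interpolation with the bounded first moment of the prefactor gives the remaining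
orders (`lintegral_rpow_le_of_le`). -/

namespace TonksGirardeau

/-! ### Bordered determinants, Hadamard bounds and trace-norm perturbation. -/

section LinearAlgebra

open Matrix
open scoped ComplexOrder

variable {n κ : Type} [Fintype n] [Fintype κ]

/-- The Euclidean norm of a complex vector. -/
noncomputable def l2 (v : n → ℂ) : ℝ := √(∑ i, ‖v i‖ ^ 2)

lemma l2_nonneg (v : n → ℂ) : 0 ≤ l2 v := Real.sqrt_nonneg _

lemma l2_sq (v : n → ℂ) : l2 v ^ 2 = ∑ i, ‖v i‖ ^ 2 :=
  Real.sq_sqrt (Finset.sum_nonneg fun _ _ => by positivity)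

lemma l2_mono {v w : n → ℂ} (h : ∀ i, ‖v i‖ ≤ ‖w i‖) : l2 v ≤ l2 w :=
  Real.sqrt_le_sqrt (Finset.sum_le_sum fun i _ => by have := h i; gcongr)

lemma l2_eq_zero {v : n → ℂ} (h : l2 v = 0) : v = 0 := by
  have h1 := l2_sq v
  rw [h] at h1
  funext i
  have := (Finset.sum_eq_zero_iff_of_nonneg
    (s := Finset.univ) (f := fun i => ‖v i‖ ^ 2) (fun i _ => by positivity)).1
      (by rw [← h1]; norm_num) i (Finset.mem_univ i)
  simpa using this

lemma l2_smul (c : ℂ) (v : n → ℂ) : l2 (fun i => c * v i) = ‖c‖ * l2 v := by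
  unfold l2
  simp_rw [norm_mul, mul_pow, ← Finset.mul_sum]
  rw [Real.sqrt_mul (by positivity), Real.sqrt_sq (norm_nonneg _)]

/-- A form of Hadamard's inequality. -/
lemma norm_det_sq_le [DecidableEq n] (A : Matrix n n ℂ) :
    ‖A.det‖ ^ 2 ≤ Real.exp ((∑ i, ∑ j, ‖A i j‖ ^ 2) - Fintype.card n) := by
  -- With `λ` the eigenvalues of `A * Aᴴ`, the squared determinant is `∏ λ` and the sum of squared
  -- entries is `∑ λ`; the claim is then `λ ≤ exp (λ - 1)` factor by factor.
  have hP : (A * Aᴴ).PosSemidef := Matrix.posSemidef_self_mul_conjTranspose A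
  have hH := hP.isHermitian
  have h1 : ((‖A.det‖ ^ 2 : ℝ) : ℂ) = ((∏ i, hH.eigenvalues i : ℝ) : ℂ) := by
    have := hH.det_eq_prod_eigenvalues
    rw [det_mul, det_conjTranspose] at this
    push_cast
    rw [← Complex.mul_conj', ← starRingEnd_apply] at *
    simpa using this
  have h2 : ((∑ i, ∑ j, ‖A i j‖ ^ 2 : ℝ) : ℂ) = ((∑ i, hH.eigenvalues i : ℝ) : ℂ) := by
    have := hH.trace_eq_sum_eigenvalues
    simp only [trace, diag, mul_apply, conjTranspose_apply] at this
    push_cast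
    simp_rw [← Complex.mul_conj', starRingEnd_apply]
    simpa using this
  rw [Complex.ofReal_inj] at h1 h2
  rw [h1, h2]
  have : (∑ i, hH.eigenvalues i) - Fintype.card n = ∑ i, (hH.eigenvalues i - 1) := by simp
  rw [this, Real.exp_sum]
  refine Finset.prod_le_prod (fun i _ => hP.eigenvalues_nonneg i) fun i _ => ?_
  have := Real.add_one_le_exp (hH.eigenvalues i - 1)
  linarith

/-- The determinant of a matrix bordered by the columns `B` and the rows `C`. -/
noncomputable def bordered [DecidableEq n] [DecidableEq κ] (M : Matrix n n ℂ) (B : Matrix n κ ℂ)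
    (C : Matrix κ n ℂ) : ℂ := (fromBlocks M B C 0).det

/-- By multilinearity the borders can be scaled to unit vectors. The Hadamard bound then applies
with no growth in the size of `M`, since the squared entries of `M` sum to at most its dimension. -/
lemma norm_bordered_le [DecidableEq n] [DecidableEq κ] {M : Matrix n n ℂ}
    (hM : ∑ i, ∑ j, ‖M i j‖ ^ 2 ≤ Fintype.card n) (B : Matrix n κ ℂ) (C : Matrix κ n ℂ) :
    ‖bordered M B C‖ ≤ Real.exp (Fintype.card κ) * ∏ k, (l2 (fun i => B i k) * l2 (C k)) := by
  by_cases hB : ∃ k, l2 (fun i => B i k) = 0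
  · obtain ⟨k, hk⟩ := hB
    have : bordered M B C = 0 := by
      refine det_eq_zero_of_column_eq_zero (Sum.inr k) ?_
      rintro (i | i)
      · simpa using congrFun (l2_eq_zero hk) i
      · simp
    rw [this, norm_zero]
    exact mul_nonneg (Real.exp_nonneg _)
      (Finset.prod_nonneg fun _ _ => mul_nonneg (l2_nonneg _) (l2_nonneg _))
  by_cases hC : ∃ k, l2 (C k) = 0
  · obtain ⟨k, hk⟩ := hC
    have : bordered M B C = 0 := by
      refine det_eq_zero_of_row_eq_zero (Sum.inr k) ?_
      rintro (i | i)
      · simpa using congrFun (l2_eq_zero hk) i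
      · simp
    rw [this, norm_zero]
    exact mul_nonneg (Real.exp_nonneg _)
      (Finset.prod_nonneg fun _ _ => mul_nonneg (l2_nonneg _) (l2_nonneg _))
  push Not at hB hC
  set β : κ → ℂ := fun k => (l2 (fun i => B i k) : ℂ)
  set γ : κ → ℂ := fun k => (l2 (C k) : ℂ)
  have hβ : ∀ k, β k ≠ 0 := fun k => Complex.ofReal_ne_zero.2 (hB k)
  have hγ : ∀ k, γ k ≠ 0 := fun k => Complex.ofReal_ne_zero.2 (hC k)
  set B' : Matrix n κ ℂ := of fun i k => (β k)⁻¹ * B i k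
  set C' : Matrix κ n ℂ := of fun k i => (γ k)⁻¹ * C k i
  have hB' : ∀ k, ∑ i, ‖B' i k‖ ^ 2 = 1 := fun k => by
    rw [← l2_sq, show (fun i => B' i k) = fun i => (β k)⁻¹ * B i k from rfl, l2_smul (β k)⁻¹,
      norm_inv, Complex.norm_real,
      Real.norm_of_nonneg (l2_nonneg _), inv_mul_cancel₀ (hB k), one_pow]
  have hC' : ∀ k, ∑ i, ‖C' k i‖ ^ 2 = 1 := fun k => by
    rw [← l2_sq, show C' k = fun i => (γ k)⁻¹ * C k i from rfl, l2_smul (γ k)⁻¹, norm_inv,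
      Complex.norm_real,
      Real.norm_of_nonneg (l2_nonneg _), inv_mul_cancel₀ (hC k), one_pow]
  have e1 : bordered M B C = (∏ k, β k) * ((∏ k, γ k) * bordered M B' C') := by
    have h1 : fromBlocks M B C 0 = of fun i j => Sum.elim (fun _ => 1) β j *
        (of fun i j => Sum.elim (fun _ => 1) γ i * fromBlocks M B' C' 0 i j) i j := by
      ext (i | i) (j | j)
      · simp
      · simp [B', hβ]
      · simp [C', hγ]
      · simp
    unfold bordered
    rw [h1, det_mul_row, det_mul_column]
    simp
  have e2 : ‖bordered M B' C'‖ ≤ Real.exp (Fintype.card κ) := by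
    have h1 := norm_det_sq_le (fromBlocks M B' C' 0)
    simp only [Fintype.sum_sum_type, fromBlocks_apply₁₁, fromBlocks_apply₁₂, fromBlocks_apply₂₁,
      fromBlocks_apply₂₂, Finset.sum_add_distrib, hC', Fintype.card_sum] at h1
    rw [Finset.sum_comm (f := fun i k => ‖B' i k‖ ^ 2)] at h1
    simp only [hB'] at h1
    have h2 : ‖bordered M B' C'‖ ^ 2 ≤ Real.exp (Fintype.card κ) ^ 2 := by
      -- The squared entries sum to at most `card n + 2 * card κ`, the dimension is `card n + card
      -- κ`, and the exponent left over is at most `card κ`.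
      refine h1.trans ?_
      rw [← Real.exp_nat_mul, Real.exp_le_exp]
      simp
      linarith
    exact (pow_le_pow_iff_left₀ (norm_nonneg _) (Real.exp_nonneg _) two_ne_zero).1 h2
  rw [e1, norm_mul, norm_mul, norm_prod, norm_prod, Finset.prod_mul_distrib, ← mul_assoc, mul_comm]
  refine mul_le_mul e2 (le_of_eq ?_) (by positivity) (Real.exp_nonneg _)
  congr 1 <;> exact Finset.prod_congr rfl fun k _ => by
    simp only [β, γ, Complex.norm_real, Real.norm_of_nonneg (l2_nonneg _)]

/-- A bound on the trace norm of `D`, in dual form. -/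
def NucLE (D : Matrix n n ℂ) (T : ℝ) : Prop :=
  ∀ (Λ : Matrix n n ℂ →ₗ[ℂ] ℂ) (K : ℝ), 0 ≤ K →
    (∀ u v : n → ℂ, ‖Λ (vecMulVec u v)‖ ≤ K * (l2 u * l2 v)) → ‖Λ D‖ ≤ K * T

lemma NucLE.mono {D : Matrix n n ℂ} {T T' : ℝ} (h : NucLE D T) (hT : T ≤ T') : NucLE D T' :=
  fun Λ K hK hΛ => (h Λ K hK hΛ).trans (by gcongr)

lemma NucLE.add {D D' : Matrix n n ℂ} {T T' : ℝ} (h : NucLE D T) (h' : NucLE D' T') :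
    NucLE (D + D') (T + T') := fun Λ K hK hΛ => by
  rw [map_add, mul_add]
  exact (norm_add_le _ _).trans (add_le_add (h Λ K hK hΛ) (h' Λ K hK hΛ))

lemma NucLE.sum {ι : Type*} (s : Finset ι) {D : ι → Matrix n n ℂ} {T : ι → ℝ}
    (h : ∀ i ∈ s, NucLE (D i) (T i)) : NucLE (∑ i ∈ s, D i) (∑ i ∈ s, T i) := fun Λ K hK hΛ => by
  rw [map_sum, Finset.mul_sum]
  exact norm_sum_le_of_le _ fun i hi => h i hi Λ K hK hΛ

lemma NucLE.smul {D : Matrix n n ℂ} {T : ℝ} (h : NucLE D T) (c : ℂ) :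
    NucLE (c • D) (‖c‖ * T) := fun Λ K hK hΛ => by
  rw [map_smul, norm_smul]
  calc _ ≤ ‖c‖ * (K * T) := by gcongr; exact h Λ K hK hΛ
    _ = _ := by ring

lemma NucLE.vecMulVec (u v : n → ℂ) : NucLE (vecMulVec u v) (l2 u * l2 v) :=
  fun _ _ _ hΛ => hΛ u v

/-- Matrix `D` with rows bounded. -/
lemma NucLE.of_rows [DecidableEq n] (D : Matrix n n ℂ) : NucLE D (∑ i, l2 (D i)) := by
  have h1 : D = ∑ i, Matrix.vecMulVec (Pi.single i 1) (D i) := by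
    ext i j
    simp [Matrix.sum_apply, vecMulVec_apply, Pi.single_apply]
  have h2 : ∀ i : n, l2 (Pi.single i 1 : n → ℂ) = 1 := fun i => by
    simp [l2, Pi.single_apply, apply_ite norm, ite_pow]
  conv_lhs => rw [h1]
  exact NucLE.sum _ fun i _ => (NucLE.vecMulVec _ _).mono (by rw [h2, one_mul])

lemma NucLE.transpose {D : Matrix n n ℂ} {T : ℝ} (h : NucLE D T) : NucLE Dᵀ T :=
  fun Λ K hK hΛ => h (Λ ∘ₗ (transposeLinearEquiv n n ℂ ℂ).toLinearMap) K hK fun u v => by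
    simpa [transpose_vecMulVec, mul_comm (l2 u)] using hΛ v u

lemma NucLE.of_columns [DecidableEq n] (D : Matrix n n ℂ) : NucLE D (∑ j, l2 (fun i => D i j)) :=
  (NucLE.of_rows Dᵀ).transpose

lemma l2_le_sum (v : n → ℂ) : l2 v ≤ ∑ i, ‖v i‖ := by
  refine Real.sqrt_le_iff.2 ⟨Finset.sum_nonneg fun _ _ => norm_nonneg _, ?_⟩
  exact Finset.sum_sq_le_sq_sum_of_nonneg (fun _ _ => norm_nonneg _)

lemma NucLE.of_entries [DecidableEq n] (D : Matrix n n ℂ) : NucLE D (∑ i, ∑ j, ‖D i j‖) :=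
  (NucLE.of_rows D).mono (Finset.sum_le_sum fun _ _ => l2_le_sum _)

/-- Bordering by one more column and row. -/
def extCol (B : Matrix n κ ℂ) (u : n → ℂ) : Matrix n (κ ⊕ Unit) ℂ :=
  of fun i => Sum.elim (B i) fun _ => u i

def extRow (C : Matrix κ n ℂ) (v : n → ℂ) : Matrix (κ ⊕ Unit) n ℂ :=
  of fun k j => Sum.elim (fun k => C k j) (fun _ => v j) k

/-- A rank-one update is a Schur complement: it arises by eliminating an extra row and column with
corner `1`. Splitting that corner row into its `1` and its remainder leaves a determinant with
corner `0`, that is, one more border. -/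
lemma bordered_add_vecMulVec [DecidableEq n] [DecidableEq κ] (M : Matrix n n ℂ) (B : Matrix n κ ℂ)
    (C : Matrix κ n ℂ) (u v : n → ℂ) (τ : ℂ) :
    bordered (M + τ • vecMulVec u v) B C
      = bordered M B C - τ * bordered M (extCol B u) (extRow C v) := by
  set N : Matrix (n ⊕ κ) (n ⊕ κ) ℂ := fromBlocks M B C 0 with hN
  set U : Matrix (n ⊕ κ) Unit ℂ := of fun i _ => Sum.elim u (fun _ => 0) i with hU
  set V : Matrix Unit (n ⊕ κ) ℂ := of fun _ j => Sum.elim v (fun _ => 0) j with hV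
  have h1 : fromBlocks (M + τ • vecMulVec u v) B C 0 = N - U * (-τ • V) := by
    ext (i | i) (j | j) <;> simp [hN, hU, hV, mul_apply, vecMulVec_apply]
    ring
  have h2 : (fromBlocks N U (-τ • V) 1).det
      = (fromBlocks N U 0 1).det + (fromBlocks N U (-τ • V) 0).det := by
    have e1 : ∀ (W : Matrix Unit (n ⊕ κ) ℂ) (Z : Matrix Unit Unit ℂ), fromBlocks N U W Z
        = (fromBlocks N U 0 0).updateRow (Sum.inr ()) (Sum.elim (W ()) (Z ())) := by
      intro W Z
      ext (i | i) (j | j) <;> simp [updateRow_apply]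
    rw [e1, e1 0 1, e1 (-τ • V) 0, ← det_updateRow_add]
    congr 2
    ext (j | j) <;> simp
  have h3 : (fromBlocks N U (-τ • V) 0).det = -τ * (fromBlocks N U V 0).det := by
    have : fromBlocks N U (-τ • V) 0 = of fun i j => Sum.elim (fun _ => 1) (fun _ => -τ) i *
        fromBlocks N U V 0 i j := by
      ext (i | i) (j | j) <;> simp
    rw [this, det_mul_column]
    simp
  have h4 : (fromBlocks N U V 0).det = bordered M (extCol B u) (extRow C v) := by
    unfold bordered
    rw [← det_submatrix_equiv_self (Equiv.sumAssoc n κ Unit).symm]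
    congr 1
    ext (i | i | i) (j | j | j) <;> simp [hN, hU, hV, extCol, extRow]
  rw [bordered, h1, ← det_fromBlocks_one₂₂, h2, h3, h4, det_fromBlocks_zero₂₁, det_one, mul_one]
  unfold bordered
  ring

/-- Removing a part `D` of the matrix in a bordered determinant changes it by at most the trace norm
of `D` times a bound on the determinants with one more bordering row and column. -/
lemma norm_bordered_add_sub_le [DecidableEq n] [DecidableEq κ] {M D : Matrix n n ℂ} {T : ℝ}
    (hD : NucLE D T) (s : n → Prop) (hs : ∀ i j, D i j ≠ 0 → s i ∧ s j) (B : Matrix n κ ℂ)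
    (C : Matrix κ n ℂ) {K : ℝ} (hK : 0 ≤ K)
    (h : ∀ τ ∈ Set.Icc (0 : ℝ) 1, ∀ u v : n → ℂ, (∀ i, u i ≠ 0 → s i) → (∀ i, v i ≠ 0 → s i) →
      ‖bordered (M + (τ : ℂ) • D) (extCol B u) (extRow C v)‖ ≤ K * (l2 u * l2 v)) :
    ‖bordered (M + D) B C - bordered M B C‖ ≤ K * T := by
  let F : (n → n → ℂ) → ℂ := fun X => bordered (of X) B C
  have hF : Differentiable ℂ F := by
    have : F = fun X => ∑ σ : Equiv.Perm (n ⊕ κ), ((Equiv.Perm.sign σ : ℤ) : ℂ) *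
        ∏ i, fromBlocks (of X) B C 0 (σ i) i := by
      funext X
      exact det_apply' _
    rw [this]
    refine Differentiable.fun_sum fun σ _ => ?_
    refine Differentiable.const_mul (ContDiff.differentiable (n := 1) ?_ one_ne_zero) _
    refine contDiff_prod fun i _ => ?_
    rcases σ i with a | a <;> rcases i with b | b <;> simp <;> fun_prop
  have hd : ∀ (N X : n → n → ℂ) (τ : ℝ),
      HasDerivAt (fun τ : ℝ => F (N + (τ : ℂ) • X)) (fderiv ℂ F (N + (τ : ℂ) • X) X) τ := by
    intro N X τ
    have h1 : HasDerivAt (fun τ : ℂ => N + τ • X) ((1 : ℂ) • X) (τ : ℂ) :=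
      ((hasDerivAt_id _).smul_const X).const_add N
    have h2 := (hF (N + (τ : ℂ) • X)).hasFDerivAt.comp_hasDerivAt (τ : ℂ) h1
    simpa using h2.comp_ofReal
  have hb : ∀ τ ∈ Set.Icc (0 : ℝ) 1,
      ‖fderiv ℂ F ((M : n → n → ℂ) + (τ : ℂ) • (D : n → n → ℂ)) D‖ ≤ K * T := by
    classical
    intro τ hτ
    set N : n → n → ℂ := (M : n → n → ℂ) + (τ : ℂ) • (D : n → n → ℂ) with hN
    -- Precomposing the derivative with the cut-off to `s × s` does not change its value at `D`, but
    -- reduces the rank-one test matrices to vectors supported in `s`.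
    let Pr : Matrix n n ℂ →ₗ[ℂ] (n → n → ℂ) :=
      { toFun := fun X i j => if s i ∧ s j then X i j else 0
        map_add' := fun X Y => by funext i j; simp only [Pi.add_apply, Matrix.add_apply]; split_ifs <;> simp
        map_smul' := fun c X => by
          funext i j; simp only [Pi.smul_apply, Matrix.smul_apply, RingHom.id_apply]; split_ifs <;> simp }
    have hPrD : Pr D = D := by
      funext i j
      by_cases hij : D i j = 0
      · simp [Pr, hij]
      · simp [Pr, hs i j hij]
    have key := hD ((fderiv ℂ F N).toLinearMap ∘ₗ Pr) K hK ?_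
    · simpa [hPrD] using key
    intro u v
    set u' : n → ℂ := fun i => if s i then u i else 0 with hu'
    set v' : n → ℂ := fun i => if s i then v i else 0 with hv'
    have e1 : Pr (Matrix.vecMulVec u v) = Matrix.vecMulVec u' v' := by
      funext i j
      simp only [Pr, LinearMap.coe_mk, AddHom.coe_mk, vecMulVec_apply, hu', hv']
      split_ifs <;> simp_all
    have e2 : fderiv ℂ F N (Matrix.vecMulVec u' v')
        = - bordered (of N) (extCol B u') (extRow C v') := by
      let X : n → n → ℂ := Matrix.vecMulVec u' v'
      have h1 := hd N X 0
      have h2 : HasDerivAt (fun τ : ℝ => F (N + (τ : ℂ) • X))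
          (0 - 1 * bordered (of N) (extCol B u') (extRow C v')) 0 := by
        have : (fun τ : ℝ => F (N + (τ : ℂ) • X)) = fun τ : ℝ =>
            bordered (of N) B C - τ * bordered (of N) (extCol B u') (extRow C v') := by
          funext τ
          exact bordered_add_vecMulVec (of N) B C u' v' τ
        rw [this]
        have h3 : HasDerivAt (fun τ : ℝ => (τ : ℂ)) 1 0 := (hasDerivAt_id (0 : ℝ)).ofReal_comp
        exact (hasDerivAt_const _ _).sub (h3.mul_const _)
      have h3 := h1.unique h2
      simp only [Complex.ofReal_zero, zero_smul, add_zero, zero_sub, one_mul] at h3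
      exact h3
    have e3 : ((fderiv ℂ F N).toLinearMap ∘ₗ Pr) (Matrix.vecMulVec u v)
        = - bordered (of N) (extCol B u') (extRow C v') := by
      rw [← e2, ← e1]
      rfl
    rw [e3, norm_neg]
    refine (h τ hτ u' v' (fun i hi => ?_) (fun i hi => ?_)).trans ?_
    · by_contra hc
      simp [hu', hc] at hi
    · by_contra hc
      simp [hv', hc] at hi
    · refine mul_le_mul_of_nonneg_left ?_ hK
      refine mul_le_mul (l2_mono fun i => ?_) (l2_mono fun i => ?_) (l2_nonneg _) (l2_nonneg _)
      · simp only [hu']; split_ifs <;> simp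
      · simp only [hv']; split_ifs <;> simp
  -- Mean value inequality along the segment from `M` to `M + D`.
  have := norm_image_sub_le_of_norm_deriv_le_segment_01' (f := fun τ : ℝ =>
      F ((M : n → n → ℂ) + (τ : ℂ) • (D : n → n → ℂ))) (C := K * T)
    (fun τ _ => (hd M D τ).hasDerivWithinAt) (fun τ hτ => hb τ ⟨hτ.1, hτ.2.le⟩)
  simp only [Complex.ofReal_one, one_smul, Complex.ofReal_zero, zero_smul, add_zero] at this
  exact this

-- A permutation with a nonvanishing term in the Leibniz formula maps the columns in `c` bijectively
-- onto the rows in `r`.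
open Classical in
lemma det_eq_zero_of_block [DecidableEq n] (A : Matrix n n ℂ) (r c : n → Prop)
    (h : ∀ i j, A i j ≠ 0 → (r i ↔ c j))
    (hcard : (Finset.univ.filter r).card ≠ (Finset.univ.filter c).card) : A.det = 0 := by
  rw [det_apply]
  refine Finset.sum_eq_zero fun σ _ => ?_
  by_cases hz : ∃ i, A (σ i) i = 0
  · obtain ⟨i, hi⟩ := hz
    rw [Finset.prod_eq_zero (f := fun i => A (σ i) i) (Finset.mem_univ i) hi, smul_zero]
  · push Not at hz
    exact absurd (Finset.card_bij (fun i _ => σ i)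
      (fun i hi => by simpa [h _ _ (hz i)] using hi) (fun i _ j _ hij => σ.injective hij)
      (fun j hj => ⟨σ.symm j, by
        have := h _ _ (hz (σ.symm j))
        simpa [← this] using hj, by simp⟩)) hcard.symm

open Classical in
/-- A bordered determinant of a matrix that is block diagonal with respect to `q` vanishes if
the bordering columns in `q` are not as many as the bordering rows in `q`. -/
lemma bordered_eq_zero [DecidableEq n] [DecidableEq κ] {M : Matrix n n ℂ} {B : Matrix n κ ℂ}
    {C : Matrix κ n ℂ} (q : n → Prop) (b c : κ → Prop)
    (hM : ∀ i j, M i j ≠ 0 → (q i ↔ q j)) (hB : ∀ i k, B i k ≠ 0 → (q i ↔ b k))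
    (hC : ∀ k j, C k j ≠ 0 → (c k ↔ q j))
    (hcard : (Finset.univ.filter c).card ≠ (Finset.univ.filter b).card) : bordered M B C = 0 := by
  have key : ∀ e : κ → Prop,
      (Finset.univ.filter (Sum.elim q e)).card
        = (Finset.univ.filter q).card + (Finset.univ.filter e).card := by
    intro e
    simp only [Finset.card_filter, Fintype.sum_sum_type, Sum.elim_inl, Sum.elim_inr]
    congr!
  refine det_eq_zero_of_block _ (Sum.elim q c) (Sum.elim q b) ?_ ?_
  · rintro (i | i) (j | j) hij
    · exact hM i j hij
    · exact hB i j hij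
    · exact hC i j hij
    · simp at hij
  · rw [key, key]
    omega

end LinearAlgebra

/-! ### Decoupling of weakly interacting blocks. -/

section Decoupling

open Matrix

variable {n κ : Type} [Fintype n] [Fintype κ]

open Classical in
/-- The matrix with the entries outside of `R` replaced by zero. -/
noncomputable def restr (M : Matrix n n ℂ) (R : n → n → Prop) : Matrix n n ℂ :=
  of fun i j => if R i j then M i j else 0

open Classical in
/-- The vector with the entries outside of `p` replaced by zero. -/
noncomputable def vpart (p : n → Prop) (f : n → ℂ) : n → ℂ := fun i => if p i then f i else 0

lemma l2_vpart_le (p : n → Prop) (f : n → ℂ) : l2 (vpart p f) ≤ l2 f :=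
  l2_mono fun i => by unfold vpart; split_ifs <;> simp

omit [Fintype n] in
lemma vpart_ne_zero {p : n → Prop} {f : n → ℂ} {i : n} (h : vpart p f i ≠ 0) : p i := by
  by_contra hp
  simp [vpart, hp] at h

lemma sum_norm_sq_mono {M M' : Matrix n n ℂ} (h : ∀ i j, ‖M' i j‖ ≤ ‖M i j‖) {c : ℝ}
    (hM : ∑ i, ∑ j, ‖M i j‖ ^ 2 ≤ c) : ∑ i, ∑ j, ‖M' i j‖ ^ 2 ≤ c :=
  (Finset.sum_le_sum fun i _ => Finset.sum_le_sum fun j _ => by have := h i j; gcongr).trans hM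

omit [Fintype n] in
lemma norm_restr_add_le (M : Matrix n n ℂ) (R R' : n → n → Prop) (h : ∀ i j, R i j → ¬ R' i j)
    {τ : ℝ} (hτ : τ ∈ Set.Icc (0 : ℝ) 1) (i j : n) :
    ‖(restr M R + (τ : ℂ) • restr M R') i j‖ ≤ ‖M i j‖ := by
  have h1 : ‖(τ : ℂ)‖ ≤ 1 := by
    rw [Complex.norm_real, Real.norm_of_nonneg hτ.1]; exact hτ.2
  have := h i j
  simp only [restr, Matrix.add_apply, Matrix.smul_apply, of_apply, smul_eq_mul]
  split_ifs
  · tauto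
  · simp
  · rw [zero_add, norm_mul]
    exact mul_le_of_le_one_left (norm_nonneg _) h1
  · simp

variable [DecidableEq n] [DecidableEq κ]

-- The block-diagonal part contributes zero by counting borders, and restoring the off-diagonal
-- blocks costs their trace norm and one more border, whence the `+ 1` in the exponent.
open Classical in
lemma norm_bordered_le_of_coupling {M : Matrix n n ℂ}
    (hM : ∑ i, ∑ j, ‖M i j‖ ^ 2 ≤ Fintype.card n) (q : n → Prop) {T : ℝ}
    (hT : NucLE (restr M fun i j => ¬ (q i ↔ q j)) T)
    {B : Matrix n κ ℂ} {C : Matrix κ n ℂ} (b c : κ → Prop)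
    (hB : ∀ i k, B i k ≠ 0 → (q i ↔ b k)) (hC : ∀ k j, C k j ≠ 0 → (c k ↔ q j))
    (hcard : (Finset.univ.filter c).card ≠ (Finset.univ.filter b).card) :
    ‖bordered M B C‖
      ≤ Real.exp (Fintype.card κ + 1) * (∏ k, (l2 (fun i => B i k) * l2 (C k))) * T := by
  have hsum : M = restr M (fun i j => (q i ↔ q j)) + restr M fun i j => ¬ (q i ↔ q j) := by
    ext i j
    simp only [restr, Matrix.add_apply, of_apply]
    split_ifs <;> simp
  have h0 : bordered (restr M fun i j => (q i ↔ q j)) B C = 0 := by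
    refine bordered_eq_zero q b c (fun i j hij => ?_) hB hC hcard
    by_contra hc
    simp [restr, hc] at hij
  have := norm_bordered_add_sub_le (M := restr M fun i j => (q i ↔ q j)) hT (fun _ => True)
    (fun _ _ _ => ⟨trivial, trivial⟩) B C
    (K := Real.exp (Fintype.card κ + 1) * (∏ k, (l2 (fun i => B i k) * l2 (C k))))
    (mul_nonneg (Real.exp_nonneg _)
      (Finset.prod_nonneg fun _ _ => mul_nonneg (l2_nonneg _) (l2_nonneg _)))
    fun τ hτ u v _ _ => by
      refine (norm_bordered_le (sum_norm_sq_mono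
        (norm_restr_add_le M _ _ (fun i j h => by simpa using h) hτ) hM) _ _).trans (le_of_eq ?_)
      simp only [Fintype.card_sum, Fintype.card_unit, Nat.cast_add, Nat.cast_one,
        Fintype.prod_sum_type, Finset.univ_unique, Finset.prod_singleton]
      rw [mul_assoc]
      rfl
  rwa [← hsum, h0, sub_zero] at this

/-- The determinant bordered by one column and one row. -/
noncomputable def bordered₁ (M : Matrix n n ℂ) (f g : n → ℂ) : ℂ :=
  bordered M (of fun i (_ : Unit) => f i) (of fun (_ : Unit) j => g j)

lemma bordered₁_add_left (M : Matrix n n ℂ) (f f' g : n → ℂ) :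
    bordered₁ M (f + f') g = bordered₁ M f g + bordered₁ M f' g := by
  have key : ∀ f : n → ℂ, bordered₁ M f g
      = ((fromBlocks M 0 (of fun (_ : Unit) j => g j) 0).updateCol (Sum.inr ())
        (Sum.elim f fun _ => 0)).det := by
    intro f
    unfold bordered₁ bordered
    congr 1
    ext (i | i) (j | j) <;> simp
  rw [key, key f, key f', ← det_updateCol_add]
  congr 2
  ext (j | j) <;> simp

lemma bordered₁_add_right (M : Matrix n n ℂ) (f g g' : n → ℂ) :
    bordered₁ M f (g + g') = bordered₁ M f g + bordered₁ M f g' := by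
  have key : ∀ g : n → ℂ, bordered₁ M f g
      = ((fromBlocks M (of fun i (_ : Unit) => f i) 0 0).updateRow (Sum.inr ())
        (Sum.elim g fun _ => 0)).det := by
    intro g
    unfold bordered₁ bordered
    congr 1
    ext (i | i) (j | j) <;> simp [updateRow_apply]
  rw [key, key g, key g', ← det_updateRow_add]
  congr 2
  ext (j | j) <;> simp

lemma norm_bordered₁_le {M : Matrix n n ℂ}
    (hM : ∑ i, ∑ j, ‖M i j‖ ^ 2 ≤ Fintype.card n) (f g : n → ℂ) :
    ‖bordered₁ M f g‖ ≤ Real.exp 1 * (l2 f * l2 g) := by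
  refine (norm_bordered_le hM _ _).trans (le_of_eq ?_)
  simp only [Fintype.card_unit, Nat.cast_one, Finset.univ_unique, Finset.prod_singleton]
  rfl

lemma norm_bordered₁_le_of_coupling {M : Matrix n n ℂ}
    (hM : ∑ i, ∑ j, ‖M i j‖ ^ 2 ≤ Fintype.card n) (q : n → Prop) {T : ℝ}
    (hT : NucLE (restr M fun i j => ¬ (q i ↔ q j)) T) {f g : n → ℂ} (b c : Prop)
    (hf : ∀ i, f i ≠ 0 → (q i ↔ b)) (hg : ∀ i, g i ≠ 0 → (c ↔ q i)) (hbc : ¬ (b ↔ c)) :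
    ‖bordered₁ M f g‖ ≤ Real.exp 2 * (l2 f * l2 g) * T := by
  refine (norm_bordered_le_of_coupling hM q hT (fun _ => b) (fun _ => c)
    (fun i _ h => hf i h) (fun _ j h => hg j h) ?_).trans (le_of_eq ?_)
  · by_cases hb : b <;> by_cases hc : c <;> simp_all
  · simp only [Fintype.card_unit, Nat.cast_one, Finset.univ_unique, Finset.prod_singleton]
    rw [show (1 : ℝ) + 1 = 2 by norm_num]

set_option maxHeartbeats 2000000 in
/-- If the matrix couples three groups `p`, `q` and the rest only weakly, then its bordered
determinant is small provided the column is mostly in `p` and the row mostly in `q`. -/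
lemma norm_bordered₁_decouple {M : Matrix n n ℂ} (hM : ∑ i, ∑ j, ‖M i j‖ ^ 2 ≤ Fintype.card n)
    (p q : n → Prop) (hpq : ∀ i, p i → ¬ q i) {T T' : ℝ}
    (hp : NucLE (restr M fun i j => ¬ q i ∧ ¬ q j ∧ ¬ (p i ↔ p j)) T)
    (hq : NucLE (restr M fun i j => ¬ p i ∧ ¬ p j ∧ ¬ (q i ↔ q j)) T)
    (h : NucLE (restr M fun i j => (p i ∧ q j) ∨ (q i ∧ p j)) T') (f g : n → ℂ) :
    ‖bordered₁ M f g‖ ≤ Real.exp 3 * (T' * (l2 f * l2 g)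
      + (T * l2 f + l2 (vpart (fun i => ¬ p i ∧ ¬ q i) f))
        * (T * l2 g + l2 (vpart (fun i => ¬ p i ∧ ¬ q i) g))
      + l2 (vpart q f) * l2 g + l2 f * l2 (vpart p g)) := by
  set m : n → Prop := fun i => ¬ p i ∧ ¬ q i with hm
  -- The direct coupling between `p` and `q` is removed first, at cost `T'`; afterwards `p` and `q`
  -- communicate only through the middle group.
  set M₁ := restr M fun i j => ¬ ((p i ∧ q j) ∨ (q i ∧ p j)) with hM₁
  -- Testing the trace-norm bound against the zero functional shows that the bound is nonnegative.
  have hT : 0 ≤ T := by simpa using hp 0 1 zero_le_one (fun u v => by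
    simpa using mul_nonneg (l2_nonneg u) (l2_nonneg v))
  have hn := fun v : n → ℂ => l2_nonneg v
  have e12 : Real.exp 1 ≤ Real.exp 3 := Real.exp_le_exp.2 (by norm_num)
  have e23 : Real.exp 2 ≤ Real.exp 3 := Real.exp_le_exp.2 (by norm_num)
  have he := Real.exp_nonneg 3
  have hM1 : ∑ i, ∑ j, ‖M₁ i j‖ ^ 2 ≤ Fintype.card n :=
    sum_norm_sq_mono (fun i j => by simp only [hM₁, restr, of_apply]; split_ifs <;> simp) hM
  have hremove : ‖bordered₁ M f g - bordered₁ M₁ f g‖ ≤ Real.exp 2 * (l2 f * l2 g) * T' := by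
    have hsum : M = M₁ + restr M fun i j => (p i ∧ q j) ∨ (q i ∧ p j) := by
      ext i j
      simp only [hM₁, restr, Matrix.add_apply, of_apply]
      split_ifs <;> simp
    have := norm_bordered_add_sub_le (M := M₁) h (fun _ => True)
      (fun _ _ _ => ⟨trivial, trivial⟩) (of fun i (_ : Unit) => f i) (of fun (_ : Unit) j => g j)
      (K := Real.exp 2 * (l2 f * l2 g)) (by have := hn f; have := hn g; positivity)
      fun τ hτ u v _ _ => by
        refine (norm_bordered_le (sum_norm_sq_mono
          (norm_restr_add_le M _ _ (fun i j h => h) hτ) hM) _ _).trans (le_of_eq ?_)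
        simp only [Fintype.card_sum, Fintype.card_unit, Nat.cast_add, Nat.cast_one,
          Fintype.prod_sum_type, Finset.univ_unique, Finset.prod_singleton]
        rw [show (1 : ℝ) + 1 = 2 by norm_num, mul_assoc (Real.exp 2)]
        rfl
    rwa [← hsum] at this
  -- Stated for every `N` agreeing with `M₁` across the boundary of `q`, so that it also covers the
  -- interpolating matrices in the quadratic step `t6`.
  have hcq : ∀ N : Matrix n n ℂ, (∀ i j, ¬ (q i ↔ q j) → N i j = M₁ i j) →
      NucLE (restr N fun i j => ¬ (q i ↔ q j)) T := by
    intro N hN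
    convert hq using 1
    ext i j
    have h1 := hpq i
    have h2 := hpq j
    have h3 := hN i j
    simp only [hM₁, restr, of_apply] at h3 ⊢
    by_cases a1 : p i <;> by_cases a2 : p j <;> by_cases a3 : q i <;> by_cases a4 : q j <;>
      simp_all
  have hcp : NucLE (restr M₁ fun i j => ¬ (p i ↔ p j)) T := by
    convert hp using 1
    ext i j
    have h1 := hpq i
    have h2 := hpq j
    simp only [hM₁, restr, of_apply]
    by_cases a1 : p i <;> by_cases a2 : p j <;> by_cases a3 : q i <;> by_cases a4 : q j <;>
      simp_all
  have t1 : ‖bordered₁ M₁ (vpart q f) g‖ ≤ Real.exp 3 * (l2 (vpart q f) * l2 g) :=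
    (norm_bordered₁_le hM1 _ _).trans (by have := hn (vpart q f); have := hn g; gcongr)
  have t2 : ‖bordered₁ M₁ (vpart p f + vpart m f) (vpart p g)‖
      ≤ Real.exp 3 * (l2 f * l2 (vpart p g)) := by
    refine (norm_bordered₁_le hM1 _ _).trans ?_
    have : l2 (vpart p f + vpart m f) ≤ l2 f := l2_mono fun i => by
      simp only [Pi.add_apply, vpart, hm]
      split_ifs <;> simp_all
    have := hn (vpart p g)
    have := hn f
    have := hn (vpart p f + vpart m f)
    gcongr
  have t3 : ‖bordered₁ M₁ (vpart m f) (vpart m g)‖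
      ≤ Real.exp 3 * (l2 (vpart m f) * l2 (vpart m g)) :=
    (norm_bordered₁_le hM1 _ _).trans (by
      have := hn (vpart m f); have := hn (vpart m g); gcongr)
  have t4 : ‖bordered₁ M₁ (vpart m f) (vpart q g)‖
      ≤ Real.exp 3 * (l2 (vpart m f) * (T * l2 g)) := by
    refine (norm_bordered₁_le_of_coupling hM1 q (hcq M₁ fun _ _ _ => rfl) False True
      (fun i hi => ?_) (fun i hi => ?_) (by simp)).trans ?_
    · simpa using (vpart_ne_zero hi).2
    · simpa using vpart_ne_zero hi
    · have := hn (vpart m f)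
      have := l2_vpart_le q g
      have := hn (vpart q g)
      have := hn g
      calc _ ≤ Real.exp 3 * (l2 (vpart m f) * l2 g) * T := by gcongr
        _ = _ := by ring
  have t5 : ‖bordered₁ M₁ (vpart p f) (vpart m g)‖
      ≤ Real.exp 3 * ((T * l2 f) * l2 (vpart m g)) := by
    refine (norm_bordered₁_le_of_coupling hM1 p hcp True False
      (fun i hi => ?_) (fun i hi => ?_) (by simp)).trans ?_
    · simpa using vpart_ne_zero hi
    · simpa using (vpart_ne_zero hi).1
    · have := hn (vpart m g)
      have := l2_vpart_le p f
      have := hn (vpart p f)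
      have := hn f
      calc _ ≤ Real.exp 3 * (l2 f * l2 (vpart m g)) * T := by gcongr
        _ = _ := by ring
  -- The decisive term, quadratic in `T`. Cutting `p` off makes the determinant vanish, at cost `T`;
  -- the extra borders created by this are supported off `q`, so the resulting determinants still
  -- have one row but no column in `q` and gain a second factor `T`.
  have t6 : ‖bordered₁ M₁ (vpart p f) (vpart q g)‖
      ≤ Real.exp 3 * ((T * l2 f) * (T * l2 g)) := by
    set M₂ := restr M₁ fun i j => (p i ↔ p j) with hM₂
    have hsum : M₁ = M₂ + restr M₁ fun i j => ¬ (p i ↔ p j) := by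
      ext i j
      simp only [hM₂, restr, Matrix.add_apply, of_apply]
      split_ifs <;> simp
    have h0 : bordered₁ M₂ (vpart p f) (vpart q g) = 0 := by
      refine bordered_eq_zero p (fun _ => True) (fun _ => False) (fun i j hij => ?_)
        (fun i _ hi => ?_) (fun _ i hi => ?_) (by simp)
      · by_contra hc
        simp [hM₂, restr, hc] at hij
      · simpa using vpart_ne_zero hi
      · have := vpart_ne_zero (show vpart q g i ≠ 0 from hi)
        simpa using fun hp => hpq i hp this
    have := norm_bordered_add_sub_le (M := M₂) hcp (fun i => ¬ q i)
      (fun i j hij => by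
        have h1 := hpq i
        have h2 := hpq j
        simp only [hM₁, restr, of_apply, ne_eq, ite_eq_right_iff, not_forall] at hij
        tauto)
      (of fun i (_ : Unit) => vpart p f i) (of fun (_ : Unit) j => vpart q g j)
      (K := Real.exp 3 * (l2 f * l2 g) * T) (by have := hn f; have := hn g; positivity)
      fun τ hτ u v hu hv => by
        have h1 := norm_bordered_le_of_coupling (M := M₂ + (τ : ℂ) • restr M₁ fun i j => ¬ (p i ↔ p j))
          (sum_norm_sq_mono (norm_restr_add_le M₁ _ _ (fun i j h => by simpa using h) hτ) hM1) q
          (hcq _ fun i j hij => by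
            have h1 := hpq i
            have h2 := hpq j
            by_cases hpp : p i ↔ p j
            · rw [Matrix.add_apply, Matrix.smul_apply, hM₂]
              unfold restr
              rw [of_apply, of_apply, if_pos hpp, if_neg (not_not.2 hpp), smul_zero, add_zero]
            · have h0 : M₁ i j = 0 := by
                rw [hM₁]
                unfold restr
                rw [of_apply, if_neg (by tauto)]
              rw [Matrix.add_apply, Matrix.smul_apply, hM₂]
              unfold restr
              rw [of_apply, of_apply, h0]
              simp)
          (B := extCol (of fun i (_ : Unit) => vpart p f i) u)
          (C := extRow (of fun (_ : Unit) j => vpart q g j) v)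
          (fun _ => False) (Sum.elim (fun _ => True) fun _ => False) ?_ ?_ ?_
        · refine h1.trans ?_
          simp only [Fintype.card_sum, Fintype.card_unit, Nat.cast_add, Nat.cast_one,
            Fintype.prod_sum_type, Finset.univ_unique, Finset.prod_singleton]
          have e1 := l2_vpart_le p f
          have e2 := l2_vpart_le q g
          have := hn u
          have := hn v
          have := hn (vpart q g)
          have := hn f
          have := hn g
          have := hn (vpart p f)
          calc _ = Real.exp 3 * (l2 (vpart p f) * l2 (vpart q g) * (l2 u * l2 v)) * T := by
                rw [show (1 : ℝ) + 1 + 1 = 3 by norm_num]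
                rfl
            _ ≤ Real.exp 3 * (l2 f * l2 g * (l2 u * l2 v)) * T := by gcongr
            _ = _ := by ring
        · rintro i (k | k) hik
          · simpa using hpq i (vpart_ne_zero hik)
          · simpa using hu i hik
        · rintro (k | k) i hik
          · simpa using vpart_ne_zero (show vpart q g i ≠ 0 from hik)
          · simpa using hv i hik
        · rw [Finset.filter_false, Finset.card_empty]
          exact Finset.card_ne_zero.2 ⟨Sum.inl (), by simp⟩
    rw [← hsum] at this
    change ‖bordered₁ M₁ (vpart p f) (vpart q g) - bordered₁ M₂ (vpart p f) (vpart q g)‖ ≤ _ at this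
    rw [h0, sub_zero] at this
    exact this.trans (le_of_eq (by ring))
  have hsplit : ∀ f : n → ℂ, f = vpart q f + (vpart p f + vpart m f) := by
    intro f
    funext i
    have := hpq i
    simp only [Pi.add_apply, vpart, hm]
    split_ifs <;> simp_all
  -- Column parts in `q` and row parts in `p` are small by assumption and are split off whole; the
  -- remaining columns in `p` or the middle meet rows in `q` or the middle.
  have hdec : bordered₁ M₁ f g = bordered₁ M₁ (vpart q f) g
      + bordered₁ M₁ (vpart p f + vpart m f) (vpart p g)
      + bordered₁ M₁ (vpart m f) (vpart m g) + bordered₁ M₁ (vpart m f) (vpart q g)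
      + bordered₁ M₁ (vpart p f) (vpart m g) + bordered₁ M₁ (vpart p f) (vpart q g) := by
    conv_lhs => rw [hsplit f, bordered₁_add_left]
    have : bordered₁ M₁ (vpart p f + vpart m f) g
        = bordered₁ M₁ (vpart p f + vpart m f) (vpart q g + (vpart p g + vpart m g)) := by
      rw [← hsplit g]
    rw [this, bordered₁_add_right, bordered₁_add_right, bordered₁_add_left M₁ _ _ (vpart q g),
      bordered₁_add_left M₁ _ _ (vpart m g)]
    ring
  have hfin : ‖bordered₁ M f g‖ ≤ ‖bordered₁ M f g - bordered₁ M₁ f g‖ + ‖bordered₁ M₁ f g‖ := by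
    simpa using norm_add_le (bordered₁ M f g - bordered₁ M₁ f g) (bordered₁ M₁ f g)
  have hT' : 0 ≤ T' := by simpa using h 0 1 zero_le_one (fun u v => by
    simpa using mul_nonneg (l2_nonneg u) (l2_nonneg v))
  have hremove_exp_three : ‖bordered₁ M f g - bordered₁ M₁ f g‖ ≤ Real.exp 3 * (l2 f * l2 g) * T' :=
    hremove.trans (by have := hn f; have := hn g; gcongr)
  have htri : ‖bordered₁ M₁ f g‖ ≤ ‖bordered₁ M₁ (vpart q f) g‖
      + ‖bordered₁ M₁ (vpart p f + vpart m f) (vpart p g)‖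
      + ‖bordered₁ M₁ (vpart m f) (vpart m g)‖ + ‖bordered₁ M₁ (vpart m f) (vpart q g)‖
      + ‖bordered₁ M₁ (vpart p f) (vpart m g)‖ + ‖bordered₁ M₁ (vpart p f) (vpart q g)‖ := by
    rw [hdec]
    refine (norm_add_le _ _).trans (add_le_add_left ?_ _)
    refine (norm_add_le _ _).trans (add_le_add_left ?_ _)
    refine (norm_add_le _ _).trans (add_le_add_left ?_ _)
    refine (norm_add_le _ _).trans (add_le_add_left ?_ _)
    exact norm_add_le _ _
  calc _ ≤ _ := hfin
    _ ≤ _ := add_le_add hremove_exp_three (htri.trans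
      (add_le_add (add_le_add (add_le_add (add_le_add (add_le_add t1 t2) t3) t4) t5) t6))
    _ = _ := by ring

end Decoupling

/-! ### Arcs and distances on the discrete torus. -/

section Geometry

/-- The distance on the discrete torus. -/
def td (L a b : ℕ) : ℕ := min (max a b - min a b) (L - (max a b - min a b))

lemma td_comm (L a b : ℕ) : td L a b = td L b a := by
  simp only [td, max_comm, min_comm]

lemma torusDist_eq {L a b : ℕ} (ha : a ≤ L) (hb : b ≤ L) : torusDist L a b = td L a b := by
  have h1 : |(a : ℝ) - b| = ((max a b - min a b : ℕ) : ℝ) := by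
    rw [Nat.cast_sub (by omega)]
    push_cast
    rw [max_sub_min_eq_abs']
  have h2 : (L : ℝ) - |(a : ℝ) - b| = ((L - (max a b - min a b) : ℕ) : ℝ) := by
    rw [Nat.cast_sub (by omega), h1]
  rw [torusDist, h1]
  rw [h1] at h2
  rw [h2, td]
  push_cast
  rfl

lemma td_triangle {L a b c : ℕ} (ha : a ≤ L) (hb : b ≤ L) (hc : c ≤ L) :
    td L a c ≤ td L a b + td L b c := by
  unfold td
  omega

/-- The cells of the two arcs between `n` and `m`. -/
def arc (L n m : ℕ) : Bool → Finset ℕ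
  | true => Finset.Icc (min n m) (max n m)
  | false => Finset.Icc 1 (min n m) ∪ Finset.Icc (max n m) L

/-- The arc opposite to a cell. -/
def oppArc (n m c : ℕ) : Bool := !decide (min n m ≤ c ∧ c ≤ max n m)

/-- The arc through which a cell near `n` and a cell near `m` are the least connected. -/
def farArc (L n m c c' : ℕ) : Bool :=
  if min n m ≤ c ∧ c ≤ max n m then
    if min n m ≤ c' ∧ c' ≤ max n m then false else decide (td L c n ≤ td L c' m)
  else
    if min n m ≤ c' ∧ c' ≤ max n m then decide (td L c' m ≤ td L c n) else true

lemma td_le_left (L a b : ℕ) : td L a b ≤ max a b - min a b := min_le_left _ _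

lemma td_le_right (L a b : ℕ) : td L a b ≤ L - (max a b - min a b) := min_le_right _ _

/-- A path between the two arcs passes through one of the end points. -/
lemma td_add_td_le {L n m c a : ℕ} (hn : n ≤ L) (hm : m ≤ L) (hc : min n m ≤ c ∧ c ≤ max n m)
    (ha : a ≤ min n m ∨ max n m ≤ a) (haL : a ≤ L) :
    td L c n + td L n a ≤ td L c a ∨ td L c m + td L m a ≤ td L c a := by
  have h1 := td_le_left L c n
  have h2 := td_le_right L c n
  have h3 := td_le_left L n a
  have h4 := td_le_right L n a
  have h5 := td_le_left L c m
  have h6 := td_le_right L c m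
  have h7 := td_le_left L m a
  have h8 := td_le_right L m a
  generalize td L c n = x1 at *
  generalize td L n a = x2 at *
  generalize td L c m = x3 at *
  generalize td L m a = x4 at *
  unfold td
  rcases le_total n m with hnm | hnm
  · simp only [min_eq_left hnm, max_eq_right hnm] at *
    rcases ha with ha | ha
    · simp only [max_eq_left hc.1, min_eq_right hc.1, max_eq_left ha, min_eq_right ha,
        max_eq_right hc.2, min_eq_left hc.2, max_eq_left (ha.trans hc.1),
        min_eq_right (ha.trans hc.1), max_eq_left (ha.trans hnm), min_eq_right (ha.trans hnm)] at *
      omega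
    · simp only [max_eq_left hc.1, min_eq_right hc.1, max_eq_right ha, min_eq_left ha,
        max_eq_right hc.2, min_eq_left hc.2, max_eq_right (hc.2.trans ha),
        min_eq_left (hc.2.trans ha), max_eq_right (hnm.trans ha), min_eq_left (hnm.trans ha)] at *
      omega
  · simp only [min_eq_right hnm, max_eq_left hnm] at *
    rcases ha with ha | ha
    · simp only [max_eq_left hc.1, min_eq_right hc.1, max_eq_left ha, min_eq_right ha,
        max_eq_right hc.2, min_eq_left hc.2, max_eq_left (ha.trans hc.1),
        min_eq_right (ha.trans hc.1), max_eq_left (ha.trans hnm), min_eq_right (ha.trans hnm)] at *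
      omega
    · simp only [max_eq_left hc.1, min_eq_right hc.1, max_eq_right ha, min_eq_left ha,
        max_eq_right hc.2, min_eq_left hc.2, max_eq_right (hc.2.trans ha),
        min_eq_left (hc.2.trans ha), max_eq_right (hnm.trans ha), min_eq_left (hnm.trans ha)] at *
      omega

lemma mem_arc_true {L n m a : ℕ} : a ∈ arc L n m true ↔ min n m ≤ a ∧ a ≤ max n m := by
  simp only [arc, Finset.mem_Icc]

lemma of_mem_arc_false {L n m a : ℕ} (hn : n ≤ L) (h : a ∈ arc L n m false) :
    a ≤ L ∧ (a ≤ min n m ∨ max n m ≤ a) := by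
  simp only [arc, Finset.mem_union, Finset.mem_Icc] at h
  omega

lemma le_of_mem_arc {L n m a : ℕ} (hn : n ≤ L) (hm : m ≤ L) {s : Bool} (h : a ∈ arc L n m s) :
    a ≤ L := by
  cases s
  · exact (of_mem_arc_false hn h).1
  · have := (mem_arc_true.1 h).2
    omega

/-- Reaching the arc that does not contain `c` requires passing through `n` or `m`. -/
lemma le_td_of_mem_oppArc {L n m c a : ℕ} (hn : n ≤ L) (hm : m ≤ L) (hc : c ≤ L)
    (ha : a ∈ arc L n m (oppArc n m c)) : td L c n ≤ td L c a ∨ td L c m ≤ td L c a := by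
  by_cases h : min n m ≤ c ∧ c ≤ max n m
  · simp only [oppArc, h, and_self, decide_true, Bool.not_true] at ha
    have ha' := of_mem_arc_false hn ha
    have := td_add_td_le hn hm h ha'.2 ha'.1
    omega
  · simp only [oppArc, h, decide_false, Bool.not_false] at ha
    have h' : c ≤ min n m ∨ max n m ≤ c := by omega
    have := td_add_td_le hn hm (mem_arc_true.1 ha) h' hc
    rw [td_comm L a c, td_comm L n c, td_comm L m c] at this
    omega

/-- In the critical case the crossing path and the triangle inequality give `td L c a + td L c' a ≥
td L n m`; two such numbers are either both at least `2/5` of the total, or one is at least `3/5` of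
it. If `c` and `c'` lie in different arcs, `farArc` makes the cell with the larger distance to its
end point do the crossing, and this larger distance compensates for the smaller one. -/
lemma le_td_of_mem_farArc {L n m c c' a : ℕ} (hn : n ≤ L) (hm : m ≤ L)
    (hcL : c ≤ L) (hcL' : c' ≤ L)
    (hc : 5 * td L c n < 2 * td L n m) (hc' : 5 * td L c' m < 2 * td L n m)
    (ha : a ∈ arc L n m (farArc L n m c c')) :
    3 * td L n m ≤ 5 * td L c a ∨ 3 * td L n m ≤ 5 * td L c' a ∨
      (2 * td L n m ≤ 5 * td L c a ∧ 2 * td L n m ≤ 5 * td L c' a) := by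
  have haL : a ≤ L := le_of_mem_arc hn hm ha
  have cross : ∀ c ≤ L, ∀ s, (min n m ≤ c ∧ c ≤ max n m ↔ s = false) → a ∈ arc L n m s →
      td L c n + td L n a ≤ td L c a ∨ td L c m + td L m a ≤ td L c a := by
    intro c hcL s hs ha
    cases s
    · have ha' := of_mem_arc_false hn ha
      exact td_add_td_le hn hm (hs.2 rfl) ha'.2 ha'.1
    · have h' : c ≤ min n m ∨ max n m ≤ c := by
        have : ¬ (min n m ≤ c ∧ c ≤ max n m) := fun h => by simpa using hs.1 h
        omega
      have := td_add_td_le hn hm (mem_arc_true.1 ha) h' hcL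
      rw [td_comm L a c, td_comm L n c, td_comm L m c, td_comm L a n, td_comm L a m] at this
      omega
  have t1 := td_triangle hn hcL hm
  have t2 := td_triangle hn hcL' hm
  have t3 := td_triangle hn haL hm
  have t4 := td_triangle hcL haL hm
  have t5 := td_triangle hcL' haL hn
  rw [td_comm L n c] at t1
  rw [td_comm L n c'] at t2
  rw [td_comm L a m] at t3 t4
  rw [td_comm L a n] at t5
  unfold farArc at ha
  split_ifs at ha with h h' h'
  · have k1 := cross c hcL _ (by simpa using h) ha
    have k2 := cross c' hcL' _ (by simpa using h') ha
    omega
  · by_cases hd : td L c n ≤ td L c' m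
    · rw [decide_eq_true hd] at ha
      have k2 := cross c' hcL' _ (by simpa using h') ha
      omega
    · rw [decide_eq_false hd] at ha
      have k1 := cross c hcL _ (by simpa using h) ha
      omega
  · by_cases hd : td L c' m ≤ td L c n
    · rw [decide_eq_true hd] at ha
      have k1 := cross c hcL _ (by simpa using h) ha
      omega
    · rw [decide_eq_false hd] at ha
      have k2 := cross c' hcL' _ (by simpa using h') ha
      omega
  · have k1 := cross c hcL _ (by simpa using h) ha
    have k2 := cross c' hcL' _ (by simpa using h') ha
    omega

end Geometry

/-! ### Trace norms of weighted overlap matrices, and the coupling to the middle group. -/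

section NuclearBounds

open Matrix

variable {ι : Type} [Fintype ι] {E : Type*} [NormedAddCommGroup E] [InnerProductSpace ℂ E]

local notation "⟪" x ", " y "⟫" => inner ℂ x y

/-- The matrix of the quadratic form of `ρ`, weighted by `w` and `w'`. -/
noncomputable def weighted (b ρ : ι → E) (w w' : ι → ℝ) : Matrix ι ι ℂ :=
  of fun i j => ((w i * w' j : ℝ) : ℂ) * ⟪b j, ρ i⟫

/-- Bessel's inequality bounds the norm of row `i` by `w i * ‖ρ i‖`. -/
lemma nucLE_weighted_row {b ρ : ι → E} (hb : Orthonormal ℂ b) {w w' : ι → ℝ} (hw : ∀ i, 0 ≤ w i)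
    (hw0 : ∀ i, 0 ≤ w' i) (hw1 : ∀ i, w' i ≤ 1) :
    NucLE (weighted b ρ w w') (∑ i, w i * ‖ρ i‖) := by
  classical
  refine (NucLE.of_rows _).mono (Finset.sum_le_sum fun i _ => ?_)
  refine Real.sqrt_le_iff.2 ⟨mul_nonneg (hw i) (norm_nonneg _), ?_⟩
  calc ∑ j, ‖weighted b ρ w w' i j‖ ^ 2 ≤ ∑ j, w i ^ 2 * ‖⟪b j, ρ i⟫‖ ^ 2 := by
        refine Finset.sum_le_sum fun j _ => ?_
        simp only [weighted, of_apply, norm_mul, Complex.norm_real, Real.norm_of_nonneg (hw i),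
          Real.norm_of_nonneg (hw0 j), mul_pow, Complex.ofReal_mul]
        have : w' j ^ 2 ≤ 1 := pow_le_one₀ (hw0 j) (hw1 j)
        have h2 := sq_nonneg (w i)
        have h3 := sq_nonneg ‖⟪b j, ρ i⟫‖
        calc _ ≤ w i ^ 2 * 1 * ‖⟪b j, ρ i⟫‖ ^ 2 := by gcongr
          _ = _ := by ring
    _ = w i ^ 2 * ∑ j, ‖⟪b j, ρ i⟫‖ ^ 2 := by rw [Finset.mul_sum]
    _ ≤ w i ^ 2 * ‖ρ i‖ ^ 2 := by
        gcongr
        exact hb.sum_inner_products_le (ρ i)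
    _ = _ := by ring

omit [Fintype ι] in
lemma inner_comm_of_inner {b ρ : ι → E} (hρ : ∀ i j, ⟪b j, ρ i⟫ = ⟪ρ j, ρ i⟫) (i j : ι) :
    ‖⟪b j, ρ i⟫‖ = ‖⟪b i, ρ j⟫‖ := by
  rw [hρ, hρ, norm_inner_symm]

/-- The assumption `hρ` makes the moduli of the overlaps symmetric, so that Bessel's inequality also
applies to columns. -/
lemma nucLE_weighted_col {b ρ : ι → E} (hb : Orthonormal ℂ b)
    (hρ : ∀ i j, ⟪b j, ρ i⟫ = ⟪ρ j, ρ i⟫) {w w' : ι → ℝ} (hw0 : ∀ i, 0 ≤ w i)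
    (hw1 : ∀ i, w i ≤ 1) (hw : ∀ i, 0 ≤ w' i) :
    NucLE (weighted b ρ w w') (∑ i, w' i * ‖ρ i‖) := by
  classical
  refine (NucLE.of_columns _).mono (Finset.sum_le_sum fun j _ => ?_)
  refine Real.sqrt_le_iff.2 ⟨mul_nonneg (hw j) (norm_nonneg _), ?_⟩
  calc ∑ i, ‖weighted b ρ w w' i j‖ ^ 2 ≤ ∑ i, w' j ^ 2 * ‖⟪b i, ρ j⟫‖ ^ 2 := by
        refine Finset.sum_le_sum fun i _ => ?_
        simp only [weighted, of_apply, norm_mul, Complex.norm_real, Real.norm_of_nonneg (hw0 i),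
          Real.norm_of_nonneg (hw j), mul_pow, Complex.ofReal_mul]
        rw [inner_comm_of_inner hρ]
        have : w i ^ 2 ≤ 1 := pow_le_one₀ (hw0 i) (hw1 i)
        have h2 := sq_nonneg (w' j)
        have h3 := sq_nonneg ‖⟪b i, ρ j⟫‖
        calc _ ≤ 1 * w' j ^ 2 * ‖⟪b i, ρ j⟫‖ ^ 2 := by gcongr
          _ = _ := by ring
    _ = w' j ^ 2 * ∑ i, ‖⟪b i, ρ j⟫‖ ^ 2 := by rw [Finset.mul_sum]
    _ ≤ w' j ^ 2 * ‖ρ j‖ ^ 2 := by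
        gcongr
        exact hb.sum_inner_products_le (ρ j)
    _ = _ := by ring

/-- Summing the moduli of all entries loses orthogonality but produces a product of two sums, which
is what gives a product of two correlators. -/
lemma nucLE_weighted_entries {b ρ : ι → E} (hρ : ∀ i j, ⟪b j, ρ i⟫ = ⟪ρ j, ρ i⟫) {w w' : ι → ℝ}
    (hw : ∀ i, 0 ≤ w i) (hw' : ∀ i, 0 ≤ w' i) :
    NucLE (weighted b ρ w w') ((∑ i, w i * ‖ρ i‖) * ∑ i, w' i * ‖ρ i‖) := by
  classical
  refine (NucLE.of_entries _).mono ?_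
  rw [Finset.sum_mul_sum]
  refine Finset.sum_le_sum fun i _ => Finset.sum_le_sum fun j _ => ?_
  simp only [weighted, of_apply, norm_mul, Complex.norm_real, Real.norm_of_nonneg (hw i),
    Real.norm_of_nonneg (hw' j), Complex.ofReal_mul]
  rw [hρ]
  have := norm_inner_le_norm (𝕜 := ℂ) (ρ j) (ρ i)
  have := hw i
  have := hw' j
  calc _ ≤ w i * w' j * (‖ρ j‖ * ‖ρ i‖) := by gcongr
    _ = _ := by ring

/-- A matrix `M` whose off-diagonal entries are given by overlaps of orthonormal vectors on either
of the two arcs between the cells `n` and `m` of the torus of length `L`. -/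
structure ArcOverlap (L n m : ℕ) (M : Matrix ι ι ℂ) (Φ : ι → ℕ → ℝ) (b : ι → E)
    (r : Bool → ℕ → ι → E) : Prop where
  orth : Orthonormal ℂ b
  inner_eq : ∀ s a i j, ⟪b j, r s a i⟫ = ⟪r s a j, r s a i⟫
  norm_le : ∀ s a i, ‖r s a i‖ ≤ Φ i a
  nonneg : ∀ i a, 0 ≤ Φ i a
  sum_sq : ∀ i, ∑ c ∈ Finset.Icc 1 L, Φ i c ^ 2 = 1
  entry : ∀ s : Bool, ∃ κ : ℂ, ‖κ‖ ≤ 2 ∧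
    ∀ i j, i ≠ j → M i j = κ * ∑ a ∈ arc L n m s, ⟪b j, r s a i⟫
  n_pos : 1 ≤ n
  n_le : n ≤ L
  m_pos : 1 ≤ m
  m_le : m ≤ L

lemma arc_comm (L n m : ℕ) : arc L n m = arc L m n := by
  funext s
  cases s <;> simp [arc, min_comm, max_comm]

/-- The correlator of a finite family. -/
noncomputable def qcor (Φ : ι → ℕ → ℝ) (c a : ℕ) : ℝ := ∑ i, Φ i c * Φ i a

/-- The sum of the correlators at distance at least `k / 5` times the distance of `n` and `m`. -/
noncomputable def farSum (Φ : ι → ℕ → ℝ) (L n m k : ℕ) : ℝ :=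
  ∑ c ∈ Finset.Icc 1 L, ∑ a ∈ Finset.Icc 1 L,
    if k * td L n m ≤ 5 * td L c a ∧ (td L c n ≤ td L c a ∨ td L c m ≤ td L c a)
    then qcor Φ c a else 0

lemma farSum_comm (Φ : ι → ℕ → ℝ) (L n m k : ℕ) : farSum Φ L n m k = farSum Φ L m n k := by
  simp only [farSum, td_comm L n m, or_comm]

/-- The cells in the inner neighborhood of `n`. -/
def nearCells (L n m : ℕ) : Finset ℕ := (Finset.Icc 1 L).filter fun c => 5 * td L c n < 2 * td L n m

def midCells (L n m : ℕ) : Finset ℕ :=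
  (Finset.Icc 1 L).filter fun c => 2 * td L n m ≤ 5 * td L c n ∧ 2 * td L n m ≤ 5 * td L c m

/-- The mass of a function in a set of cells. -/
noncomputable def mass (Φ : ι → ℕ → ℝ) (F : Finset ℕ) (i : ι) : ℝ := ∑ c ∈ F, Φ i c ^ 2

open Classical in
/-- The share of the cell `c` in the mass of a function in `F`, restricted to the group `α`. -/
noncomputable def share (Φ : ι → ℕ → ℝ) (F : Finset ℕ) (α : ι → Prop) (c : ℕ) (i : ι) : ℝ :=
  if α i then Φ i c ^ 2 / mass Φ F i else 0

namespace ArcOverlap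

variable {L n m : ℕ} {M : Matrix ι ι ℂ} {Φ : ι → ℕ → ℝ} {b : ι → E} {r : Bool → ℕ → ι → E}

omit [Fintype ι] in
lemma swap (h : ArcOverlap L n m M Φ b r) : ArcOverlap L m n M Φ b r where
  orth := h.orth
  inner_eq := h.inner_eq
  norm_le := h.norm_le
  nonneg := h.nonneg
  sum_sq := h.sum_sq
  entry := by simpa only [arc_comm L m n] using h.entry
  n_pos := h.m_pos
  n_le := h.m_le
  m_pos := h.n_pos
  m_le := h.n_le

omit [Fintype ι] in
lemma le_one (h : ArcOverlap L n m M Φ b r) (i : ι) {c : ℕ} (hc : c ∈ Finset.Icc 1 L) :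
    Φ i c ≤ 1 := by
  have h1 := Finset.single_le_sum (f := fun c => Φ i c ^ 2) (fun _ _ => sq_nonneg _) hc
  rw [h.sum_sq i] at h1
  have := h.nonneg i c
  nlinarith

lemma qcor_nonneg (h : ArcOverlap L n m M Φ b r) (c a : ℕ) : 0 ≤ qcor Φ c a :=
  Finset.sum_nonneg fun i _ => mul_nonneg (h.nonneg i c) (h.nonneg i a)

omit [Fintype ι] in
lemma share_nonneg (F : Finset ℕ) (α : ι → Prop) (c : ℕ) (i : ι) : 0 ≤ share Φ F α c i := by
  unfold share mass
  split_ifs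
  · exact div_nonneg (sq_nonneg _) (Finset.sum_nonneg fun _ _ => sq_nonneg _)
  · exact le_rfl

omit [Fintype ι] in
open Classical in
lemma sum_share {F : Finset ℕ} {α : ι → Prop} (hα : ∀ i, α i → 1 / 3 ≤ mass Φ F i) (i : ι) :
    ∑ c ∈ F, share Φ F α c i = if α i then 1 else 0 := by
  unfold share
  split_ifs with hi
  · rw [← Finset.sum_div]
    have := hα i hi
    exact div_self (by unfold mass at *; linarith)
  · simp

omit [Fintype ι] in
lemma sum_share_le {F F' : Finset ℕ} (hF : F' ⊆ F) {α : ι → Prop}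
    (hα : ∀ i, α i → 1 / 3 ≤ mass Φ F i) (i : ι) : ∑ c ∈ F', share Φ F α c i ≤ 1 := by
  refine (Finset.sum_le_sum_of_subset_of_nonneg hF fun _ _ _ => share_nonneg _ _ _ _).trans ?_
  rw [sum_share hα]
  split_ifs <;> norm_num

/-- The mass in `F` is at least `1/3` and `Φ i c ≤ 1`, so a share is at most `3 * Φ i c ^ 2 ≤ 3 * Φ
i c`. -/
lemma sum_share_mul_le (h : ArcOverlap L n m M Φ b r) {F : Finset ℕ} (hF : F ⊆ Finset.Icc 1 L)
    {α : ι → Prop} (hα : ∀ i, α i → 1 / 3 ≤ mass Φ F i) {c : ℕ} (hc : c ∈ F) (a : ℕ) :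
    ∑ i, share Φ F α c i * Φ i a ≤ 3 * qcor Φ c a := by
  rw [qcor, Finset.mul_sum]
  refine Finset.sum_le_sum fun i _ => ?_
  have h1 := h.nonneg i c
  have h2 := h.nonneg i a
  have h3 := h.le_one i (hF hc)
  rw [← mul_assoc]
  refine mul_le_mul_of_nonneg_right ?_ h2
  unfold share
  split_ifs with hi
  · have := hα i hi
    rw [div_le_iff₀ (by linarith)]
    nlinarith
  · linarith

lemma sum_share_norm_le (h : ArcOverlap L n m M Φ b r) {F : Finset ℕ} (hF : F ⊆ Finset.Icc 1 L)
    {α : ι → Prop} (hα : ∀ i, α i → 1 / 3 ≤ mass Φ F i) {c : ℕ} (hc : c ∈ F) (s : Bool) (a : ℕ) :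
    ∑ i, share Φ F α c i * ‖r s a i‖ ≤ 3 * qcor Φ c a :=
  (Finset.sum_le_sum fun i _ => mul_le_mul_of_nonneg_left (h.norm_le s a i)
    (share_nonneg _ _ _ _)).trans (h.sum_share_mul_le hF hα hc a)

-- The shares of the cells in `F` form a partition of unity on the group `α`.
open Classical in
lemma sum_group_le (h : ArcOverlap L n m M Φ b r) {F : Finset ℕ} (hF : F ⊆ Finset.Icc 1 L)
    {α : ι → Prop} (hα : ∀ i, α i → 1 / 3 ≤ mass Φ F i) (a : ℕ) :
    ∑ i, (if α i then Φ i a else 0) ≤ 3 * ∑ c ∈ F, qcor Φ c a := by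
  have : ∀ i, (if α i then Φ i a else 0) = ∑ c ∈ F, share Φ F α c i * Φ i a := fun i => by
    rw [← Finset.sum_mul, sum_share hα]
    split_ifs <;> simp
  simp_rw [this]
  rw [Finset.sum_comm, Finset.mul_sum]
  exact Finset.sum_le_sum fun c hc => h.sum_share_mul_le hF hα hc a

lemma sum_le_farSum (h : ArcOverlap L n m M Φ b r) {k : ℕ} {F : Finset ℕ}
    (hF : F ⊆ Finset.Icc 1 L) {G : ℕ → Finset ℕ} (hG : ∀ c ∈ F, G c ⊆ Finset.Icc 1 L)
    (hk : ∀ c ∈ F, ∀ a ∈ G c, k * td L n m ≤ 5 * td L c a ∧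
      (td L c n ≤ td L c a ∨ td L c m ≤ td L c a)) :
    ∑ c ∈ F, ∑ a ∈ G c, qcor Φ c a ≤ farSum Φ L n m k := by
  have hnn : ∀ c a, 0 ≤ if k * td L n m ≤ 5 * td L c a ∧
      (td L c n ≤ td L c a ∨ td L c m ≤ td L c a) then qcor Φ c a else 0 := fun c a => by
    split_ifs
    · exact h.qcor_nonneg c a
    · exact le_rfl
  calc ∑ c ∈ F, ∑ a ∈ G c, qcor Φ c a
      = ∑ c ∈ F, ∑ a ∈ G c, if k * td L n m ≤ 5 * td L c a ∧
        (td L c n ≤ td L c a ∨ td L c m ≤ td L c a) then qcor Φ c a else 0 :=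
        Finset.sum_congr rfl fun c hc => Finset.sum_congr rfl fun a ha => (if_pos (hk c hc a ha)).symm
    _ ≤ ∑ c ∈ F, ∑ a ∈ Finset.Icc 1 L, if k * td L n m ≤ 5 * td L c a ∧
        (td L c n ≤ td L c a ∨ td L c m ≤ td L c a) then qcor Φ c a else 0 :=
        Finset.sum_le_sum fun c hc => Finset.sum_le_sum_of_subset_of_nonneg (hG c hc)
          fun a _ _ => hnn c a
    _ ≤ _ := Finset.sum_le_sum_of_subset_of_nonneg hF
          fun c _ _ => Finset.sum_nonneg fun a _ => hnn c a

lemma farSum_nonneg (h : ArcOverlap L n m M Φ b r) (k : ℕ) : 0 ≤ farSum Φ L n m k := by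
  simpa using h.sum_le_farSum (k := k) (F := ∅) (G := fun _ => ∅) (by simp) (by simp) (by simp)

omit [Fintype ι] in
lemma arc_subset (h : ArcOverlap L n m M Φ b r) (s : Bool) : arc L n m s ⊆ Finset.Icc 1 L := by
  have h1 := h.n_pos
  have h2 := h.n_le
  have h3 := h.m_pos
  have h4 := h.m_le
  intro a ha
  cases s <;> simp only [arc, Finset.mem_union, Finset.mem_Icc] at ha ⊢ <;> omega

omit [Fintype ι] in
lemma mid_mem (h : ArcOverlap L n m M Φ b r) {c a : ℕ} (hc : c ∈ midCells L n m)
    (ha : a ∈ arc L n m (oppArc n m c)) :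
    2 * td L n m ≤ 5 * td L c a ∧ (td L c n ≤ td L c a ∨ td L c m ≤ td L c a) := by
  simp only [midCells, Finset.mem_filter, Finset.mem_Icc] at hc
  have := le_td_of_mem_oppArc h.n_le h.m_le hc.1.2 ha
  omega

-- Each function of the middle group is distributed over its cells `c` by `share`, and for each `c`
-- the matrix entries are computed on the arc opposite to `c`, all of whose cells are far from `c`.
-- The constant is `6 = 2 * 3`: `2` from the factor `κ`, `3` from the shares.
open Classical in
lemma nucLE_mid_right (h : ArcOverlap L n m M Φ b r) {α β : ι → Prop} (hαβ : ∀ i, α i → ¬ β i)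
    (hβ : ∀ i, β i → 1 / 3 ≤ mass Φ (midCells L n m) i) :
    NucLE (restr M fun i j => α i ∧ β j) (6 * farSum Φ L n m 2) := by
  choose κ hκ hM using h.entry
  have hF : midCells L n m ⊆ Finset.Icc 1 L := Finset.filter_subset _ _
  have key : restr M (fun i j => α i ∧ β j) = ∑ c ∈ midCells L n m,
      ∑ a ∈ arc L n m (oppArc n m c), κ (oppArc n m c) • weighted b (r (oppArc n m c) a)
        (fun i => if α i then 1 else 0) (share Φ (midCells L n m) β c) := by
    ext i j
    simp only [restr, of_apply, Matrix.sum_apply, Matrix.smul_apply, weighted, smul_eq_mul]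
    by_cases hi : α i
    · by_cases hj : β j
      · have hij : i ≠ j := fun e => hαβ i hi (e ▸ hj)
        have h1 : ∀ c, ∑ a ∈ arc L n m (oppArc n m c), κ (oppArc n m c) *
            ((((if α i then 1 else 0) * share Φ (midCells L n m) β c j : ℝ) : ℂ) *
              ⟪b j, r (oppArc n m c) a i⟫)
            = ((share Φ (midCells L n m) β c j : ℝ) : ℂ) * M i j := by
          intro c
          rw [hM (oppArc n m c) i j hij, if_pos hi, one_mul, Finset.mul_sum, Finset.mul_sum]
          exact Finset.sum_congr rfl fun a _ => by ring
        simp_rw [h1]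
        rw [← Finset.sum_mul, ← Complex.ofReal_sum, sum_share hβ, if_pos hj, if_pos ⟨hi, hj⟩]
        simp
      · have : ∀ c, share Φ (midCells L n m) β c j = 0 := fun c => if_neg hj
        simp [hj, this]
    · simp [hi]
  rw [key]
  refine (NucLE.sum _ fun c hc => NucLE.sum _ fun a ha => ((nucLE_weighted_col h.orth
    (h.inner_eq _ _) (fun i => ?_) (fun i => ?_) (share_nonneg _ _ _)).mono
      (h.sum_share_norm_le hF hβ hc _ a)).smul _).mono ?_
  · split_ifs <;> norm_num
  · split_ifs <;> norm_num
  · calc _ ≤ ∑ c ∈ midCells L n m, ∑ a ∈ arc L n m (oppArc n m c), 6 * qcor Φ c a :=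
          Finset.sum_le_sum fun c _ => Finset.sum_le_sum fun a _ => by
            have := h.qcor_nonneg c a
            nlinarith [hκ (oppArc n m c)]
      _ = 6 * ∑ c ∈ midCells L n m, ∑ a ∈ arc L n m (oppArc n m c), qcor Φ c a := by
          simp_rw [Finset.mul_sum]
      _ ≤ _ := by
          gcongr
          exact h.sum_le_farSum hF (fun c _ => h.arc_subset _) fun c hc a ha => h.mid_mem hc ha

open Classical in
lemma nucLE_mid_left (h : ArcOverlap L n m M Φ b r) {α β : ι → Prop} (hαβ : ∀ i, α i → ¬ β i)
    (hβ : ∀ i, β i → 1 / 3 ≤ mass Φ (midCells L n m) i) :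
    NucLE (restr M fun i j => β i ∧ α j) (6 * farSum Φ L n m 2) := by
  choose κ hκ hM using h.entry
  have hF : midCells L n m ⊆ Finset.Icc 1 L := Finset.filter_subset _ _
  have key : restr M (fun i j => β i ∧ α j) = ∑ c ∈ midCells L n m,
      ∑ a ∈ arc L n m (oppArc n m c), κ (oppArc n m c) • weighted b (r (oppArc n m c) a)
        (share Φ (midCells L n m) β c) (fun i => if α i then 1 else 0) := by
    ext i j
    simp only [restr, of_apply, Matrix.sum_apply, Matrix.smul_apply, weighted, smul_eq_mul]
    by_cases hj : α j
    · by_cases hi : β i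
      · have hij : i ≠ j := fun e => hαβ j hj (e ▸ hi)
        have h1 : ∀ c, ∑ a ∈ arc L n m (oppArc n m c), κ (oppArc n m c) *
            (((share Φ (midCells L n m) β c i * (if α j then 1 else 0) : ℝ) : ℂ) *
              ⟪b j, r (oppArc n m c) a i⟫)
            = ((share Φ (midCells L n m) β c i : ℝ) : ℂ) * M i j := by
          intro c
          rw [hM (oppArc n m c) i j hij, if_pos hj, mul_one, Finset.mul_sum, Finset.mul_sum]
          exact Finset.sum_congr rfl fun a _ => by ring
        simp_rw [h1]
        rw [← Finset.sum_mul, ← Complex.ofReal_sum, sum_share hβ, if_pos hi, if_pos ⟨hi, hj⟩]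
        simp
      · have : ∀ c, share Φ (midCells L n m) β c i = 0 := fun c => if_neg hi
        simp [hi, this]
    · simp [hj]
  rw [key]
  refine (NucLE.sum _ fun c hc => NucLE.sum _ fun a ha => ((nucLE_weighted_row h.orth
    (share_nonneg _ _ _) (fun i => ?_) (fun i => ?_)).mono
      (h.sum_share_norm_le hF hβ hc _ a)).smul _).mono ?_
  · split_ifs <;> norm_num
  · split_ifs <;> norm_num
  · calc _ ≤ ∑ c ∈ midCells L n m, ∑ a ∈ arc L n m (oppArc n m c), 6 * qcor Φ c a :=
          Finset.sum_le_sum fun c _ => Finset.sum_le_sum fun a _ => by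
            have := h.qcor_nonneg c a
            nlinarith [hκ (oppArc n m c)]
      _ = 6 * ∑ c ∈ midCells L n m, ∑ a ∈ arc L n m (oppArc n m c), qcor Φ c a := by
          simp_rw [Finset.mul_sum]
      _ ≤ _ := by
          gcongr
          exact h.sum_le_farSum hF (fun c _ => h.arc_subset _) fun c hc a ha => h.mid_mem hc ha

end ArcOverlap

end NuclearBounds

/-! ### Trace norm of the direct coupling between the two end groups. -/

section PointwiseBound

open Matrix

variable {ι : Type} [Fintype ι] {E : Type*} [NormedAddCommGroup E] [InnerProductSpace ℂ E]

local notation "⟪" x ", " y "⟫" => inner ℂ x y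

namespace ArcOverlap

variable {L n m : ℕ} {M : Matrix ι ι ℂ} {Φ : ι → ℕ → ℝ} {b : ι → E} {r : Bool → ℕ → ι → E}

-- For a fixed arc cell `a`, a pair `(c, c')` assigned to its arc falls into one of three classes:
-- `c` is far from `a` (row bound), otherwise `c'` is far from `a` (column bound), otherwise both
-- are at medium distance from `a` (entrywise bound, giving a product of correlators).
open Classical in
lemma nucLE_far_cell (h : ArcOverlap L n m M Φ b r) {α β : ι → Prop}
    (hα : ∀ i, α i → 1 / 3 ≤ mass Φ (nearCells L n m) i)
    (hβ : ∀ i, β i → 1 / 3 ≤ mass Φ (nearCells L m n) i) (s : Bool) {a : ℕ}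
    (ha : a ∈ arc L n m s) :
    NucLE (∑ c ∈ nearCells L n m, ∑ c' ∈ nearCells L m n, if farArc L n m c c' = s then
        weighted b (r s a) (share Φ (nearCells L n m) α c) (share Φ (nearCells L m n) β c') else 0)
      (∑ c ∈ (nearCells L n m).filter fun c => 3 * td L n m ≤ 5 * td L c a, 3 * qcor Φ c a
        + ∑ c ∈ (nearCells L m n).filter fun c => 3 * td L n m ≤ 5 * td L c a, 3 * qcor Φ c a
        + 9 * ((∑ c ∈ (nearCells L n m).filter fun c => 2 * td L n m ≤ 5 * td L c a, qcor Φ c a)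
          * ∑ c ∈ (nearCells L m n).filter fun c => 2 * td L n m ≤ 5 * td L c a, qcor Φ c a)) := by
  set P := nearCells L n m with hP
  set Q := nearCells L m n with hQ
  have hPF : P ⊆ Finset.Icc 1 L := Finset.filter_subset _ _
  have hQF : Q ⊆ Finset.Icc 1 L := Finset.filter_subset _ _
  set A : ℕ → Prop := fun c => 3 * td L n m ≤ 5 * td L c a with hA
  set B : ℕ → Prop := fun c => 2 * td L n m ≤ 5 * td L c a with hB
  have key : (∑ c ∈ P, ∑ c' ∈ Q, if farArc L n m c c' = s then
        weighted b (r s a) (share Φ P α c) (share Φ Q β c') else 0)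
      = ∑ c ∈ P.filter A, weighted b (r s a) (share Φ P α c)
          (fun j => ∑ c' ∈ Q.filter (fun c' => farArc L n m c c' = s), share Φ Q β c' j)
        + ∑ c' ∈ Q.filter A, weighted b (r s a)
          (fun i => ∑ c ∈ P.filter (fun c => ¬ A c ∧ farArc L n m c c' = s), share Φ P α c i)
          (share Φ Q β c')
        + ∑ c ∈ P.filter B, ∑ c' ∈ Q.filter B,
          (if ¬ A c ∧ ¬ A c' ∧ farArc L n m c c' = s then (1 : ℂ) else 0) •
            weighted b (r s a) (share Φ P α c) (share Φ Q β c') := by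
    have hgeo : ∀ c ∈ P, ∀ c' ∈ Q, farArc L n m c c' = s → ¬ A c → ¬ A c' → B c ∧ B c' := by
      intro c hc c' hc' hs h1 h2
      rw [hP] at hc
      rw [hQ] at hc'
      simp only [nearCells, Finset.mem_filter, Finset.mem_Icc] at hc hc'
      rw [td_comm L m n] at hc'
      rcases le_td_of_mem_farArc h.n_le h.m_le hc.1.2 hc'.1.2 hc.2 hc'.2 (hs ▸ ha) with h3 | h3 | h3
      · exact absurd h3 h1
      · exact absurd h3 h2
      · exact h3
    ext i j
    simp only [Matrix.add_apply, Matrix.sum_apply, Matrix.smul_apply, smul_eq_mul]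
    have e1 : ∀ c ∈ P, ∀ c' ∈ Q, (if farArc L n m c c' = s then
        weighted b (r s a) (share Φ P α c) (share Φ Q β c') else 0) i j
        = (if A c then if farArc L n m c c' = s then
            weighted b (r s a) (share Φ P α c) (share Φ Q β c') i j else 0 else 0)
          + (if A c' then if ¬ A c ∧ farArc L n m c c' = s then
            weighted b (r s a) (share Φ P α c) (share Φ Q β c') i j else 0 else 0)
          + (if B c then if B c' then (if ¬ A c ∧ ¬ A c' ∧ farArc L n m c c' = s then (1 : ℂ) else 0)
            * weighted b (r s a) (share Φ P α c) (share Φ Q β c') i j else 0 else 0) := by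
      intro c hc c' hc'
      have := hgeo c hc c' hc'
      by_cases h1 : farArc L n m c c' = s
      · by_cases h2 : A c
        · simp [h1, h2]
        · by_cases h3 : A c'
          · simp [h1, h2, h3]
          · obtain ⟨h4, h5⟩ := this h1 h2 h3
            simp [h1, h2, h3, h4, h5]
      · simp [h1]
    rw [Finset.sum_congr rfl fun c hc => Finset.sum_congr rfl fun c' hc' => e1 c hc c' hc']
    simp only [Finset.sum_add_distrib]
    congr 1
    · congr 1
      · rw [Finset.sum_filter]
        refine Finset.sum_congr rfl fun c _ => ?_
        split_ifs
        · simp only [weighted, of_apply]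
          rw [← Finset.sum_filter, Finset.mul_sum, Complex.ofReal_sum, Finset.sum_mul]
        · simp
      · rw [Finset.sum_comm, Finset.sum_filter]
        refine Finset.sum_congr rfl fun c' _ => ?_
        split_ifs
        · simp only [weighted, of_apply]
          rw [← Finset.sum_filter, Finset.sum_mul, Complex.ofReal_sum, Finset.sum_mul]
        · simp
    · rw [Finset.sum_filter]
      refine Finset.sum_congr rfl fun c _ => ?_
      split_ifs
      · rw [Finset.sum_filter]
      · simp
  rw [key]
  refine ((NucLE.sum _ fun c hc => ?_).add (NucLE.sum _ fun c' hc' => ?_)).add ?_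
  · exact (nucLE_weighted_row h.orth (share_nonneg _ _ _)
      (fun j => Finset.sum_nonneg fun _ _ => share_nonneg _ _ _ _)
      (fun j => sum_share_le (Finset.filter_subset _ _) hβ j)).mono
      (h.sum_share_norm_le hPF hα (Finset.mem_filter.1 hc).1 s a)
  · exact (nucLE_weighted_col h.orth (h.inner_eq s a)
      (fun j => Finset.sum_nonneg fun _ _ => share_nonneg _ _ _ _)
      (fun j => sum_share_le (Finset.filter_subset _ _) hα j) (share_nonneg _ _ _)).mono
      (h.sum_share_norm_le hQF hβ (Finset.mem_filter.1 hc').1 s a)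
  · refine (NucLE.sum _ fun c hc => NucLE.sum _ fun c' hc' => ((nucLE_weighted_entries
      (h.inner_eq s a) (share_nonneg _ _ _) (share_nonneg _ _ _)).smul _).mono
        (T' := 9 * (qcor Φ c a * qcor Φ c' a)) ?_).mono (le_of_eq ?_)
    · have h1 := h.sum_share_norm_le hPF hα (Finset.mem_filter.1 hc).1 s a
      have h2 := h.sum_share_norm_le hQF hβ (Finset.mem_filter.1 hc').1 s a
      have h3 : 0 ≤ ∑ i, share Φ P α c i * ‖r s a i‖ :=
        Finset.sum_nonneg fun _ _ => mul_nonneg (share_nonneg _ _ _ _) (norm_nonneg _)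
      have h4 : 0 ≤ ∑ i, share Φ Q β c' i * ‖r s a i‖ :=
        Finset.sum_nonneg fun _ _ => mul_nonneg (share_nonneg _ _ _ _) (norm_nonneg _)
      have h5 := mul_le_mul h1 h2 h4 (h3.trans h1)
      have h6 : ‖(if ¬ A c ∧ ¬ A c' ∧ farArc L n m c c' = s then (1 : ℂ) else 0)‖ ≤ 1 := by
        split_ifs <;> simp
      refine (mul_le_of_le_one_left (mul_nonneg h3 h4) h6).trans (h5.trans (le_of_eq ?_))
      ring
    · simp_rw [← Finset.mul_sum]
      rw [← Finset.sum_mul]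

lemma near_mem {c a : ℕ} (hc : c ∈ nearCells L n m) {k : ℕ} (hk2 : 2 ≤ k)
    (hk : k * td L n m ≤ 5 * td L c a) :
    k * td L n m ≤ 5 * td L c a ∧ (td L c n ≤ td L c a ∨ td L c m ≤ td L c a) := by
  simp only [nearCells, Finset.mem_filter] at hc
  have : 2 * td L n m ≤ k * td L n m := Nat.mul_le_mul_right _ hk2
  omega

lemma sum_near_le (h : ArcOverlap L n m M Φ b r) {k : ℕ} (hk : 2 ≤ k) (s : Bool) :
    ∑ a ∈ arc L n m s, ∑ c ∈ (nearCells L n m).filter fun c => k * td L n m ≤ 5 * td L c a,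
      qcor Φ c a ≤ farSum Φ L n m k := by
  rw [Finset.sum_comm' (t' := nearCells L n m)
    (s' := fun c => (arc L n m s).filter fun a => k * td L n m ≤ 5 * td L c a)]
  · exact h.sum_le_farSum (Finset.filter_subset _ _)
      (fun c _ => (Finset.filter_subset _ _).trans (h.arc_subset s))
      fun c hc a ha => near_mem hc hk (Finset.mem_filter.1 ha).2
  · intro a c
    simp only [Finset.mem_filter]
    tauto

lemma sum_near_le' (h : ArcOverlap L n m M Φ b r) {k : ℕ} (hk : 2 ≤ k) (s : Bool) :
    ∑ a ∈ arc L n m s, ∑ c ∈ (nearCells L m n).filter fun c => k * td L n m ≤ 5 * td L c a,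
      qcor Φ c a ≤ farSum Φ L n m k := by
  have := h.swap.sum_near_le hk s
  rwa [arc_comm, farSum_comm, td_comm L m n] at this

open Classical in
lemma nucLE_far (h : ArcOverlap L n m M Φ b r) {α β : ι → Prop} (hαβ : ∀ i, α i → ¬ β i)
    (hα : ∀ i, α i → 1 / 3 ≤ mass Φ (nearCells L n m) i)
    (hβ : ∀ i, β i → 1 / 3 ≤ mass Φ (nearCells L m n) i) :
    NucLE (restr M fun i j => α i ∧ β j)
      (24 * farSum Φ L n m 3 + 36 * farSum Φ L n m 2 ^ 2) := by
  choose κ hκ hM using h.entry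
  set P := nearCells L n m with hP
  set Q := nearCells L m n with hQ
  have key : restr M (fun i j => α i ∧ β j) = ∑ s : Bool, ∑ a ∈ arc L n m s, κ s •
      ∑ c ∈ P, ∑ c' ∈ Q, if farArc L n m c c' = s then
        weighted b (r s a) (share Φ P α c) (share Φ Q β c') else 0 := by
    ext i j
    have e0 : ∀ s a c c', (if farArc L n m c c' = s then
        weighted b (r s a) (share Φ P α c) (share Φ Q β c') else 0) i j
        = if farArc L n m c c' = s then
          weighted b (r s a) (share Φ P α c) (share Φ Q β c') i j else 0 := by
      intro s a c c'
      split_ifs <;> rfl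
    simp only [restr, of_apply, Matrix.sum_apply, Matrix.smul_apply, e0, smul_eq_mul]
    by_cases hi : α i
    · by_cases hj : β j
      · have hij : i ≠ j := fun e => hαβ i hi (e ▸ hj)
        have e1 : ∀ c c', ∑ s : Bool, ∑ a ∈ arc L n m s, κ s * (if farArc L n m c c' = s then
            weighted b (r s a) (share Φ P α c) (share Φ Q β c') i j else 0)
            = ((share Φ P α c i : ℝ) : ℂ) * ((share Φ Q β c' j : ℝ) : ℂ) * M i j := by
          intro c c'
          -- Only the arc chosen for the pair `(c, c')` survives, and on it the overlaps add up to
          -- `M i j`.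
          rw [Finset.sum_eq_single (farArc L n m c c')]
          · simp only [if_true, weighted, of_apply]
            rw [hM (farArc L n m c c') i j hij, Finset.mul_sum, Finset.mul_sum]
            refine Finset.sum_congr rfl fun a _ => ?_
            push_cast
            ring
          · intro s _ hs
            simp [hs.symm]
          · simp
        have e2 : ∑ s : Bool, ∑ a ∈ arc L n m s, κ s * ∑ c ∈ P, ∑ c' ∈ Q,
            (if farArc L n m c c' = s then
              weighted b (r s a) (share Φ P α c) (share Φ Q β c') i j else 0)
            = ∑ c ∈ P, ∑ c' ∈ Q, ∑ s : Bool, ∑ a ∈ arc L n m s,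
              κ s * (if farArc L n m c c' = s then
              weighted b (r s a) (share Φ P α c) (share Φ Q β c') i j else 0) := by
          have : ∀ s : Bool, ∑ a ∈ arc L n m s, κ s * ∑ c ∈ P, ∑ c' ∈ Q,
              (if farArc L n m c c' = s then
                weighted b (r s a) (share Φ P α c) (share Φ Q β c') i j else 0)
              = ∑ c ∈ P, ∑ c' ∈ Q, ∑ a ∈ arc L n m s,
              κ s * (if farArc L n m c c' = s then
                weighted b (r s a) (share Φ P α c) (share Φ Q β c') i j else 0) := by
            intro s
            simp_rw [Finset.mul_sum]
            rw [Finset.sum_comm]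
            exact Finset.sum_congr rfl fun c _ => Finset.sum_comm
          simp_rw [this]
          rw [Finset.sum_comm]
          exact Finset.sum_congr rfl fun c _ => Finset.sum_comm
        rw [e2]
        simp_rw [e1, ← Finset.sum_mul, ← Finset.mul_sum, ← Finset.sum_mul, ← Complex.ofReal_sum]
        rw [sum_share hα, sum_share hβ, if_pos hi, if_pos hj, if_pos ⟨hi, hj⟩]
        simp
      · have : ∀ c, share Φ Q β c j = 0 := fun c => if_neg hj
        simp [hj, weighted, this]
    · have : ∀ c, share Φ P α c i = 0 := fun c => if_neg hi
      simp [hi, weighted, this]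
  rw [key]
  refine (NucLE.sum _ fun s _ => NucLE.sum _ fun a ha =>
    (h.nucLE_far_cell hα hβ s ha).smul (κ s)).mono ?_
  have hZ3 := h.farSum_nonneg 3
  have hZ2 := h.farSum_nonneg 2
  have hs : ∀ s ∈ (Finset.univ : Finset Bool), ∑ a ∈ arc L n m s, ‖κ s‖ *
      (∑ c ∈ P.filter fun c => 3 * td L n m ≤ 5 * td L c a, 3 * qcor Φ c a
        + ∑ c ∈ Q.filter fun c => 3 * td L n m ≤ 5 * td L c a, 3 * qcor Φ c a
        + 9 * ((∑ c ∈ P.filter fun c => 2 * td L n m ≤ 5 * td L c a, qcor Φ c a)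
          * ∑ c ∈ Q.filter fun c => 2 * td L n m ≤ 5 * td L c a, qcor Φ c a))
      ≤ 12 * farSum Φ L n m 3 + 18 * farSum Φ L n m 2 ^ 2 := by
    intro s _
    rw [← Finset.mul_sum, Finset.sum_add_distrib, Finset.sum_add_distrib]
    simp_rw [← Finset.mul_sum]
    have b1 := h.sum_near_le (k := 3) (by norm_num) s
    have b2 := h.sum_near_le' (k := 3) (by norm_num) s
    have b3 := h.sum_near_le (k := 2) (by norm_num) s
    have b4 := h.sum_near_le' (k := 2) (by norm_num) s
    have n1 : ∀ a, 0 ≤ ∑ c ∈ P.filter fun c => 2 * td L n m ≤ 5 * td L c a, qcor Φ c a :=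
      fun a => Finset.sum_nonneg fun c _ => h.qcor_nonneg c a
    have n2 : ∀ a, 0 ≤ ∑ c ∈ Q.filter fun c => 2 * td L n m ≤ 5 * td L c a, qcor Φ c a :=
      fun a => Finset.sum_nonneg fun c _ => h.qcor_nonneg c a
    have b5 : ∑ a ∈ arc L n m s,
        (∑ c ∈ P.filter fun c => 2 * td L n m ≤ 5 * td L c a, qcor Φ c a)
          * (∑ c ∈ Q.filter fun c => 2 * td L n m ≤ 5 * td L c a, qcor Φ c a)
        ≤ farSum Φ L n m 2 * farSum Φ L n m 2 := by
      refine le_trans ?_ (mul_le_mul b3 b4 (Finset.sum_nonneg fun a _ => n2 a) hZ2)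
      rw [Finset.sum_mul]
      -- A sum of products of nonnegative terms is at most the product of the sums.
      refine Finset.sum_le_sum fun a ha => mul_le_mul_of_nonneg_left ?_ (n1 a)
      exact Finset.single_le_sum (f := fun a =>
        ∑ c ∈ Q.filter fun c => 2 * td L n m ≤ 5 * td L c a, qcor Φ c a) (fun a _ => n2 a) ha
    calc _ ≤ ‖κ s‖ * (3 * farSum Φ L n m 3 + 3 * farSum Φ L n m 3
          + 9 * (farSum Φ L n m 2 * farSum Φ L n m 2)) := by gcongr
      _ ≤ 2 * (3 * farSum Φ L n m 3 + 3 * farSum Φ L n m 3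
          + 9 * (farSum Φ L n m 2 * farSum Φ L n m 2)) := by
          gcongr
          exact hκ s
      _ = _ := by ring
  refine (Finset.sum_le_sum hs).trans (le_of_eq ?_)
  simp
  ring

end ArcOverlap

end PointwiseBound

/-! ### The density matrix as a bordered determinant. -/

section GammaFormula

open Matrix

/-- Andréief's identity with a multiplicative weight `h`: expand both determinants and factorize the
integrals. For each fixed permutation of the second determinant, the sum over the first reproduces
the determinant of the overlaps, whence the factor `N!`. -/
lemma integral_det_mul_det {N : ℕ} {α : Type} [MeasurableSpace α] (μ : Measure α) [SigmaFinite μ]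
    (p q : Fin N → α → ℂ) (h : α → ℂ)
    (hint : ∀ a b, Integrable (fun z => p a z * star (q b z) * h z) μ) :
    Integrable (fun z : Fin N → α => (of fun a b => p a (z b)).det *
        star (of fun a b => q a (z b)).det * ∏ b, h (z b)) (Measure.pi fun _ => μ) ∧
      ∫ z : Fin N → α, (of fun a b => p a (z b)).det * star (of fun a b => q a (z b)).det *
        ∏ b, h (z b) ∂(Measure.pi fun _ => μ)
      = (N.factorial : ℂ) * (of fun a b => ∫ z, p a z * star (q b z) * h z ∂μ).det := by
  have hexp : ∀ z : Fin N → α, (of fun a b => p a (z b)).det *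
      star (of fun a b => q a (z b)).det * ∏ b, h (z b)
      = ∑ σ : Equiv.Perm (Fin N), ∑ τ : Equiv.Perm (Fin N),
        (((Equiv.Perm.sign σ : ℤ) : ℂ) * ((Equiv.Perm.sign τ : ℤ) : ℂ)) *
          ∏ b, (p (σ b) (z b) * star (q (τ b) (z b)) * h (z b)) := by
    intro z
    rw [det_apply', det_apply', star_sum, Finset.sum_mul_sum, Finset.sum_mul]
    refine Finset.sum_congr rfl fun σ _ => ?_
    rw [Finset.sum_mul]
    refine Finset.sum_congr rfl fun τ _ => ?_
    simp only [of_apply, star_mul', star_prod, Finset.prod_mul_distrib]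
    simp
    ring
  have hI : ∀ σ τ : Equiv.Perm (Fin N), Integrable (fun z : Fin N → α =>
      ∏ b, (p (σ b) (z b) * star (q (τ b) (z b)) * h (z b))) (Measure.pi fun _ => μ) :=
    fun σ τ => Integrable.fintype_prod (f := fun b z => p (σ b) z * star (q (τ b) z) * h z)
      fun b => hint _ _
  simp_rw [hexp]
  refine ⟨integrable_finsetSum _ fun σ _ => integrable_finsetSum _ fun τ _ =>
    (hI σ τ).const_mul _, ?_⟩
  rw [integral_finsetSum _ fun σ _ => integrable_finsetSum _ fun τ _ => (hI σ τ).const_mul _]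
  simp_rw [integral_finsetSum _ fun τ _ => (hI _ τ).const_mul _, integral_const_mul]
  set F : Matrix (Fin N) (Fin N) ℂ := of fun a b => ∫ z, p a z * star (q b z) * h z ∂μ with hF
  have e1 : ∀ σ τ : Equiv.Perm (Fin N), ∫ z : Fin N → α,
      ∏ b, (p (σ b) (z b) * star (q (τ b) (z b)) * h (z b)) ∂(Measure.pi fun _ => μ)
      = ∏ b, F (σ b) (τ b) := by
    intro σ τ
    exact integral_fintype_prod_eq_prod (μ := fun _ => μ)
      (fun b z => p (σ b) z * star (q (τ b) z) * h z)
  simp_rw [e1]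
  rw [Finset.sum_comm]
  have e2 : ∀ τ : Equiv.Perm (Fin N), ∑ σ : Equiv.Perm (Fin N),
      (((Equiv.Perm.sign σ : ℤ) : ℂ) * ((Equiv.Perm.sign τ : ℤ) : ℂ)) * ∏ b, F (σ b) (τ b)
      = F.det := by
    intro τ
    have h1 := det_permute' τ F
    rw [det_apply'] at h1
    have h2 : ((Equiv.Perm.sign τ : ℤ) : ℂ) * ((Equiv.Perm.sign τ : ℤ) : ℂ) = 1 := by
      rw [← Int.cast_mul]
      rcases Int.units_eq_one_or (Equiv.Perm.sign τ) with h | h <;> rw [h] <;> simp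
    calc _ = ((Equiv.Perm.sign τ : ℤ) : ℂ) * ∑ σ : Equiv.Perm (Fin N),
          ((Equiv.Perm.sign σ : ℤ) : ℂ) * ∏ b, F (σ b) (τ b) := by
          rw [Finset.mul_sum]
          exact Finset.sum_congr rfl fun σ _ => by ring
      _ = ((Equiv.Perm.sign τ : ℤ) : ℂ) * (((Equiv.Perm.sign τ : ℤ) : ℂ) * F.det) := by
          rw [← h1]
          rfl
      _ = _ := by rw [← mul_assoc, h2, one_mul]
  rw [Finset.sum_congr rfl fun τ _ => e2 τ]
  simp [Fintype.card_perm]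

/-- Cofactor expansion along the bordering column and then along the bordering row; the zero corner
contributes nothing. -/
lemma bordered₁_eq_sum {N : ℕ} (F : Matrix (Fin (N + 1)) (Fin (N + 1)) ℂ) (f g : Fin (N + 1) → ℂ) :
    bordered₁ F f g = -∑ i : Fin (N + 1), ∑ j : Fin (N + 1), (-1) ^ (i : ℕ) * f i * ((-1) ^ (j : ℕ) * g j *
      (F.submatrix i.succAbove j.succAbove).det) := by
  set A : Matrix (Fin (N + 2)) (Fin (N + 2)) ℂ := of (Fin.cons (Fin.cons 0 g)
    fun i => Fin.cons (f i) (F i)) with hA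
  have h1 : bordered₁ F f g = A.det := by
    unfold bordered₁ bordered
    rw [← det_submatrix_equiv_self
      ((finSuccEquiv (N + 1)).trans (Equiv.optionEquivSumPUnit (Fin (N + 1))))]
    congr 1
    ext i j
    refine Fin.cases ?_ (fun i => ?_) i <;> refine Fin.cases ?_ (fun j => ?_) j <;>
      simp [hA]
  rw [h1, det_succ_column_zero, Fin.sum_univ_succ]
  have h0 : A 0 0 = 0 := by simp [hA]
  rw [h0, mul_zero, zero_mul, zero_add, ← Finset.sum_neg_distrib]
  refine Finset.sum_congr rfl fun i _ => ?_
  rw [det_succ_row_zero, Finset.mul_sum, ← Finset.sum_neg_distrib]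
  refine Finset.sum_congr rfl fun j _ => ?_
  have h2 : ((A.submatrix i.succ.succAbove Fin.succ).submatrix Fin.succ j.succAbove)
      = F.submatrix i.succAbove j.succAbove := by
    ext a b
    simp [hA, Fin.succ_succAbove_succ]
  rw [h2]
  simp [hA, pow_succ]

/-- The sign picked up by a particle at `z` when one particle is moved from `x` to `y`. -/
noncomputable def flip (x y z : ℝ) : ℝ := if min x y < z ∧ z < max x y then -1 else 1

lemma measurable_flip (x y : ℝ) : Measurable (flip x y) :=
  Measurable.ite (measurableSet_Ioi.inter measurableSet_Iio) measurable_const measurable_const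

lemma abs_flip (x y z : ℝ) : |flip x y z| = 1 := by
  unfold flip
  split_ifs <;> simp

lemma sign_mul_sign {x y z : ℝ} (hx : z ≠ x) (hy : z ≠ y) :
    Real.sign (x - z) * Real.sign (y - z) = flip x y z := by
  unfold flip
  rcases lt_or_gt_of_ne hx with h1 | h1 <;> rcases lt_or_gt_of_ne hy with h2 | h2
  · rw [Real.sign_of_pos (sub_pos.2 h1), Real.sign_of_pos (sub_pos.2 h2), if_neg]
    · simp
    · simp [h1.le, h2.le]
  · rw [Real.sign_of_pos (sub_pos.2 h1), Real.sign_of_neg (sub_neg.2 h2), if_pos]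
    · simp
    · simp [h1, h2]
  · rw [Real.sign_of_neg (sub_neg.2 h1), Real.sign_of_pos (sub_pos.2 h2), if_pos]
    · simp
    · simp [h1, h2]
  · rw [Real.sign_of_neg (sub_neg.2 h1), Real.sign_of_neg (sub_neg.2 h2), if_neg]
    · simp
    · simp [h1.le, h2.le]

lemma sign_sq {t : ℝ} (h : t ≠ 0) : Real.sign t * Real.sign t = 1 := by
  rcases lt_or_gt_of_ne h with h | h
  · simp [Real.sign_of_neg h]
  · simp [Real.sign_of_pos h]

/-- Signs among the spectators `z` occur twice and cancel, and the signs relative to `x` and `y`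
combine to `flip`. -/
lemma waveFunction_cons_mul {N : ℕ} (u : Fin (N + 1) → ℝ → ℂ) (x y : ℝ) (z : Fin N → ℝ) :
    waveFunction u (Fin.cons x z : Fin (N + 1) → ℝ) *
        star (waveFunction u (Fin.cons y z : Fin (N + 1) → ℝ))
      = (1 / ((N + 1).factorial : ℂ)) *
        ((of fun a b => u a ((Fin.cons x z : Fin (N + 1) → ℝ) b)).det *
          star (of fun a b => u a ((Fin.cons y z : Fin (N + 1) → ℝ) b)).det *
          ∏ b, (flip x y (z b) : ℂ)) := by
  set S : ℂ := ∏ a : Fin N, ∏ b ∈ Finset.Ioi a, (Real.sign (z a - z b) : ℂ) with hS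
  have hprod : ∀ t : ℝ, (∏ a : Fin (N + 1), ∏ b ∈ Finset.Ioi a,
      (Real.sign ((Fin.cons t z : Fin (N + 1) → ℝ) a - (Fin.cons t z : Fin (N + 1) → ℝ) b) : ℂ))
      = (∏ b, (Real.sign (t - z b) : ℂ)) * S := by
    intro t
    rw [Fin.prod_univ_succ, Fin.prod_Ioi_zero]
    simp only [Fin.cons_zero, Fin.cons_succ, Fin.prod_Ioi_succ, hS]
  set Dx := (of fun a b => u a ((Fin.cons x z : Fin (N + 1) → ℝ) b)).det with hDx
  set Dy := (of fun a b => u a ((Fin.cons y z : Fin (N + 1) → ℝ) b)).det with hDy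
  have hsqrt : (1 / (Real.sqrt ((N + 1).factorial : ℝ) : ℂ)) *
      (1 / (Real.sqrt ((N + 1).factorial : ℝ) : ℂ)) = 1 / ((N + 1).factorial : ℂ) := by
    rw [div_mul_div_comm, one_mul, ← Complex.ofReal_mul, Real.mul_self_sqrt (by positivity)]
    simp
  have hstarS : star S = S := by
    simp only [hS, star_prod]
    simp
  have hreal : ∀ t : ℝ, star (∏ b, (Real.sign (t - z b) : ℂ)) = ∏ b, (Real.sign (t - z b) : ℂ) := by
    intro t
    simp only [star_prod]
    simp
  -- When coordinates coincide `Real.sign` is zero while `flip` is not; there one of the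
  -- determinants has two equal columns, so both sides vanish.
  have key : Dx * star Dy * ((∏ b, (Real.sign (x - z b) : ℂ)) * (∏ b, (Real.sign (y - z b) : ℂ))
      * (S * S)) = Dx * star Dy * ∏ b, (flip x y (z b) : ℂ) := by
    by_cases hx : ∃ b, z b = x
    · obtain ⟨b, hb⟩ := hx
      have : Dx = 0 := det_zero_of_column_eq (i := 0) (j := b.succ) (Fin.succ_ne_zero b).symm
        fun a => by simp [hb]
      simp [this]
    by_cases hy : ∃ b, z b = y
    · obtain ⟨b, hb⟩ := hy
      have : Dy = 0 := det_zero_of_column_eq (i := 0) (j := b.succ) (Fin.succ_ne_zero b).symm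
        fun a => by simp [hb]
      simp [this]
    by_cases hz : ∃ a b, a ≠ b ∧ z a = z b
    · obtain ⟨a, b, hab, h⟩ := hz
      have : Dx = 0 := det_zero_of_column_eq (i := a.succ) (j := b.succ)
        (fun e => hab (Fin.succ_injective _ e)) fun c => by simp [h]
      simp [this]
    push Not at hx hy hz
    have hSS : S * S = 1 := by
      rw [hS, ← Finset.prod_mul_distrib]
      refine Finset.prod_eq_one fun a _ => ?_
      rw [← Finset.prod_mul_distrib]
      refine Finset.prod_eq_one fun b hb => ?_
      rw [← Complex.ofReal_mul, sign_sq, Complex.ofReal_one]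
      exact sub_ne_zero.2 (hz a b (Finset.mem_Ioi.1 hb).ne)
    rw [hSS, mul_one, ← Finset.prod_mul_distrib]
    congr 1
    refine Finset.prod_congr rfl fun b _ => ?_
    rw [← Complex.ofReal_mul, sign_mul_sign (hx b) (hy b)]
  unfold waveFunction
  rw [hprod, hprod, ← hDx, ← hDy, star_mul', star_mul', star_mul', hstarS, hreal, ← key, ← hsqrt]
  have : star (1 / (Real.sqrt ((N + 1).factorial : ℝ) : ℂ))
      = 1 / (Real.sqrt ((N + 1).factorial : ℝ) : ℂ) := by simp
  rw [this]
  ring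

/-- The overlap matrix of the one-particle functions, with the sign change between `x` and `y`. -/
noncomputable def flipMatrix {ι : Type} (L : ℝ) (u : ι → ℝ → ℂ) (x y : ℝ) : Matrix ι ι ℂ :=
  of fun i j => ∫ z in Set.Ioc 0 L, u i z * star (u j z) * (flip x y z : ℂ)

lemma integrable_mul_flip {L : ℝ} {v w : ℝ → ℂ} (hv : MemLp v 2 (volume.restrict (Set.Ioc 0 L)))
    (hw : MemLp w 2 (volume.restrict (Set.Ioc 0 L))) (x y : ℝ) :
    Integrable (fun z => v z * star (w z) * (flip x y z : ℂ)) (volume.restrict (Set.Ioc 0 L)) := by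
  have h1 : Integrable (fun z => v z * star (w z)) (volume.restrict (Set.Ioc 0 L)) :=
    MemLp.integrable_mul hv hw.star
  refine h1.mul_bdd (c := 1) ?_ ?_
  · exact (Complex.measurable_ofReal.comp (measurable_flip x y)).aestronglyMeasurable
  · exact Filter.Eventually.of_forall fun z => by
      rw [Complex.norm_real, Real.norm_eq_abs, abs_flip]

/-- Expanding both determinants in the distinguished coordinate and integrating out the others by
Andréief's identity produces the minors in `bordered₁_eq_sum`. The prefactors cancel: `(N + 1) * N!
/ (N + 1)! = 1`. -/
lemma norm_reducedKernel_waveFunction {N : ℕ} {L : ℝ} {u : Fin N → ℝ → ℂ}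
    (hu : ∀ i, MemLp (u i) 2 (volume.restrict (Set.Ioc 0 L))) (x y : ℝ) :
    ‖reducedKernel L N (waveFunction u) x y‖
      ≤ ‖bordered₁ (flipMatrix L u x y) (fun i => u i x) fun j => star (u j y)‖ := by
  rcases N with _ | N
  · simp [reducedKernel]
  refine le_of_eq ?_
  have hint := fun a b => integrable_mul_flip (hu a) (hu b) x y
  rw [bordered₁_eq_sum, norm_neg, reducedKernel]
  congr 1
  simp_rw [waveFunction_cons_mul]
  rw [integral_const_mul, volume_pi, Measure.restrict_pi_pi]
  have hexp : ∀ z : Fin N → ℝ, ((of fun a b => u a ((Fin.cons x z : Fin (N + 1) → ℝ) b)).det *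
          star (of fun a b => u a ((Fin.cons y z : Fin (N + 1) → ℝ) b)).det *
          ∏ b, (flip x y (z b) : ℂ))
      = ∑ i : Fin (N + 1), ∑ j : Fin (N + 1), ((-1) ^ (i : ℕ) * u i x * ((-1) ^ (j : ℕ) * star (u j y))) *
        ((of fun a b => u (i.succAbove a) (z b)).det *
          star (of fun a b => u (j.succAbove a) (z b)).det * ∏ b, (flip x y (z b) : ℂ)) := by
    intro z
    rw [det_succ_column_zero, det_succ_column_zero, star_sum, Finset.sum_mul_sum, Finset.sum_mul]
    refine Finset.sum_congr rfl fun i _ => ?_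
    rw [Finset.sum_mul]
    refine Finset.sum_congr rfl fun j _ => ?_
    have e1 : ∀ (t : ℝ) (i : Fin (N + 1)),
        ((of fun a b => u a ((Fin.cons t z : Fin (N + 1) → ℝ) b)).submatrix i.succAbove Fin.succ)
        = of fun a b => u (i.succAbove a) (z b) := by
      intro t i
      ext a b
      simp
    rw [e1, e1, star_mul', star_mul', star_pow, star_neg, star_one]
    simp only [of_apply, Fin.cons_zero]
    ring
  have hA := fun i j : Fin (N + 1) => integral_det_mul_det (volume.restrict (Set.Ioc 0 L))
    (fun a => u (i.succAbove a)) (fun a => u (j.succAbove a)) (fun z => (flip x y z : ℂ))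
    (fun a b => hint _ _)
  simp_rw [hexp]
  rw [integral_finsetSum _ fun i _ => integrable_finsetSum _ fun j _ => (hA i j).1.const_mul _]
  simp_rw [integral_finsetSum _ fun j _ => (hA _ j).1.const_mul _, integral_const_mul,
    fun i j => (hA i j).2]
  rw [Finset.mul_sum, Finset.mul_sum]
  refine Finset.sum_congr rfl fun i _ => ?_
  rw [Finset.mul_sum, Finset.mul_sum]
  refine Finset.sum_congr rfl fun j _ => ?_
  have e2 : (flipMatrix L u x y).submatrix i.succAbove j.succAbove = of fun a b =>
      ∫ z in Set.Ioc 0 L, u (i.succAbove a) z * star (u (j.succAbove b) z) * (flip x y z : ℂ) := rfl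
  rw [e2, Nat.factorial_succ]
  have hN : ((N.factorial : ℕ) : ℂ) ≠ 0 := Nat.cast_ne_zero.2 N.factorial_ne_zero
  have hN1 : ((N + 1 : ℕ) : ℂ) ≠ 0 := Nat.cast_ne_zero.2 N.succ_ne_zero
  push_cast at hN1 ⊢
  field_simp

end GammaFormula

/-! ### Orthonormal families in `L²` and their overlaps on arcs. -/

section Overlap

local notation "⟪" x ", " y "⟫" => inner ℂ x y

lemma inner_toLp_toLp {α : Type*} [MeasurableSpace α] {μ : Measure α} {f g : α → ℂ}
    (hf : MemLp f 2 μ) (hg : MemLp g 2 μ) :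
    ⟪hf.toLp f, hg.toLp g⟫ = ∫ z, g z * star (f z) ∂μ := by
  rw [L2.inner_def]
  refine integral_congr_ae ?_
  filter_upwards [hf.coeFn_toLp, hg.coeFn_toLp] with z h1 h2
  rw [h1, h2]
  simp

lemma measurableSet_cell (a : ℕ) : MeasurableSet (cell a) := measurableSet_Ioc

lemma localNorm_eq (f : ℝ → ℂ) (a : ℕ) :
    localNorm f a = eLpNorm f 2 (volume.restrict (cell a)) := by
  rw [eLpNorm_eq_lintegral_rpow_enorm_toReal (by norm_num) (by norm_num)]
  simp [localNorm]

lemma localNorm_sq (f : ℝ → ℂ) (a : ℕ) : localNorm f a ^ 2 = ∫⁻ x in cell a, ‖f x‖ₑ ^ 2 := by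
  rw [localNorm, ← ENNReal.rpow_natCast, ← ENNReal.rpow_mul]
  norm_num

lemma iUnion_cell (L : ℕ) : ⋃ a ∈ Finset.Icc 1 L, cell a = Set.Ioc (0 : ℝ) L := by
  ext z
  simp only [Set.mem_iUnion, Finset.mem_Icc, cell, Set.mem_Ioc, exists_prop]
  constructor
  · rintro ⟨a, ⟨h1, h2⟩, h3, h4⟩
    have h1' : (1 : ℝ) ≤ a := by exact_mod_cast h1
    have h2' : (a : ℝ) ≤ L := by exact_mod_cast h2
    constructor <;> linarith
  · rintro ⟨h1, h2⟩
    refine ⟨⌈z⌉₊, ⟨Nat.one_le_iff_ne_zero.2 (Nat.ceil_pos.2 h1).ne', Nat.ceil_le.2 h2⟩, ?_,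
      Nat.le_ceil z⟩
    have := Nat.ceil_lt_add_one h1.le
    linarith

lemma pairwise_disjoint_cell : Pairwise (Function.onFun Disjoint cell) := by
  have key : ∀ a b : ℕ, a < b → Disjoint (cell a) (cell b) := by
    intro a b hab
    rw [Set.disjoint_left]
    intro z hz hz'
    have h1 : (a : ℝ) + 1 ≤ b := by exact_mod_cast hab
    have h2 := hz.2
    have h3 := hz'.1
    linarith
  intro a b hab
  rcases lt_or_gt_of_ne hab with h | h
  · exact key a b h
  · exact (key b a h).symm

lemma cell_subset {L a : ℕ} (ha : a ∈ Finset.Icc 1 L) : cell a ⊆ Set.Ioc (0 : ℝ) L := by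
  rw [← iUnion_cell L]
  exact Set.subset_biUnion_of_mem (u := fun a => cell a) ha

lemma sum_localNorm_sq (f : ℝ → ℂ) (L : ℕ) :
    ∑ a ∈ Finset.Icc 1 L, localNorm f a ^ 2 = ∫⁻ x in Set.Ioc (0 : ℝ) L, ‖f x‖ₑ ^ 2 := by
  simp_rw [localNorm_sq]
  rw [← iUnion_cell, lintegral_biUnion_finset]
  · exact fun a _ b _ hab => pairwise_disjoint_cell hab
  · exact fun a _ => measurableSet_cell a

/-- A finite orthonormal family in `L²(0, L]`. -/
structure OrthoFamily {ι : Type} (L : ℕ) (u : ι → ℝ → ℂ) : Prop where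
  memLp : ∀ i, MemLp (u i) 2 (volume.restrict (Set.Ioc (0 : ℝ) L))
  orth : Orthonormal ℂ fun i => (memLp i).toLp (u i)

/-- The local norms of a family, as real numbers. -/
noncomputable def locReal {ι : Type} (L : ℕ) (u : ι → ℝ → ℂ) (i : ι) (a : ℕ) : ℝ :=
  (eLpNorm (u i) 2 ((volume.restrict (Set.Ioc (0 : ℝ) L)).restrict (cell a))).toReal

/-- The interval between `x` and `y`, or its complement, within a cell. -/
def arcPiece (x y : ℝ) : Bool → ℕ → Set ℝ
  | true, a => cell a ∩ Set.Ioo (min x y) (max x y)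
  | false, a => cell a \ Set.Ioo (min x y) (max x y)

lemma measurableSet_arcPiece (x y : ℝ) (s : Bool) (a : ℕ) : MeasurableSet (arcPiece x y s a) := by
  cases s
  · exact (measurableSet_cell a).diff measurableSet_Ioo
  · exact (measurableSet_cell a).inter measurableSet_Ioo

lemma arcPiece_subset (x y : ℝ) (s : Bool) (a : ℕ) : arcPiece x y s a ⊆ cell a := by
  cases s
  · exact Set.sdiff_subset
  · exact Set.inter_subset_left

namespace OrthoFamily

variable {ι : Type} {L : ℕ} {u : ι → ℝ → ℂ}

lemma localNorm_ne_top (h : OrthoFamily L u) (i : ι) {a : ℕ} (ha : a ∈ Finset.Icc 1 L) :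
    localNorm (u i) a ≠ ∞ := by
  rw [localNorm_eq]
  exact ((h.memLp i).mono_measure (Measure.restrict_mono (cell_subset ha) le_rfl)).eLpNorm_ne_top

lemma locReal_eq (u : ι → ℝ → ℂ) (i : ι) {a : ℕ} (ha : a ∈ Finset.Icc 1 L) :
    locReal L u i a = (localNorm (u i) a).toReal := by
  rw [locReal, localNorm_eq, Measure.restrict_restrict (measurableSet_cell a),
    Set.inter_eq_left.2 (cell_subset ha)]

lemma ofReal_locReal (h : OrthoFamily L u) (i : ι) {a : ℕ} (ha : a ∈ Finset.Icc 1 L) :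
    ENNReal.ofReal (locReal L u i a) = localNorm (u i) a := by
  rw [locReal_eq u i ha, ENNReal.ofReal_toReal (h.localNorm_ne_top i ha)]

/-- The restriction of a function to a piece of an arc. -/
noncomputable def piece (h : OrthoFamily L u) (x y : ℝ) (s : Bool) (a : ℕ) (i : ι) :
    Lp ℂ 2 (volume.restrict (Set.Ioc (0 : ℝ) L)) :=
  ((h.memLp i).indicator (measurableSet_arcPiece x y s a)).toLp _

lemma sum_locReal_sq (h : OrthoFamily L u) (i : ι) :
    ∑ a ∈ Finset.Icc 1 L, locReal L u i a ^ 2 = 1 := by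
  have h1 : ENNReal.ofReal (∑ a ∈ Finset.Icc 1 L, locReal L u i a ^ 2) = 1 := by
    rw [ENNReal.ofReal_sum_of_nonneg fun _ _ => sq_nonneg _]
    have : ∀ a ∈ Finset.Icc 1 L, ENNReal.ofReal (locReal L u i a ^ 2) = localNorm (u i) a ^ 2 := by
      intro a ha
      rw [ENNReal.ofReal_pow (show 0 ≤ locReal L u i a from ENNReal.toReal_nonneg),
        h.ofReal_locReal i ha]
    rw [Finset.sum_congr rfl this, sum_localNorm_sq]
    have h2 := h.orth.1 i
    rw [Lp.norm_toLp, eLpNorm_eq_lintegral_rpow_enorm_toReal (by norm_num) (by norm_num)] at h2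
    rw [ENNReal.toReal_eq_one_iff] at h2
    simp only [ENNReal.toReal_ofNat, ENNReal.rpow_ofNat] at h2
    rw [← ENNReal.rpow_one (∫⁻ _ in _, _), show (1 : ℝ) = (1 / 2) * 2 by norm_num,
      ENNReal.rpow_mul, h2, ENNReal.one_rpow]
  rwa [ENNReal.ofReal_eq_one] at h1

/-- Row `i` holds the coefficients of `flip * u i`, which has norm one, in an orthonormal family;
Bessel's inequality bounds each row. -/
lemma sum_norm_flipMatrix_sq [Fintype ι] (h : OrthoFamily L u) (x y : ℝ) :
    ∑ i, ∑ j, ‖flipMatrix L u x y i j‖ ^ 2 ≤ Fintype.card ι := by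
  have hm : ∀ i, MemLp (fun z => u i z * (flip x y z : ℂ)) 2
      (volume.restrict (Set.Ioc (0 : ℝ) L)) := by
    intro i
    refine (h.memLp i).of_le ((h.memLp i).1.mul
      (Complex.measurable_ofReal.comp (measurable_flip x y)).aestronglyMeasurable) ?_
    exact Filter.Eventually.of_forall fun z => by
      rw [norm_mul, Complex.norm_real, Real.norm_eq_abs, abs_flip, mul_one]
  have hn : ∀ i, ‖(hm i).toLp _‖ = 1 := by
    intro i
    rw [← h.orth.1 i, Lp.norm_toLp, Lp.norm_toLp]
    congr 1
    refine eLpNorm_congr_norm_ae (Filter.Eventually.of_forall fun z => ?_)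
    rw [norm_mul, Complex.norm_real, Real.norm_eq_abs, abs_flip, mul_one]
  have hrow : ∀ i, ∑ j, ‖flipMatrix L u x y i j‖ ^ 2 ≤ 1 := by
    intro i
    have h1 := h.orth.sum_inner_products_le (s := Finset.univ) ((hm i).toLp _)
    rw [hn i, one_pow] at h1
    refine le_trans (le_of_eq (Finset.sum_congr rfl fun j _ => ?_)) h1
    rw [inner_toLp_toLp]
    congr 2
    refine integral_congr_ae (Filter.Eventually.of_forall fun z => ?_)
    simp only
    ring
  exact (Finset.sum_le_sum fun i _ => hrow i).trans (by simp)

lemma biUnion_arcPiece_true {n m : ℕ} {x y : ℝ} (hn1 : 1 ≤ n) (hm1 : 1 ≤ m)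
    (hx : x ∈ cell n) (hy : y ∈ cell m) :
    ⋃ a ∈ arc L n m true, arcPiece x y true a = Set.Ioo (min x y) (max x y) := by
  ext z
  simp only [Set.mem_iUnion, arc, arcPiece, Finset.mem_Icc, Set.mem_inter_iff, exists_prop]
  refine ⟨fun ⟨a, _, _, h⟩ => h, fun hz => ?_⟩
  have h1 : (n : ℝ) - 1 < x := hx.1
  have h2 : x ≤ n := hx.2
  have h3 : (m : ℝ) - 1 < y := hy.1
  have h4 : y ≤ m := hy.2
  have hn1' : (1 : ℝ) ≤ n := by exact_mod_cast hn1
  have hm1' : (1 : ℝ) ≤ m := by exact_mod_cast hm1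
  have h5 : ((min n m : ℕ) : ℝ) - 1 < z := by
    push_cast
    refine lt_of_le_of_lt ?_ hz.1
    rw [le_min_iff]
    have := min_le_left (n : ℝ) m
    have := min_le_right (n : ℝ) m
    constructor <;> linarith
  have h6 : z ≤ ((max n m : ℕ) : ℝ) := by
    push_cast
    refine hz.2.le.trans ?_
    rw [max_le_iff]
    have := le_max_left (n : ℝ) m
    have := le_max_right (n : ℝ) m
    constructor <;> linarith
  have hz0 : 0 < z := by
    have : (1 : ℝ) ≤ ((min n m : ℕ) : ℝ) := by exact_mod_cast (by omega : 1 ≤ min n m)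
    linarith
  have h7 := Nat.ceil_lt_add_one hz0.le
  refine ⟨⌈z⌉₊, ⟨?_, Nat.ceil_le.2 h6⟩, ⟨by linarith, Nat.le_ceil z⟩, hz⟩
  have h8 : ((min n m : ℕ) : ℝ) < (⌈z⌉₊ : ℝ) + 1 := by
    have := Nat.le_ceil z
    linarith
  have : min n m < ⌈z⌉₊ + 1 := by exact_mod_cast h8
  omega

lemma biUnion_arcPiece_false {n m : ℕ} {x y : ℝ} (hn1 : 1 ≤ n) (hn : n ≤ L) (hm1 : 1 ≤ m)
    (hx : x ∈ cell n) (hy : y ∈ cell m) :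
    ⋃ a ∈ arc L n m false, arcPiece x y false a
      = Set.Ioc (0 : ℝ) L \ Set.Ioo (min x y) (max x y) := by
  ext z
  rw [← iUnion_cell L]
  simp only [Set.mem_iUnion, arcPiece, Set.mem_sdiff, exists_prop, arc, Finset.mem_union,
    Finset.mem_Icc]
  constructor
  · rintro ⟨a, ha, hz, hz'⟩
    exact ⟨⟨a, by omega, hz⟩, hz'⟩
  · rintro ⟨⟨a, ha, hz⟩, hz'⟩
    refine ⟨a, ?_, hz, hz'⟩
    by_contra hc
    apply hz'
    have h1 : (n : ℝ) - 1 < x := hx.1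
    have h2 : x ≤ n := hx.2
    have h3 : (m : ℝ) - 1 < y := hy.1
    have h4 : y ≤ m := hy.2
    have h5 : (a : ℝ) - 1 < z := hz.1
    have h6 : z ≤ a := hz.2
    rcases le_total n m with hnm | hnm
    · have h7 : (n : ℝ) + 1 ≤ a := by exact_mod_cast (by omega : n + 1 ≤ a)
      have h8 : (a : ℝ) + 1 ≤ m := by exact_mod_cast (by omega : a + 1 ≤ m)
      exact ⟨min_lt_of_left_lt (by linarith), lt_max_of_lt_right (by linarith)⟩
    · have h7 : (m : ℝ) + 1 ≤ a := by exact_mod_cast (by omega : m + 1 ≤ a)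
      have h8 : (a : ℝ) + 1 ≤ n := by exact_mod_cast (by omega : a + 1 ≤ n)
      exact ⟨min_lt_of_right_lt (by linarith), lt_max_of_lt_left (by linarith)⟩

lemma inner_piece (h : OrthoFamily L u) (x y : ℝ) (s : Bool) (a : ℕ) (i j : ι) :
    ⟪(h.memLp j).toLp (u j), h.piece x y s a i⟫
      = ∫ z in arcPiece x y s a, u i z * star (u j z) ∂(volume.restrict (Set.Ioc (0 : ℝ) L)) := by
  rw [piece, inner_toLp_toLp, ← integral_indicator (measurableSet_arcPiece x y s a)]
  congr 1
  funext z
  by_cases hz : z ∈ arcPiece x y s a <;> simp [hz]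

lemma arcOverlap (h : OrthoFamily L u) {n m : ℕ} {x y : ℝ} (hn1 : 1 ≤ n) (hn : n ≤ L)
    (hm1 : 1 ≤ m) (hm : m ≤ L) (hx : x ∈ cell n) (hy : y ∈ cell m) :
    ArcOverlap L n m (flipMatrix L u x y) (locReal L u) (fun i => (h.memLp i).toLp (u i))
      (h.piece x y) where
  orth := h.orth
  inner_eq s a i j := by
    rw [piece, piece, inner_toLp_toLp, inner_toLp_toLp]
    congr 1
    funext z
    by_cases hz : z ∈ arcPiece x y s a <;> simp [hz]
  norm_le s a i := by
    rw [piece, Lp.norm_toLp, eLpNorm_indicator_eq_eLpNorm_restrict (measurableSet_arcPiece x y s a)]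
    refine ENNReal.toReal_mono ?_ (eLpNorm_mono_measure _
      (Measure.restrict_mono (arcPiece_subset x y s a) le_rfl))
    exact ((h.memLp i).mono_measure Measure.restrict_le_self).eLpNorm_ne_top
  nonneg i a := ENNReal.toReal_nonneg
  sum_sq := h.sum_locReal_sq
  n_pos := hn1
  n_le := hn
  m_pos := hm1
  m_le := hm
  entry s := by
    set μ := volume.restrict (Set.Ioc (0 : ℝ) L) with hμ
    set I := Set.Ioo (min x y) (max x y) with hI
    have hImeas : MeasurableSet I := measurableSet_Ioo
    have hint : ∀ i j, Integrable (fun z => u i z * star (u j z)) μ := fun i j =>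
      MemLp.integrable_mul (h.memLp i) (h.memLp j).star
    have hflip : ∀ i j, flipMatrix L u x y i j = (∫ z in Iᶜ, u i z * star (u j z) ∂μ)
        - ∫ z in I, u i z * star (u j z) ∂μ := by
      intro i j
      have h1 := integrable_mul_flip (h.memLp i) (h.memLp j) x y
      have : flipMatrix L u x y i j = ∫ z, u i z * star (u j z) * (flip x y z : ℂ) ∂μ := rfl
      rw [this, ← integral_add_compl hImeas h1, sub_eq_add_neg, add_comm]
      congr 1
      · refine setIntegral_congr_fun hImeas.compl fun z hz => ?_
        have : flip x y z = 1 := if_neg hz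
        simp [this]
      · rw [← integral_neg]
        refine setIntegral_congr_fun hImeas fun z hz => ?_
        have : flip x y z = -1 := if_pos hz
        simp [this]
    -- Off the diagonal the overlaps inside and outside `I` cancel, so their difference is `2` times
    -- the outer one and `-2` times the inner one. This is the freedom to choose the arc.
    have hzero : ∀ i j, i ≠ j → (∫ z in I, u i z * star (u j z) ∂μ)
        + (∫ z in Iᶜ, u i z * star (u j z) ∂μ) = 0 := by
      intro i j hij
      rw [integral_add_compl hImeas (hint i j), ← inner_toLp_toLp (h.memLp j) (h.memLp i)]
      exact h.orth.2 hij.symm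
    have hsum : ∀ (s : Bool) (i j : ι), ∑ a ∈ arc L n m s,
        ⟪(h.memLp j).toLp (u j), h.piece x y s a i⟫
        = ∫ z in ⋃ a ∈ arc L n m s, arcPiece x y s a, u i z * star (u j z) ∂μ := by
      intro s i j
      rw [integral_biUnion_finset]
      · exact Finset.sum_congr rfl fun a _ => h.inner_piece x y s a i j
      · exact fun a _ => measurableSet_arcPiece x y s a
      · exact fun a _ b _ hab => (pairwise_disjoint_cell hab).mono (arcPiece_subset x y s a)
          (arcPiece_subset x y s b)
      · exact fun a _ => (hint i j).integrableOn
    cases s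
    · refine ⟨2, by simp, fun i j hij => ?_⟩
      have h2 : ∫ z in Iᶜ, u i z * star (u j z) ∂μ
          = ∫ z in Set.Ioc (0 : ℝ) L \ I, u i z * star (u j z) ∂μ := by
        rw [hμ, Measure.restrict_restrict hImeas.compl,
          Measure.restrict_restrict (measurableSet_Ioc.diff hImeas)]
        congr 2
        ext z
        simp only [Set.mem_inter_iff, Set.mem_compl_iff, Set.mem_sdiff]
        tauto
      rw [hsum, biUnion_arcPiece_false hn1 hn hm1 hx hy, ← h2, hflip]
      linear_combination -(hzero i j hij)
    · refine ⟨-2, by simp, fun i j hij => ?_⟩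
      rw [hsum, biUnion_arcPiece_true hn1 hm1 hx hy, hflip]
      linear_combination (hzero i j hij)

end OrthoFamily

end Overlap

/-! ### From the pointwise determinant bound to the Hilbert-Schmidt norm. -/

section HilbertSchmidt

open Matrix

variable {ι : Type} [Fintype ι]

/-- The functions concentrated near `n`. -/
def leftGroup (Φ : ι → ℕ → ℝ) (L n m : ℕ) (i : ι) : Prop := 1 / 3 ≤ mass Φ (nearCells L n m) i

/-- The functions concentrated near `m`, but not near `n`. -/
def rightGroup (Φ : ι → ℕ → ℝ) (L n m : ℕ) (i : ι) : Prop :=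
  ¬ leftGroup Φ L n m i ∧ 1 / 3 ≤ mass Φ (nearCells L m n) i

/-- The functions concentrated neither near `n` nor near `m`. -/
def midGroup (Φ : ι → ℕ → ℝ) (L n m : ℕ) (i : ι) : Prop :=
  ¬ leftGroup Φ L n m i ∧ ¬ rightGroup Φ L n m i

lemma NucLE.restr_or {M : Matrix ι ι ℂ} {R R' Q : ι → ι → Prop} {T T' : ℝ}
    (hR : NucLE (restr M R) T) (hR' : NucLE (restr M R') T')
    (hQ : ∀ i j, Q i j ↔ R i j ∨ R' i j) (hd : ∀ i j, R i j → ¬ R' i j) :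
    NucLE (restr M Q) (T + T') := by
  have : restr M Q = restr M R + restr M R' := by
    ext i j
    have h1 := hQ i j
    have h2 := hd i j
    by_cases h3 : R i j <;> by_cases h4 : R' i j <;> simp_all [restr]
  rw [this]
  exact hR.add hR'

namespace ArcOverlap

variable {E : Type*} [NormedAddCommGroup E] [InnerProductSpace ℂ E]
  {L n m : ℕ} {M : Matrix ι ι ℂ} {Φ : ι → ℕ → ℝ} {b : ι → E} {r : Bool → ℕ → ι → E}

-- The near cells of `n`, the near cells of `m` and the middle cells cover the torus, so one of them
-- carries a third of the unit mass.
omit [Fintype ι] in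
lemma mass_midCells (h : ArcOverlap L n m M Φ b r) {i : ι} (hi : midGroup Φ L n m i) :
    1 / 3 ≤ mass Φ (midCells L n m) i := by
  have h1 : ¬ 1 / 3 ≤ mass Φ (nearCells L n m) i := hi.1
  have h2 : ¬ 1 / 3 ≤ mass Φ (nearCells L m n) i := fun h2 => hi.2 ⟨hi.1, h2⟩
  have h3 : Finset.Icc 1 L ⊆ nearCells L n m ∪ nearCells L m n ∪ midCells L n m := by
    intro c hc
    simp only [nearCells, midCells, Finset.mem_union, Finset.mem_filter, hc, true_and,
      td_comm L m n]
    omega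
  have h4 : (1 : ℝ) ≤ mass Φ (nearCells L n m) i + mass Φ (nearCells L m n) i
      + mass Φ (midCells L n m) i := by
    rw [← h.sum_sq i]
    have hnn : ∀ c, 0 ≤ Φ i c ^ 2 := fun c => sq_nonneg _
    have e1 : ∀ F G : Finset ℕ, ∑ c ∈ F ∪ G, Φ i c ^ 2 ≤ ∑ c ∈ F, Φ i c ^ 2 + ∑ c ∈ G, Φ i c ^ 2 :=
      fun F G => by
        rw [← Finset.sum_union_inter]
        exact le_add_of_nonneg_right (Finset.sum_nonneg fun c _ => hnn c)
    refine (Finset.sum_le_sum_of_subset_of_nonneg h3 fun c _ _ => hnn c).trans ?_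
    exact (e1 _ _).trans (add_le_add_left (e1 _ _) _)
  linarith

lemma norm_bordered₁_le_groups [DecidableEq ι] (h : ArcOverlap L n m M Φ b r)
    (hM : ∑ i, ∑ j, ‖M i j‖ ^ 2 ≤ Fintype.card ι) (f g : ι → ℂ) :
    ‖bordered₁ M f g‖ ≤ Real.exp 3 *
      ((48 * farSum Φ L n m 3 + 72 * farSum Φ L n m 2 ^ 2) * (l2 f * l2 g)
      + (12 * farSum Φ L n m 2 * l2 f + l2 (vpart (midGroup Φ L n m) f))
        * (12 * farSum Φ L n m 2 * l2 g + l2 (vpart (midGroup Φ L n m) g))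
      + l2 (vpart (rightGroup Φ L n m) f) * l2 g
      + l2 f * l2 (vpart (leftGroup Φ L n m) g)) := by
  set p := leftGroup Φ L n m with hp
  set q := rightGroup Φ L n m with hq
  have hmid : ∀ i, midGroup Φ L n m i ↔ ¬ p i ∧ ¬ q i := fun i => Iff.rfl
  have hpq : ∀ i, p i → ¬ q i := fun i hi hi' => hi'.1 hi
  have hp' : ∀ i, p i → 1 / 3 ≤ mass Φ (nearCells L n m) i := fun i hi => hi
  have hq' : ∀ i, q i → 1 / 3 ≤ mass Φ (nearCells L m n) i := fun i hi => hi.2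
  have hm' : ∀ i, midGroup Φ L n m i → 1 / 3 ≤ mass Φ (midCells L n m) i :=
    fun i hi => h.mass_midCells hi
  have hmp : ∀ i, p i → ¬ midGroup Φ L n m i := fun i hi hi' => hi'.1 hi
  have hmq : ∀ i, q i → ¬ midGroup Φ L n m i := fun i hi hi' => hi'.2 hi
  have e1 := (h.nucLE_mid_right hmp hm').restr_or (h.nucLE_mid_left hmp hm')
    (Q := fun i j => ¬ q i ∧ ¬ q j ∧ ¬ (p i ↔ p j))
    (fun i j => by have := hpq i; have := hpq j; have := hmid i; have := hmid j; tauto)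
    (fun i j => by have := hmp i; have := hmp j; tauto)
  have e2 := (h.nucLE_mid_right hmq hm').restr_or (h.nucLE_mid_left hmq hm')
    (Q := fun i j => ¬ p i ∧ ¬ p j ∧ ¬ (q i ↔ q j))
    (fun i j => by have := hpq i; have := hpq j; have := hmid i; have := hmid j; tauto)
    (fun i j => by have := hmq i; have := hmq j; tauto)
  have e3 := (h.nucLE_far hpq hp' hq').restr_or
    (h.swap.nucLE_far (fun i hi hi' => hpq i hi' hi) hq' hp')
    (Q := fun i j => (p i ∧ q j) ∨ (q i ∧ p j)) (fun i j => Iff.rfl)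
    (fun i j => by have := hpq i; have := hpq j; tauto)
  have := norm_bordered₁_decouple hM p q hpq e1 e2 e3 f g
  rw [farSum_comm Φ L m n, farSum_comm Φ L m n] at this
  refine this.trans (le_of_eq ?_)
  have e4 : (fun i => ¬ p i ∧ ¬ q i) = midGroup Φ L n m := rfl
  rw [e4]
  ring

open Classical in
lemma sum_midGroup_le (h : ArcOverlap L n m M Φ b r) :
    ∑ i, (if midGroup Φ L n m i then Φ i n else 0) ≤ 3 * farSum Φ L n m 2 := by
  have hF : midCells L n m ⊆ Finset.Icc 1 L := Finset.filter_subset _ _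
  refine (h.sum_group_le hF (fun i hi => h.mass_midCells hi) n).trans ?_
  have := h.sum_le_farSum (k := 2) hF (G := fun _ => {n})
    (fun _ _ => Finset.singleton_subset_iff.2 (Finset.mem_Icc.2 ⟨h.n_pos, h.n_le⟩))
    (fun c hc a ha => by
      simp only [midCells, Finset.mem_filter, Finset.mem_singleton] at hc ha
      subst ha
      exact ⟨hc.2.1, Or.inl le_rfl⟩)
  simp only [Finset.sum_singleton] at this
  linarith

open Classical in
lemma sum_midGroup_le' (h : ArcOverlap L n m M Φ b r) :
    ∑ i, (if midGroup Φ L n m i then Φ i m else 0) ≤ 3 * farSum Φ L n m 2 := by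
  have hF : midCells L n m ⊆ Finset.Icc 1 L := Finset.filter_subset _ _
  refine (h.sum_group_le hF (fun i hi => h.mass_midCells hi) m).trans ?_
  have := h.sum_le_farSum (k := 2) hF (G := fun _ => {m})
    (fun _ _ => Finset.singleton_subset_iff.2 (Finset.mem_Icc.2 ⟨h.m_pos, h.m_le⟩))
    (fun c hc a ha => by
      simp only [midCells, Finset.mem_filter, Finset.mem_singleton] at hc ha
      subst ha
      exact ⟨hc.2.2, Or.inr le_rfl⟩)
  simp only [Finset.sum_singleton] at this
  linarith

-- A cell within `2/5` of the distance from `n` is at least `3/5` of it away from `m`.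
open Classical in
lemma sum_nearGroup_le (h : ArcOverlap L n m M Φ b r) {α : ι → Prop}
    (hα : ∀ i, α i → 1 / 3 ≤ mass Φ (nearCells L n m) i) :
    ∑ i, (if α i then Φ i m else 0) ≤ 3 * farSum Φ L n m 3 := by
  have hF : nearCells L n m ⊆ Finset.Icc 1 L := Finset.filter_subset _ _
  refine (h.sum_group_le hF hα m).trans ?_
  have := h.sum_le_farSum (k := 3) hF (G := fun _ => {m})
    (fun _ _ => Finset.singleton_subset_iff.2 (Finset.mem_Icc.2 ⟨h.m_pos, h.m_le⟩))
    (fun c hc a ha => by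
      simp only [nearCells, Finset.mem_filter, Finset.mem_singleton, Finset.mem_Icc] at hc ha
      subst ha
      have := td_triangle (L := L) h.n_le hc.1.2 h.m_le
      rw [td_comm L n c] at this
      exact ⟨by omega, Or.inr le_rfl⟩)
  simp only [Finset.sum_singleton] at this
  linarith

end ArcOverlap

/-- A majorant that is a finite sum of products in `x` and `y` separates the double integral. No
measurability of `γ` is needed. -/
lemma localHS_sq_le_sum {κ : Type*} [Fintype κ] {γ : ℝ → ℝ → ℂ} {n m : ℕ} {F G : κ → ℝ → ℝ}
    (hFm : ∀ k, Measurable (F k)) (hGm : ∀ k, Measurable (G k)) (hF0 : ∀ k x, 0 ≤ F k x)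
    (hG0 : ∀ k x, 0 ≤ G k x) {A B : κ → ℝ} (hA0 : ∀ k, 0 ≤ A k) (hB0 : ∀ k, 0 ≤ B k)
    (hA : ∀ k, ∫⁻ x in cell n, ENNReal.ofReal (F k x) ≤ ENNReal.ofReal (A k))
    (hB : ∀ k, ∫⁻ x in cell m, ENNReal.ofReal (G k x) ≤ ENNReal.ofReal (B k))
    (h : ∀ x ∈ cell n, ∀ y ∈ cell m, ‖γ x y‖ ^ 2 ≤ ∑ k, F k x * G k y) :
    localHS γ n m ^ 2 ≤ ENNReal.ofReal (∑ k, A k * B k) := by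
  rw [localHS, ← ENNReal.rpow_natCast, ← ENNReal.rpow_mul]
  norm_num only [one_div, Nat.cast_ofNat, inv_mul_cancel₀, ENNReal.rpow_one]
  calc ∫⁻ x in cell n, ∫⁻ y in cell m, ‖γ x y‖ₑ ^ 2
      ≤ ∫⁻ x in cell n, ∫⁻ y in cell m, ∑ k, ENNReal.ofReal (F k x) * ENNReal.ofReal (G k y) := by
        refine setLIntegral_mono' (measurableSet_cell n) fun x hx =>
          setLIntegral_mono' (measurableSet_cell m) fun y hy => ?_
        rw [← ofReal_norm, ← ENNReal.ofReal_pow (norm_nonneg _)]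
        simp_rw [← ENNReal.ofReal_mul (hF0 _ _)]
        rw [← ENNReal.ofReal_sum_of_nonneg fun k _ => mul_nonneg (hF0 k x) (hG0 k y)]
        exact ENNReal.ofReal_le_ofReal (h x hx y hy)
    _ = ∑ k, (∫⁻ x in cell n, ENNReal.ofReal (F k x)) * ∫⁻ y in cell m, ENNReal.ofReal (G k y) := by
        have e1 : ∀ x, ∫⁻ y in cell m, ∑ k, ENNReal.ofReal (F k x) * ENNReal.ofReal (G k y)
            = ∑ k, ENNReal.ofReal (F k x) * ∫⁻ y in cell m, ENNReal.ofReal (G k y) := fun x => by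
          rw [lintegral_finsetSum _ fun k _ => (hGm k).ennreal_ofReal.const_mul _]
          exact Finset.sum_congr rfl fun k _ => lintegral_const_mul _ (hGm k).ennreal_ofReal
        simp_rw [e1]
        rw [lintegral_finsetSum _ fun k _ => (hFm k).ennreal_ofReal.mul_const _]
        exact Finset.sum_congr rfl fun k _ => lintegral_mul_const _ (hFm k).ennreal_ofReal
    _ ≤ ∑ k, ENNReal.ofReal (A k) * ENNReal.ofReal (B k) :=
        Finset.sum_le_sum fun k _ => mul_le_mul' (hA k) (hB k)
    _ = _ := by
        rw [ENNReal.ofReal_sum_of_nonneg fun k _ => mul_nonneg (hA0 k) (hB0 k)]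
        simp_rw [ENNReal.ofReal_mul (hA0 _)]

lemma sq_sum_groups_le (T T' a b a₀ b₀ a₁ b₁ : ℝ) :
    (T' * (a * b) + (T * a + a₀) * (T * b + b₀) + a₁ * b + a * b₁) ^ 2
      ≤ 4 * T' ^ 2 * a ^ 2 * b ^ 2 + 16 * (T ^ 2 * a ^ 2 + a₀ ^ 2) * (T ^ 2 * b ^ 2 + b₀ ^ 2)
        + 4 * a₁ ^ 2 * b ^ 2 + 4 * a ^ 2 * b₁ ^ 2 := by
  have e1 : (T * a + a₀) ^ 2 ≤ 2 * (T ^ 2 * a ^ 2 + a₀ ^ 2) := by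
    nlinarith [sq_nonneg (T * a - a₀)]
  have e2 : (T * b + b₀) ^ 2 ≤ 2 * (T ^ 2 * b ^ 2 + b₀ ^ 2) := by
    nlinarith [sq_nonneg (T * b - b₀)]
  have e3 := mul_le_mul e1 e2 (sq_nonneg _) (by positivity)
  have e4 : ∀ w x y z : ℝ, (w + x + y + z) ^ 2 ≤ 4 * (w ^ 2 + x ^ 2 + y ^ 2 + z ^ 2) := by
    intro w x y z
    nlinarith [sq_nonneg (w - x), sq_nonneg (w - y), sq_nonneg (w - z), sq_nonneg (x - y),
      sq_nonneg (x - z), sq_nonneg (y - z)]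
  refine (e4 _ _ _ _).trans ?_
  simp only [mul_pow] at e3 ⊢
  linarith

namespace OrthoFamily

variable {L n m : ℕ} {u : ι → ℝ → ℂ}

open Classical in
lemma lintegral_l2_vpart_sq (h : OrthoFamily L u) (hu : ∀ i, Measurable (u i)) {a : ℕ}
    (ha : a ∈ Finset.Icc 1 L) (α : ι → Prop) :
    ∫⁻ x in cell a, ENNReal.ofReal (l2 (vpart α fun i => u i x) ^ 2)
      = ENNReal.ofReal (∑ i, if α i then locReal L u i a ^ 2 else 0) := by
  have e1 : ∀ x, ENNReal.ofReal (l2 (vpart α fun i => u i x) ^ 2)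
      = ∑ i, if α i then ‖u i x‖ₑ ^ 2 else 0 := by
    intro x
    rw [l2_sq, ENNReal.ofReal_sum_of_nonneg fun _ _ => sq_nonneg _]
    refine Finset.sum_congr rfl fun i _ => ?_
    rw [ENNReal.ofReal_pow (norm_nonneg _), ofReal_norm]
    by_cases hi : α i <;> simp [vpart, hi]
  simp_rw [e1]
  rw [lintegral_finsetSum, ENNReal.ofReal_sum_of_nonneg]
  · refine Finset.sum_congr rfl fun i _ => ?_
    by_cases hi : α i
    · simp only [hi, if_true]
      rw [← localNorm_sq, ← h.ofReal_locReal i ha,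
        ENNReal.ofReal_pow (show 0 ≤ locReal L u i a from ENNReal.toReal_nonneg)]
    · simp [hi]
  · intro i _
    split_ifs
    exacts [sq_nonneg _, le_rfl]
  · intro i _
    split_ifs
    exacts [(hu i).enorm.pow_const 2, measurable_const]

lemma measurable_l2_vpart_sq (hu : ∀ i, Measurable (u i)) (α : ι → Prop) :
    Measurable fun x => l2 (vpart α fun i => u i x) ^ 2 := by
  simp_rw [l2_sq]
  refine Finset.measurable_sum _ fun i _ => ?_
  unfold vpart
  split_ifs
  exacts [(hu i).norm.pow_const 2, by fun_prop]

open Classical in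
lemma lintegral_l2_vpart_sq_le (h : OrthoFamily L u) (hu : ∀ i, Measurable (u i)) {a : ℕ}
    (ha : a ∈ Finset.Icc 1 L) {α : ι → Prop} {Z : ℝ}
    (hZ : ∑ i, (if α i then locReal L u i a else 0) ≤ Z) :
    ∫⁻ x in cell a, ENNReal.ofReal (l2 (vpart α fun i => u i x) ^ 2) ≤ ENNReal.ofReal (Z ^ 2) := by
  rw [h.lintegral_l2_vpart_sq hu ha]
  have hnn : ∀ i, 0 ≤ if α i then locReal L u i a else 0 := fun i => by
    split_ifs
    exacts [ENNReal.toReal_nonneg, le_rfl]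
  refine ENNReal.ofReal_le_ofReal (le_trans ?_ (pow_le_pow_left₀
    (Finset.sum_nonneg fun i _ => hnn i) hZ 2))
  refine le_trans (Finset.sum_le_sum fun i _ => ?_)
    (Finset.sum_sq_le_sq_sum_of_nonneg fun i _ => hnn i)
  split_ifs <;> simp

lemma l2_star (f : ι → ℂ) : l2 (fun i => star (f i)) = l2 f := by simp [l2]

lemma l2_vpart_star (α : ι → Prop) (f : ι → ℂ) :
    l2 (vpart α fun i => star (f i)) = l2 (vpart α f) := by
  rw [← l2_star (vpart α f)]
  congr 1
  funext i
  by_cases hi : α i <;> simp [vpart, hi]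

omit [Fintype ι] in
lemma vpart_true (f : ι → ℂ) : vpart (fun _ => True) f = f := by
  funext i
  simp [vpart]

lemma measurable_l2_sq (hu : ∀ i, Measurable (u i)) :
    Measurable fun x => l2 (fun i => u i x) ^ 2 := by
  simpa only [vpart_true] using measurable_l2_vpart_sq hu fun _ => True

lemma lintegral_l2_sq (h : OrthoFamily L u) (hu : ∀ i, Measurable (u i)) {a : ℕ}
    (ha : a ∈ Finset.Icc 1 L) :
    ∫⁻ x in cell a, ENNReal.ofReal (l2 (fun i => u i x) ^ 2)
      = ENNReal.ofReal (qcor (locReal L u) a a) := by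
  have := h.lintegral_l2_vpart_sq hu ha fun _ => True
  simpa only [vpart_true, if_true, qcor, ← sq] using this

/-- The a priori bound without decay; it is used where the correlator sums are large. -/
lemma localHS_sq_le_qcor [DecidableEq ι] (h : OrthoFamily L u)
    (hu : ∀ i, Measurable (u i)) {γ : ℝ → ℝ → ℂ}
    (hγ : ∀ x y, ‖γ x y‖ ≤ ‖bordered₁ (flipMatrix L u x y) (fun i => u i x)
      fun j => star (u j y)‖) (hn : n ∈ Finset.Icc 1 L) (hm : m ∈ Finset.Icc 1 L) :
    localHS γ n m ^ 2 ≤ ENNReal.ofReal (Real.exp 1 ^ 2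
      * (qcor (locReal L u) n n * qcor (locReal L u) m m)) := by
  have hq : ∀ a, 0 ≤ qcor (locReal L u) a a := fun a =>
    Finset.sum_nonneg fun i _ => mul_self_nonneg _
  refine (localHS_sq_le_sum (κ := Unit) (F := fun _ x => Real.exp 1 ^ 2 * l2 (fun i => u i x) ^ 2)
    (G := fun _ x => l2 (fun i => u i x) ^ 2)
    (A := fun _ => Real.exp 1 ^ 2 * qcor (locReal L u) n n)
    (B := fun _ => qcor (locReal L u) m m)
    (fun _ => (measurable_l2_sq hu).const_mul _) (fun _ => measurable_l2_sq hu)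
    (fun _ _ => by positivity) (fun _ _ => by positivity)
    (fun _ => mul_nonneg (by positivity) (hq n)) (fun _ => hq m) (fun _ => ?_)
    (fun _ => (h.lintegral_l2_sq hu hm).le) (fun x hx y hy => ?_)).trans (le_of_eq ?_)
  · simp_rw [ENNReal.ofReal_mul (show 0 ≤ Real.exp 1 ^ 2 by positivity)]
    rw [lintegral_const_mul _ (measurable_l2_sq hu).ennreal_ofReal, h.lintegral_l2_sq hu hn]
  · have h1 := (hγ x y).trans (norm_bordered₁_le (h.sum_norm_flipMatrix_sq x y) _ _)
    rw [l2_star] at h1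
    simp only [Finset.univ_unique, Finset.sum_singleton]
    calc ‖γ x y‖ ^ 2 ≤ (Real.exp 1 * (l2 (fun i => u i x) * l2 fun i => u i y)) ^ 2 := by gcongr
      _ = _ := by ring
  · simp [mul_assoc]

lemma localHS_sq_le_farSum [DecidableEq ι] (h : OrthoFamily L u)
    (hu : ∀ i, Measurable (u i)) {γ : ℝ → ℝ → ℂ}
    (hγ : ∀ x y, ‖γ x y‖ ≤ ‖bordered₁ (flipMatrix L u x y) (fun i => u i x)
      fun j => star (u j y)‖) (hn : n ∈ Finset.Icc 1 L) (hm : m ∈ Finset.Icc 1 L) {Z₂ Z₃ F G : ℝ}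
    (hZ₂ : Z₂ = farSum (locReal L u) L n m 2) (hZ₃ : Z₃ = farSum (locReal L u) L n m 3)
    (hF : F = qcor (locReal L u) n n) (hG : G = qcor (locReal L u) m m) :
    localHS γ n m ^ 2 ≤ ENNReal.ofReal (Real.exp 3 ^ 2 *
      (4 * (48 * Z₃ + 72 * Z₂ ^ 2) ^ 2 * F * G
        + 16 * ((12 * Z₂) ^ 2 * F + (3 * Z₂) ^ 2) * ((12 * Z₂) ^ 2 * G + (3 * Z₂) ^ 2)
        + 4 * (3 * Z₃) ^ 2 * G + 4 * F * (3 * Z₃) ^ 2)) := by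
  have hn' := Finset.mem_Icc.1 hn
  have hm' := Finset.mem_Icc.1 hm
  have hq : ∀ a, 0 ≤ qcor (locReal L u) a a := fun a =>
    Finset.sum_nonneg fun i _ => mul_self_nonneg _
  have hF0 : 0 ≤ F := hF ▸ hq n
  have hG0 : 0 ≤ G := hG ▸ hq m
  have hov : ∀ x ∈ cell n, ∀ y ∈ cell m, _ := fun x hx y hy =>
    h.arcOverlap hn'.1 hn'.2 hm'.1 hm'.2 hx hy
  -- The group estimates involve only the local norms, so any choice of `x` and `y` in the cells
  -- serves; here the right end points.
  have hov0 := hov n ⟨by linarith, le_rfl⟩ m ⟨by linarith, le_rfl⟩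
  set Φ := locReal L u
  set T := 12 * Z₂ with hT
  set T' := 48 * Z₃ + 72 * Z₂ ^ 2 with hT'
  set c := Real.exp 3 ^ 2 with hc
  have hc0 : 0 ≤ c := by positivity
  set f : ℝ → ℝ := fun x => l2 (fun i => u i x) ^ 2 with hf
  set p : (ι → Prop) → ℝ → ℝ := fun α x => l2 (vpart α fun i => u i x) ^ 2 with hp
  have hfm : Measurable f := measurable_l2_sq hu
  have hpm : ∀ α, Measurable (p α) := fun α => measurable_l2_vpart_sq hu α
  have hf0 : ∀ x, 0 ≤ f x := fun x => sq_nonneg _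
  have hp0 : ∀ α x, 0 ≤ p α x := fun α x => sq_nonneg _
  have hfi : ∫⁻ x in cell n, ENNReal.ofReal (f x) = ENNReal.ofReal F :=
    (h.lintegral_l2_sq hu hn).trans (by rw [hF])
  have hgi : ∫⁻ x in cell m, ENNReal.ofReal (f x) = ENNReal.ofReal G :=
    (h.lintegral_l2_sq hu hm).trans (by rw [hG])
  have hmn := h.lintegral_l2_vpart_sq_le hu hn hov0.sum_midGroup_le
  have hmm := h.lintegral_l2_vpart_sq_le hu hm hov0.sum_midGroup_le'
  have hpp := h.lintegral_l2_vpart_sq_le hu hm (hov0.sum_nearGroup_le (α := leftGroup Φ L n m)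
    fun i hi => hi)
  have hqq := h.lintegral_l2_vpart_sq_le hu hn (hov0.swap.sum_nearGroup_le (α := rightGroup Φ L n m)
    fun i hi => hi.2)
  rw [farSum_comm Φ L m n] at hqq
  rw [← hZ₂] at hmn hmm
  rw [← hZ₃] at hpp hqq
  have hconst : ∀ (k : ℝ) (_ : 0 ≤ k) (v : ℝ → ℝ) (_ : Measurable v) (a : ℕ) (A : ℝ),
      ∫⁻ x in cell a, ENNReal.ofReal (v x) ≤ ENNReal.ofReal A →
      ∫⁻ x in cell a, ENNReal.ofReal (k * v x) ≤ ENNReal.ofReal (k * A) := by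
    intro k hk v hv a A hA
    simp_rw [ENNReal.ofReal_mul hk]
    rw [lintegral_const_mul _ hv.ennreal_ofReal]
    gcongr
  have hadd : ∀ (v w : ℝ → ℝ) (_ : Measurable v) (_ : ∀ x, 0 ≤ v x) (_ : ∀ x, 0 ≤ w x) (a : ℕ)
      (A B : ℝ), 0 ≤ A → 0 ≤ B → ∫⁻ x in cell a, ENNReal.ofReal (v x) ≤ ENNReal.ofReal A →
      ∫⁻ x in cell a, ENNReal.ofReal (w x) ≤ ENNReal.ofReal B →
      ∫⁻ x in cell a, ENNReal.ofReal (v x + w x) ≤ ENNReal.ofReal (A + B) := by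
    intro v w hv hv0 hw0 a A B hA0 hB0 hA hB
    simp_rw [ENNReal.ofReal_add (hv0 _) (hw0 _)]
    rw [lintegral_add_left hv.ennreal_ofReal, ENNReal.ofReal_add hA0 hB0]
    gcongr
  -- The four products are the four terms of `sq_sum_groups_le`: direct coupling, passage through
  -- the middle group, column in the right group, row in the left group.
  have key := localHS_sq_le_sum (γ := γ) (n := n) (m := m)
    (F := ![fun x => c * (4 * T' ^ 2) * f x,
      fun x => c * 16 * (T ^ 2 * f x + p (midGroup Φ L n m) x),
      fun x => c * 4 * p (rightGroup Φ L n m) x, fun x => c * 4 * f x])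
    (G := ![f, fun x => T ^ 2 * f x + p (midGroup Φ L n m) x, f, p (leftGroup Φ L n m)])
    (A := ![c * (4 * T' ^ 2) * F, c * 16 * (T ^ 2 * F + (3 * Z₂) ^ 2), c * 4 * (3 * Z₃) ^ 2,
      c * 4 * F])
    (B := ![G, T ^ 2 * G + (3 * Z₂) ^ 2, G, (3 * Z₃) ^ 2])
    (by
      have := hpm (midGroup Φ L n m)
      have := hpm (rightGroup Φ L n m)
      intro k
      fin_cases k <;> simp <;> fun_prop)
    (by
      have := hpm (midGroup Φ L n m)
      have := hpm (leftGroup Φ L n m)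
      intro k
      fin_cases k <;> simp <;> fun_prop)
    (by
      intro k x
      have h1 := hf0 x
      have h2 := hp0 (midGroup Φ L n m) x
      have h3 := hp0 (rightGroup Φ L n m) x
      fin_cases k <;> simp <;> positivity)
    (by
      intro k x
      have h1 := hf0 x
      have h2 := hp0 (midGroup Φ L n m) x
      have h3 := hp0 (leftGroup Φ L n m) x
      fin_cases k <;> simp <;> positivity)
    (by intro k; fin_cases k <;> simp <;> positivity)
    (by intro k; fin_cases k <;> simp <;> positivity)
    (by
      intro k
      fin_cases k
      · exact hconst _ (by positivity) _ hfm _ _ hfi.le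
      · refine hconst _ (by positivity) _ ((hfm.const_mul _).add (hpm _)) _ _ ?_
        exact hadd _ _ (hfm.const_mul _) (fun x => mul_nonneg (sq_nonneg _) (hf0 x)) (hp0 _) _ _ _
          (by positivity) (by positivity) (hconst _ (by positivity) _ hfm _ _ hfi.le) hmn
      · exact hconst _ (by positivity) _ (hpm _) _ _ hqq
      · exact hconst _ (by positivity) _ hfm _ _ hfi.le)
    (by
      intro k
      fin_cases k
      · exact hgi.le
      · exact hadd _ _ (hfm.const_mul _) (fun x => mul_nonneg (sq_nonneg _) (hf0 x)) (hp0 _) _ _ _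
          (by positivity) (by positivity) (hconst _ (by positivity) _ hfm _ _ hgi.le) hmm
      · exact hgi.le
      · exact hpp)
    (by
      intro x hx y hy
      have h1 := (hγ x y).trans ((hov x hx y hy).norm_bordered₁_le_groups
        (h.sum_norm_flipMatrix_sq x y) _ _)
      rw [l2_star, l2_vpart_star, l2_vpart_star, ← hZ₂, ← hZ₃, ← hT, ← hT'] at h1
      have h2 := sq_sum_groups_le T T' (l2 fun i => u i x) (l2 fun i => u i y)
        (l2 (vpart (midGroup Φ L n m) fun i => u i x)) (l2 (vpart (midGroup Φ L n m) fun i => u i y))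
        (l2 (vpart (rightGroup Φ L n m) fun i => u i x))
        (l2 (vpart (leftGroup Φ L n m) fun i => u i y))
      have h3 := pow_le_pow_left₀ (norm_nonneg _) h1 2
      rw [mul_pow] at h3
      refine (h3.trans (mul_le_mul_of_nonneg_left h2 hc0)).trans (le_of_eq ?_)
      simp only [Fin.sum_univ_four, hf, hp, cons_val]
      ring)
  refine key.trans (le_of_eq ?_)
  congr 1
  simp only [Fin.sum_univ_four, cons_val]
  ring

lemma localHS_sq_le [DecidableEq ι] (h : OrthoFamily L u)
    (hu : ∀ i, Measurable (u i)) {γ : ℝ → ℝ → ℂ}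
    (hγ : ∀ x y, ‖γ x y‖ ≤ ‖bordered₁ (flipMatrix L u x y) (fun i => u i x)
      fun j => star (u j y)‖) (hn : n ∈ Finset.Icc 1 L) (hm : m ∈ Finset.Icc 1 L) :
    localHS γ n m ^ 2 ≤ ENNReal.ofReal ((600 * Real.exp 3) ^ 2 *
      ((1 + qcor (locReal L u) n n) * (1 + qcor (locReal L u) m m)) *
      min 1 (farSum (locReal L u) L n m 3 + farSum (locReal L u) L n m 2 ^ 2) ^ 2) := by
  have h1 := h.localHS_sq_le_qcor hu hγ hn hm
  have h2 := h.localHS_sq_le_farSum hu hγ hn hm rfl rfl rfl rfl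
  have hn' := Finset.mem_Icc.1 hn
  have hm' := Finset.mem_Icc.1 hm
  have hov0 := h.arcOverlap hn'.1 hn'.2 hm'.1 hm'.2 (x := n) (y := m) ⟨by linarith, le_rfl⟩
    ⟨by linarith, le_rfl⟩
  have hF0 := hov0.qcor_nonneg n n
  have hG0 := hov0.qcor_nonneg m m
  have hZ₂ := hov0.farSum_nonneg 2
  have hZ₃ := hov0.farSum_nonneg 3
  set F := qcor (locReal L u) n n
  set G := qcor (locReal L u) m m
  set Z₂ := farSum (locReal L u) L n m 2
  set Z₃ := farSum (locReal L u) L n m 3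
  -- If `Z₃ + Z₂ ^ 2 ≥ 1` the a priori bound suffices; otherwise every error term is at most
  -- quadratic in this sum, up to the factor `(1 + F) * (1 + G)`. The constants add up to less than
  -- `600 ^ 2`.
  by_cases hW : 1 ≤ Z₃ + Z₂ ^ 2
  · rw [min_eq_left hW]
    refine h1.trans (ENNReal.ofReal_le_ofReal ?_)
    have e1 : Real.exp 1 ≤ 600 * Real.exp 3 := by
      have := Real.exp_le_exp.2 (show (1 : ℝ) ≤ 3 by norm_num)
      have := Real.exp_pos 3
      linarith
    have e2 : F * G ≤ (1 + F) * (1 + G) := by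
      have := mul_nonneg hF0 hG0
      linarith
    have e3 : Real.exp 1 ^ 2 ≤ (600 * Real.exp 3) ^ 2 := by gcongr
    rw [one_pow, mul_one]
    exact mul_le_mul e3 e2 (by positivity) (by positivity)
  · push Not at hW
    rw [min_eq_right hW.le]
    refine h2.trans (ENNReal.ofReal_le_ofReal ?_)
    set W := Z₃ + Z₂ ^ 2 with hWdef
    have hW0 : 0 ≤ W := by positivity
    have hZW : Z₂ ^ 2 ≤ W := by linarith
    have hZ1 : Z₂ ^ 2 ≤ 1 := by linarith
    have hZ3W : Z₃ ≤ W := by linarith [sq_nonneg Z₂]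
    have hT' : 48 * Z₃ + 72 * Z₂ ^ 2 ≤ 72 * W := by linarith
    have hprod := mul_nonneg hF0 hG0
    obtain ⟨D, hD⟩ : ∃ D, D = (1 + F) * (1 + G) := ⟨_, rfl⟩
    have hD' : D = 1 + F + G + F * G := by rw [hD]; ring
    have hFG : F * G ≤ D := by linarith
    have hGD : G ≤ D := by linarith
    have hFD : F ≤ D := by linarith
    have hD0 : 0 ≤ D := by linarith
    rw [← hD]
    have f1 : 4 * (48 * Z₃ + 72 * Z₂ ^ 2) ^ 2 * F * G ≤ 4 * (72 * W) ^ 2 * D := by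
      rw [mul_assoc]
      gcongr
    have f2 : ∀ R, 0 ≤ R → (12 * Z₂) ^ 2 * R + (3 * Z₂) ^ 2 ≤ 144 * W * (1 + R) := by
      intro R hR
      have := mul_le_mul_of_nonneg_right hZW hR
      nlinarith
    have f3 : 16 * ((12 * Z₂) ^ 2 * F + (3 * Z₂) ^ 2) * ((12 * Z₂) ^ 2 * G + (3 * Z₂) ^ 2)
        ≤ 16 * (144 * W) ^ 2 * D := by
      have g1 := f2 F hF0
      have g2 := f2 G hG0
      calc _ ≤ 16 * (144 * W * (1 + F)) * (144 * W * (1 + G)) := by gcongr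
        _ = _ := by rw [hD]; ring
    have f4 : 4 * (3 * Z₃) ^ 2 * G ≤ 4 * (3 * W) ^ 2 * D := by gcongr
    have f5 : 4 * F * (3 * Z₃) ^ 2 ≤ 4 * D * (3 * W) ^ 2 := by gcongr
    have hE : 0 ≤ Real.exp 3 ^ 2 := by positivity
    have hWD : 0 ≤ W ^ 2 * D := by positivity
    calc _ ≤ Real.exp 3 ^ 2 * (4 * (72 * W) ^ 2 * D + 16 * (144 * W) ^ 2 * D + 4 * (3 * W) ^ 2 * D
          + 4 * D * (3 * W) ^ 2) :=
          mul_le_mul_of_nonneg_left (add_le_add (add_le_add (add_le_add f1 f3) f4) f5) hE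
      _ ≤ Real.exp 3 ^ 2 * (360000 * (W ^ 2 * D)) := mul_le_mul_of_nonneg_left (by linarith) hE
      _ = _ := by ring

/-- The Hilbert-Schmidt norm of the localized density matrix is controlled by correlators. -/
lemma localHS_le [DecidableEq ι] (h : OrthoFamily L u) (hu : ∀ i, Measurable (u i))
    {γ : ℝ → ℝ → ℂ} (hγ : ∀ x y, ‖γ x y‖ ≤ ‖bordered₁ (flipMatrix L u x y) (fun i => u i x)
      fun j => star (u j y)‖) (hn : n ∈ Finset.Icc 1 L) (hm : m ∈ Finset.Icc 1 L) :
    localHS γ n m ≤ ENNReal.ofReal (600 * Real.exp 3 *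
      (2 + qcor (locReal L u) n n + qcor (locReal L u) m m) *
      min 1 (farSum (locReal L u) L n m 3 + farSum (locReal L u) L n m 2 ^ 2)) := by
  have hq : ∀ a, 0 ≤ qcor (locReal L u) a a := fun a =>
    Finset.sum_nonneg fun i _ => mul_self_nonneg _
  have hZ : 0 ≤ farSum (locReal L u) L n m 3 := Finset.sum_nonneg fun c _ =>
    Finset.sum_nonneg fun a _ => by
      split_ifs
      exacts [Finset.sum_nonneg fun i _ => mul_nonneg ENNReal.toReal_nonneg ENNReal.toReal_nonneg,
        le_rfl]
  have hF := hq n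
  have hG := hq m
  have hmin : 0 ≤ min 1 (farSum (locReal L u) L n m 3 + farSum (locReal L u) L n m 2 ^ 2) :=
    le_min zero_le_one (by positivity)
  rw [← ENNReal.pow_le_pow_left_iff two_ne_zero, ← ENNReal.ofReal_pow (by positivity)]
  refine (h.localHS_sq_le hu hγ hn hm).trans (ENNReal.ofReal_le_ofReal ?_)
  rw [mul_pow (600 * Real.exp 3 * _), mul_pow (600 * Real.exp 3) (2 + _ + _)]
  refine mul_le_mul_of_nonneg_right (mul_le_mul_of_nonneg_left ?_ (by positivity)) (by positivity)
  nlinarith [mul_nonneg hF hG]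

end OrthoFamily

end HilbertSchmidt

/-! ### Sums of stretched exponentials over pairs of cells. -/

section TorusSums

/-- Comparison with `k ^ (-2)`: the exponential beats the power `-(2 / ξ)` of `k ^ ξ`. -/
lemma summable_exp_neg_mul_rpow {c ξ : ℝ} (hc : 0 < c) (hξ : 0 < ξ) :
    Summable fun k : ℕ => Real.exp (-(c * (k : ℝ) ^ ξ)) := by
  have h1 := (isLittleO_exp_neg_mul_rpow_atTop hc (-(2 / ξ))).isBigO
  have h2 : Filter.Tendsto (fun k : ℕ => (k : ℝ) ^ ξ) Filter.atTop Filter.atTop :=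
    (tendsto_rpow_atTop hξ).comp tendsto_natCast_atTop_atTop
  have h3 := h1.comp_tendsto h2
  have h4 : Summable fun k : ℕ => ((k : ℝ) ^ ξ) ^ (-(2 / ξ)) := by
    have : ∀ k : ℕ, ((k : ℝ) ^ ξ) ^ (-(2 / ξ)) = (k : ℝ) ^ (-2 : ℝ) := fun k => by
      rw [← Real.rpow_mul (Nat.cast_nonneg k)]
      congr 1
      field_simp
    simp_rw [this]
    exact Real.summable_nat_rpow.2 (by norm_num)
  refine summable_of_isBigO_nat h4 ?_
  simpa only [Function.comp_def, neg_mul] using h3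

lemma sum_td_le {w : ℕ → ℝ} (hw : ∀ k, 0 ≤ w k) (hs : Summable w) {L n : ℕ} (hn : n ≤ L) :
    ∑ a ∈ Finset.Icc 1 L, w (td L a n) ≤ 4 * ∑' k, w k := by
  rw [Finset.sum_comp w fun a => td L a n]
  calc ∑ k ∈ (Finset.Icc 1 L).image fun a => td L a n,
        ((Finset.Icc 1 L).filter fun a => td L a n = k).card • w k
      ≤ ∑ k ∈ (Finset.Icc 1 L).image fun a => td L a n, 4 * w k := by
        refine Finset.sum_le_sum fun k _ => ?_
        rw [nsmul_eq_mul]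
        refine mul_le_mul_of_nonneg_right ?_ (hw k)
        -- At most four cells have a given distance from `n`: one step of length `k` in either
        -- direction, with or without wrapping around.
        have h1 : ((Finset.Icc 1 L).filter fun a => td L a n = k)
            ⊆ {n + k, n - k, n + L - k, n + k - L} := by
          intro a ha
          rw [Finset.mem_filter, Finset.mem_Icc] at ha
          have ha' := ha.2
          unfold td at ha'
          simp only [Finset.mem_insert, Finset.mem_singleton]
          omega
        exact_mod_cast (Finset.card_le_card h1).trans Finset.card_le_four
    _ = 4 * ∑ k ∈ (Finset.Icc 1 L).image fun a => td L a n, w k := by rw [Finset.mul_sum]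
    _ ≤ 4 * ∑' k, w k := by
        gcongr
        exact hs.sum_le_tsum _ fun k _ => hw k

/-- Of the two factors `w`, one is moved by monotonicity to the distance of `c` from `n` or `m` and
makes the sum over `c` converge, while the other is summed over `a`. This is the purpose of the
second condition in `farSum`: it makes the bound independent of `L`. -/
lemma sum_far_sq_le {w : ℕ → ℝ} (hw : ∀ k, 0 ≤ w k) (hanti : Antitone w) (hs : Summable w)
    {L n m : ℕ} (hn : n ≤ L) (hm : m ≤ L) :
    ∑ c ∈ Finset.Icc 1 L, ∑ a ∈ Finset.Icc 1 L,
      (if td L c n ≤ td L c a ∨ td L c m ≤ td L c a then w (td L c a) ^ 2 else 0)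
      ≤ 32 * (∑' k, w k) ^ 2 := by
  set T := ∑' k, w k with hT
  have hT0 : 0 ≤ T := tsum_nonneg hw
  calc ∑ c ∈ Finset.Icc 1 L, ∑ a ∈ Finset.Icc 1 L,
        (if td L c n ≤ td L c a ∨ td L c m ≤ td L c a then w (td L c a) ^ 2 else 0)
      ≤ ∑ c ∈ Finset.Icc 1 L, ∑ a ∈ Finset.Icc 1 L,
        (w (td L c n) + w (td L c m)) * w (td L a c) := by
        refine Finset.sum_le_sum fun c _ => Finset.sum_le_sum fun a _ => ?_
        rw [td_comm L a c]
        have h1 := hw (td L c n)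
        have h2 := hw (td L c m)
        have h3 := hw (td L c a)
        split_ifs with h
        · rw [sq]
          refine mul_le_mul_of_nonneg_right ?_ h3
          rcases h with h | h
          · have := hanti h
            linarith
          · have := hanti h
            linarith
        · positivity
    _ = ∑ c ∈ Finset.Icc 1 L, (w (td L c n) + w (td L c m))
          * ∑ a ∈ Finset.Icc 1 L, w (td L a c) := by simp_rw [Finset.mul_sum]
    _ ≤ ∑ c ∈ Finset.Icc 1 L, (w (td L c n) + w (td L c m)) * (4 * T) := by
        refine Finset.sum_le_sum fun c hc => mul_le_mul_of_nonneg_left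
          (sum_td_le hw hs (Finset.mem_Icc.1 hc).2) (add_nonneg (hw _) (hw _))
    _ = (∑ c ∈ Finset.Icc 1 L, w (td L c n) + ∑ c ∈ Finset.Icc 1 L, w (td L c m)) * (4 * T) := by
        rw [← Finset.sum_mul, Finset.sum_add_distrib]
    _ ≤ (4 * T + 4 * T) * (4 * T) := by
        gcongr
        · exact sum_td_le hw hs hn
        · exact sum_td_le hw hs hm
    _ = _ := by ring

/-- The decay rate left over in the sum of a stretched exponential over distant pairs of cells. -/
noncomputable def spareRate (ℓ ξ : ℝ) : ℝ := (1 - (5 / 6 : ℝ) ^ ξ) / 2 / ℓ ^ ξ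

lemma spareRate_pos {ℓ ξ : ℝ} (hℓ : 0 < ℓ) (hξ : 0 < ξ) : 0 < spareRate ℓ ξ := by
  have : (5 / 6 : ℝ) ^ ξ < 1 := Real.rpow_lt_one (by norm_num) (by norm_num) hξ
  have := Real.rpow_pos_of_pos hℓ ξ
  exact div_pos (by linarith) this

/-- From `k d ≤ 5 t` follows `k d / 6 ≤ (5 / 6) t`. The unused part `1 - (5 / 6) ^ ξ` of the
exponent is halved into two equal factors for `sum_far_sq_le`. -/
lemma exp_neg_rpow_le {ℓ ξ : ℝ} (hℓ : 0 < ℓ) (hξ : 0 < ξ) {k d t : ℕ} (h : k * d ≤ 5 * t) :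
    Real.exp (-((t : ℝ) ^ ξ / ℓ ^ ξ)) ≤ Real.exp (-((k * d / 6 : ℝ) ^ ξ / ℓ ^ ξ))
      * Real.exp (-(spareRate ℓ ξ * (t : ℝ) ^ ξ)) ^ 2 := by
  rw [← Real.exp_nat_mul, ← Real.exp_add, Real.exp_le_exp]
  have hp := Real.rpow_pos_of_pos hℓ ξ
  have h1 : (k * d / 6 : ℝ) ≤ 5 / 6 * t := by
    have : (k * d : ℝ) ≤ 5 * t := by exact_mod_cast h
    linarith
  have h2 : (k * d / 6 : ℝ) ^ ξ ≤ (5 / 6 : ℝ) ^ ξ * (t : ℝ) ^ ξ := by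
    rw [← Real.mul_rpow (by norm_num) (by positivity)]
    gcongr
  have h3 := div_le_div_of_nonneg_right h2 hp.le
  have h4 : (2 : ℕ) * -(spareRate ℓ ξ * (t : ℝ) ^ ξ)
      = -((t : ℝ) ^ ξ / ℓ ^ ξ) + (5 / 6 : ℝ) ^ ξ * (t : ℝ) ^ ξ / ℓ ^ ξ := by
    unfold spareRate
    push_cast
    field_simp
    ring
  rw [h4]
  linarith

/-- The stretched exponential, summed over all pairs of cells entering `farSum`. -/
lemma sum_far_exp_le {ℓ ξ : ℝ} (hℓ : 0 < ℓ) (hξ : 0 < ξ) {L n m : ℕ} (hn : n ≤ L) (hm : m ≤ L)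
    (k : ℕ) :
    ∑ c ∈ Finset.Icc 1 L, ∑ a ∈ Finset.Icc 1 L,
      (if k * td L n m ≤ 5 * td L c a ∧ (td L c n ≤ td L c a ∨ td L c m ≤ td L c a)
        then Real.exp (-((td L c a : ℝ) ^ ξ / ℓ ^ ξ)) else 0)
      ≤ 32 * (∑' j : ℕ, Real.exp (-(spareRate ℓ ξ * (j : ℝ) ^ ξ))) ^ 2
        * Real.exp (-((k * td L n m / 6 : ℝ) ^ ξ / ℓ ^ ξ)) := by
  have hpos := spareRate_pos hℓ hξ
  have h1 := sum_far_sq_le (w := fun j : ℕ => Real.exp (-(spareRate ℓ ξ * (j : ℝ) ^ ξ)))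
    (fun j => (Real.exp_pos _).le) (fun i j hij => by
      have : (i : ℝ) ≤ j := by exact_mod_cast hij
      simp only
      gcongr) (summable_exp_neg_mul_rpow hpos hξ) hn hm
  rw [mul_comm (32 * _)]
  refine le_trans ?_ (mul_le_mul_of_nonneg_left h1 (Real.exp_pos _).le)
  simp_rw [Finset.mul_sum]
  refine Finset.sum_le_sum fun c _ => Finset.sum_le_sum fun a _ => ?_
  split_ifs with h2 h3 h3
  · exact exp_neg_rpow_le hℓ hξ h2.1
  · exact absurd h2.2 h3
  · positivity
  · simp

end TorusSums

/-! ### Selected eigenfunctions and their correlators in `[0, ∞]`. -/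

section Selections

/-- The correlator of the functions selected by `S`. -/
noncomputable def selCor (φ : ℕ → ℝ → ℂ) (S : Finset ℕ) (c a : ℕ) : ℝ≥0∞ :=
  ∑ k ∈ S, localNorm (φ k) c * localNorm (φ k) a

/-- The sum of the correlators of the functions selected by `S` over distant pairs of cells. -/
noncomputable def selFar (φ : ℕ → ℝ → ℂ) (S : Finset ℕ) (L n m k : ℕ) : ℝ≥0∞ :=
  ∑ c ∈ Finset.Icc 1 L, ∑ a ∈ Finset.Icc 1 L,
    if k * td L n m ≤ 5 * td L c a ∧ (td L c n ≤ td L c a ∨ td L c m ≤ td L c a)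
    then selCor φ S c a else 0

lemma selCor_le_correlator {E : ℕ → ℝ} {φ : ℕ → ℝ → ℂ} {J : Set ℝ} {S : Finset ℕ}
    (h : ∀ k ∈ S, E k ∈ J) (c a : ℕ) : selCor φ S c a ≤ correlator E φ J c a := by
  classical
  rw [selCor, ← Finset.sum_subtype_of_mem _ h]
  exact ENNReal.sum_le_tsum _

lemma IsEigenbasis.orthoFamily {V : ℝ → ℝ} {s : ℤˣ} {L : ℕ} {E : ℕ → ℝ} {φ : ℕ → ℝ → ℂ}
    (h : IsEigenbasis V s L E φ) (S : Finset ℕ) :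
    OrthoFamily L fun a : Fin S.card => φ (S.orderEmbOfFin rfl a) := by
  obtain ⟨b, hb⟩ := h.basis
  have hmem : ∀ j, MemLp (φ j) 2 (volume.restrict (Set.Ioc (0 : ℝ) L)) := fun j =>
    (Lp.memLp (b j)).ae_eq (hb j)
  refine ⟨fun a => hmem _, ?_⟩
  have : (fun a : Fin S.card => (hmem (S.orderEmbOfFin rfl a)).toLp (φ (S.orderEmbOfFin rfl a)))
      = b ∘ S.orderEmbOfFin rfl := by
    funext a
    exact Lp.ext ((MemLp.coeFn_toLp _).trans (hb _).symm)
  rw [this]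
  exact b.orthonormal.comp _ (S.orderEmbOfFin rfl).injective

variable {L : ℕ} {φ : ℕ → ℝ → ℂ} {S : Finset ℕ}

lemma OrthoFamily.ofReal_qcor (h : OrthoFamily L fun a : Fin S.card => φ (S.orderEmbOfFin rfl a))
    {c a : ℕ} (hc : c ∈ Finset.Icc 1 L) (ha : a ∈ Finset.Icc 1 L) :
    ENNReal.ofReal (qcor (locReal L fun a : Fin S.card => φ (S.orderEmbOfFin rfl a)) c a)
      = selCor φ S c a := by
  have hnn : ∀ (i : Fin S.card) (a : ℕ),
      0 ≤ locReal L (fun a : Fin S.card => φ (S.orderEmbOfFin rfl a)) i a :=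
    fun _ _ => ENNReal.toReal_nonneg
  rw [qcor, ENNReal.ofReal_sum_of_nonneg fun i _ => mul_nonneg (hnn i c) (hnn i a)]
  conv_rhs => rw [selCor, ← Finset.map_orderEmbOfFin_univ S rfl, Finset.sum_map]
  refine Finset.sum_congr rfl fun i _ => ?_
  rw [ENNReal.ofReal_mul (hnn i c), h.ofReal_locReal i hc, h.ofReal_locReal i ha]
  rfl

lemma qcor_locReal_nonneg {ι : Type} [Fintype ι] (L : ℕ) (u : ι → ℝ → ℂ) (c a : ℕ) :
    0 ≤ qcor (locReal L u) c a :=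
  Finset.sum_nonneg fun _ _ => mul_nonneg ENNReal.toReal_nonneg ENNReal.toReal_nonneg

lemma farSum_locReal_nonneg {ι : Type} [Fintype ι] (u : ι → ℝ → ℂ) (L n m k : ℕ) :
    0 ≤ farSum (locReal L u) L n m k :=
  Finset.sum_nonneg fun _ _ => Finset.sum_nonneg fun _ _ => by
    split_ifs
    exacts [qcor_locReal_nonneg L u _ _, le_rfl]

lemma OrthoFamily.ofReal_farSum (h : OrthoFamily L fun a : Fin S.card => φ (S.orderEmbOfFin rfl a))
    (n m k : ℕ) :
    ENNReal.ofReal (farSum (locReal L fun a : Fin S.card => φ (S.orderEmbOfFin rfl a)) L n m k)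
      = selFar φ S L n m k := by
  have hnn : ∀ c a, 0 ≤ if k * td L n m ≤ 5 * td L c a ∧
      (td L c n ≤ td L c a ∨ td L c m ≤ td L c a)
      then qcor (locReal L fun a : Fin S.card => φ (S.orderEmbOfFin rfl a)) c a else 0 :=
    fun c a => by
      split_ifs
      exacts [qcor_locReal_nonneg L _ _ _, le_rfl]
  rw [farSum, selFar, ENNReal.ofReal_sum_of_nonneg fun c _ => Finset.sum_nonneg fun a _ => hnn c a]
  refine Finset.sum_congr rfl fun c hc => ?_
  rw [ENNReal.ofReal_sum_of_nonneg fun a _ => hnn c a]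
  refine Finset.sum_congr rfl fun a ha => ?_
  split_ifs
  · exact h.ofReal_qcor hc ha
  · simp

/-- The exponent `2` is lowered to `3/2` so that, after raising to the power `2/5`, the correlator
sum has exponent `3/5`, the largest that Hölder's inequality allows next to a prefactor with
exponent `2/5`. -/
lemma min_one_add_sq_le {x y : ℝ} (hx : 0 ≤ x) (hy : 0 ≤ y) :
    min 1 (x + y ^ 2) ≤ x + y ^ (3 / 2 : ℝ) := by
  rcases le_total y 1 with h | h
  · refine (min_le_right _ _).trans (add_le_add_right ?_ _)
    rw [← Real.rpow_natCast]
    exact Real.rpow_le_rpow_of_exponent_ge' hy h (by norm_num) (by norm_num)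
  · refine (min_le_left _ _).trans ?_
    have := Real.one_le_rpow h (show (0 : ℝ) ≤ 3 / 2 by norm_num)
    linarith

lemma OrthoFamily.localHS_gammaKernel_le
    (h : OrthoFamily L fun a : Fin S.card => φ (S.orderEmbOfFin rfl a))
    (hφ : ∀ k, Measurable (φ k)) {n m : ℕ} (hn : n ∈ Finset.Icc 1 L) (hm : m ∈ Finset.Icc 1 L) :
    localHS (gammaKernel L φ S) n m
      ≤ ENNReal.ofReal (600 * Real.exp 3) * (2 + selCor φ S n n + selCor φ S m m) ∧
    localHS (gammaKernel L φ S) n m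
      ≤ ENNReal.ofReal (600 * Real.exp 3) * (2 + selCor φ S n n + selCor φ S m m)
        * (selFar φ S L n m 3 + selFar φ S L n m 2 ^ (3 / 2 : ℝ)) := by
  have key := h.localHS_le (γ := gammaKernel L φ S) (fun i => hφ _)
    (fun x y => norm_reducedKernel_waveFunction h.memLp x y) hn hm
  have hF := qcor_locReal_nonneg L (fun a : Fin S.card => φ (S.orderEmbOfFin rfl a)) n n
  have hG := qcor_locReal_nonneg L (fun a : Fin S.card => φ (S.orderEmbOfFin rfl a)) m m
  have hZ₂ := farSum_locReal_nonneg (fun a : Fin S.card => φ (S.orderEmbOfFin rfl a)) L n m 2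
  have hZ₃ := farSum_locReal_nonneg (fun a : Fin S.card => φ (S.orderEmbOfFin rfl a)) L n m 3
  have hU : ENNReal.ofReal (600 * Real.exp 3 *
      (2 + qcor (locReal L fun a : Fin S.card => φ (S.orderEmbOfFin rfl a)) n n
        + qcor (locReal L fun a : Fin S.card => φ (S.orderEmbOfFin rfl a)) m m))
      = ENNReal.ofReal (600 * Real.exp 3) * (2 + selCor φ S n n + selCor φ S m m) := by
    rw [ENNReal.ofReal_mul (by positivity), ENNReal.ofReal_add (by positivity) hG,
      ENNReal.ofReal_add (by norm_num) hF, h.ofReal_qcor hn hn, h.ofReal_qcor hm hm]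
    simp
  rw [ENNReal.ofReal_mul (by positivity), hU] at key
  refine ⟨key.trans ?_, key.trans (mul_le_mul_right ?_ _)⟩
  · refine (mul_le_mul_right (ENNReal.ofReal_le_ofReal (min_le_left _ _)) _).trans ?_
    simp
  · refine (ENNReal.ofReal_le_ofReal (min_one_add_sq_le hZ₃ hZ₂)).trans (le_of_eq ?_)
    rw [ENNReal.ofReal_add hZ₃ (by positivity), ← ENNReal.ofReal_rpow_of_nonneg hZ₂ (by norm_num),
      h.ofReal_farSum, h.ofReal_farSum]

end Selections

/-! ### Measurability, expectations and fractional moments. -/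

section Expectations

variable {Ω : Type*} [MeasurableSpace Ω]

/-- There are only countably many finite sets of labels, so a measurable selection can be treated
one value at a time. -/
lemma measurable_apply_finset {β : Type*} [MeasurableSpace β] {S : Ω → Finset ℕ}
    (hS : ∀ k, MeasurableSet {ω | k ∈ S ω}) {g : Ω → Finset ℕ → β}
    (hg : ∀ F, Measurable fun ω => g ω F) : Measurable fun ω => g ω (S ω) := by
  let _ : MeasurableSpace (Finset ℕ) := ⊤
  have h1 : Measurable S := by
    refine measurable_to_countable' fun F => ?_
    have : S ⁻¹' {F} = ⋂ k : ℕ, {ω | k ∈ S ω ↔ k ∈ F} := by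
      ext ω
      simp [Finset.ext_iff]
    rw [this]
    refine MeasurableSet.iInter fun k => ?_
    by_cases hk : k ∈ F
    · simpa [hk] using hS k
    · simpa [hk, Set.compl_ofPred] using (hS k).compl
  have h2 : Measurable fun p : Ω × Finset ℕ => g p.1 p.2 := measurable_from_prod_countable_left hg
  exact h2.comp (measurable_id.prodMk h1)

lemma measurable_localNorm {f : Ω → ℝ → ℂ} (hf : Measurable fun p : Ω × ℝ => f p.1 p.2) (a : ℕ) :
    Measurable fun ω => localNorm (f ω) a := by
  unfold localNorm
  exact ((hf.enorm.pow_const 2).lintegral_prod_right'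
    (ν := volume.restrict (cell a))).pow_const _

lemma measurable_selCor {φ : ℤˣ → Ω → ℕ → ℝ → ℂ}
    (hφ : ∀ s j, Measurable fun p : Ω × ℝ => φ s p.1 j p.2) {S : Ω → Finset ℕ}
    (hS : ∀ k, MeasurableSet {ω | k ∈ S ω}) (c a : ℕ) :
    Measurable fun ω => selCor (φ (bcSign (S ω).card) ω) (S ω) c a :=
  measurable_apply_finset hS (g := fun ω F => selCor (φ (bcSign F.card) ω) F c a) fun _ =>
    Finset.measurable_fun_sum _ fun _ _ =>
      (measurable_localNorm (hφ _ _) c).mul (measurable_localNorm (hφ _ _) a)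

lemma measurable_selFar {φ : ℤˣ → Ω → ℕ → ℝ → ℂ}
    (hφ : ∀ s j, Measurable fun p : Ω × ℝ => φ s p.1 j p.2) {S : Ω → Finset ℕ}
    (hS : ∀ k, MeasurableSet {ω | k ∈ S ω}) (L n m k : ℕ) :
    Measurable fun ω => selFar (φ (bcSign (S ω).card) ω) (S ω) L n m k := by
  refine Finset.measurable_fun_sum _ fun c _ => Finset.measurable_fun_sum _ fun a _ => ?_
  split_ifs
  exacts [measurable_selCor hφ hS c a, measurable_const]

variable {P : Measure Ω}

/-- The parity of the random particle number selects the boundary condition. Splitting by parity and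
bounding each part by the full correlator of its boundary condition gives the factor `2`. -/
lemma lintegral_selCor_le {E : ℤˣ → ℕ → Ω → ℕ → ℝ} {φ : ℤˣ → ℕ → Ω → ℕ → ℝ → ℂ} {J : Set ℝ}
    {C ℓ ξ : ℝ} (hC : 0 ≤ C) (hECL : ECL P E φ J C ℓ ξ) {L : ℕ} {S : Ω → Finset ℕ}
    (hS : ∀ k, MeasurableSet {ω | k ∈ S ω})
    (hJ : ∀ᵐ ω ∂P, ∀ k ∈ S ω, E (bcSign (S ω).card) L ω k ∈ J)
    {c a : ℕ} (hc : c ∈ Finset.Icc 1 L) (ha : a ∈ Finset.Icc 1 L) :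
    ∫⁻ ω, selCor (φ (bcSign (S ω).card) L ω) (S ω) c a ∂P
      ≤ ENNReal.ofReal (2 * C * Real.exp (-((td L c a : ℝ) ^ ξ / ℓ ^ ξ))) := by
  have hc' := Finset.mem_Icc.1 hc
  have ha' := Finset.mem_Icc.1 ha
  set A : Set Ω := {ω | bcSign (S ω).card = 1} with hA
  have hAm : MeasurableSet A := measurableSet_setOfPred.2
    (measurable_apply_finset hS (g := fun _ F => bcSign F.card = 1) fun _ => measurable_const)
  have key : ∀ (s : ℤˣ) (B : Set Ω), MeasurableSet B → (∀ ω ∈ B, bcSign (S ω).card = s) →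
      ∫⁻ ω in B, selCor (φ (bcSign (S ω).card) L ω) (S ω) c a ∂P
        ≤ ENNReal.ofReal (C * Real.exp (-((td L c a : ℝ) ^ ξ / ℓ ^ ξ))) := by
    intro s B hB hs
    rw [← torusDist_eq hc'.2 ha'.2]
    refine le_trans ?_ (hECL s L c a hc'.1 hc'.2 ha'.1 ha'.2)
    refine le_trans (lintegral_mono_ae ?_) (setLIntegral_le_lintegral B _)
    filter_upwards [ae_restrict_mem hB, ae_restrict_of_ae hJ] with ω h1 h2
    rw [hs ω h1] at h2 ⊢
    exact selCor_le_correlator h2 c a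
  rw [← lintegral_add_compl _ hAm]
  refine (add_le_add (key 1 A hAm fun _ h => h) (key (-1) Aᶜ hAm.compl fun ω h =>
    (Int.units_eq_one_or _).resolve_left h)).trans (le_of_eq ?_)
  rw [← ENNReal.ofReal_add (by positivity) (by positivity)]
  congr 1
  ring

lemma lintegral_selFar_le {E : ℤˣ → ℕ → Ω → ℕ → ℝ} {φ : ℤˣ → ℕ → Ω → ℕ → ℝ → ℂ} {J : Set ℝ}
    (hφ : ∀ s L j, Measurable fun p : Ω × ℝ => φ s L p.1 j p.2)
    {C ℓ ξ : ℝ} (hC : 0 ≤ C) (hℓ : 0 < ℓ) (hξ : 0 < ξ) (hECL : ECL P E φ J C ℓ ξ) {L : ℕ}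
    {S : Ω → Finset ℕ} (hS : ∀ k, MeasurableSet {ω | k ∈ S ω})
    (hJ : ∀ᵐ ω ∂P, ∀ k ∈ S ω, E (bcSign (S ω).card) L ω k ∈ J)
    {n m : ℕ} (hn : n ≤ L) (hm : m ≤ L) (k : ℕ) :
    ∫⁻ ω, selFar (φ (bcSign (S ω).card) L ω) (S ω) L n m k ∂P
      ≤ ENNReal.ofReal (64 * C * (∑' j : ℕ, Real.exp (-(spareRate ℓ ξ * (j : ℝ) ^ ξ))) ^ 2
        * Real.exp (-((k * td L n m / 6 : ℝ) ^ ξ / ℓ ^ ξ))) := by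
  have hmeas : ∀ c a, Measurable fun ω => selCor (φ (bcSign (S ω).card) L ω) (S ω) c a :=
    fun c a => measurable_selCor (φ := fun s => φ s L) (fun s j => hφ s L j) hS c a
  have hmeas' : ∀ c a, Measurable fun ω => if k * td L n m ≤ 5 * td L c a ∧
      (td L c n ≤ td L c a ∨ td L c m ≤ td L c a)
      then selCor (φ (bcSign (S ω).card) L ω) (S ω) c a else 0 := fun c a => by
    split_ifs
    exacts [hmeas c a, measurable_const]
  have hnn : ∀ c a : ℕ, 0 ≤ 2 * C * if k * td L n m ≤ 5 * td L c a ∧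
      (td L c n ≤ td L c a ∨ td L c m ≤ td L c a)
      then Real.exp (-((td L c a : ℝ) ^ ξ / ℓ ^ ξ)) else 0 := fun c a => by
    split_ifs <;> positivity
  unfold selFar
  rw [lintegral_finsetSum _ fun c _ => Finset.measurable_fun_sum _ fun a _ => hmeas' c a]
  have h1 : ∀ c ∈ Finset.Icc 1 L, ∫⁻ ω, (∑ a ∈ Finset.Icc 1 L,
      if k * td L n m ≤ 5 * td L c a ∧ (td L c n ≤ td L c a ∨ td L c m ≤ td L c a)
      then selCor (φ (bcSign (S ω).card) L ω) (S ω) c a else 0) ∂P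
      ≤ ENNReal.ofReal (∑ a ∈ Finset.Icc 1 L, 2 * C * if k * td L n m ≤ 5 * td L c a ∧
        (td L c n ≤ td L c a ∨ td L c m ≤ td L c a)
        then Real.exp (-((td L c a : ℝ) ^ ξ / ℓ ^ ξ)) else 0) := by
    intro c hc
    rw [lintegral_finsetSum _ fun a _ => hmeas' c a,
      ENNReal.ofReal_sum_of_nonneg fun a _ => hnn c a]
    refine Finset.sum_le_sum fun a ha => ?_
    split_ifs
    · exact lintegral_selCor_le hC hECL hS hJ hc ha
    · simp
  refine (Finset.sum_le_sum h1).trans ?_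
  rw [← ENNReal.ofReal_sum_of_nonneg fun c _ => Finset.sum_nonneg fun a _ => hnn c a]
  refine ENNReal.ofReal_le_ofReal ?_
  simp_rw [← Finset.mul_sum]
  refine (mul_le_mul_of_nonneg_left (sum_far_exp_le hℓ hξ hn hm k) (by positivity)).trans
    (le_of_eq ?_)
  ring

lemma lintegral_rpow_mul_le [IsProbabilityMeasure P] {U Z : Ω → ℝ≥0∞} (hU : Measurable U)
    (hZ : Measurable Z) {p q : ℝ} (hp : 0 ≤ p) (hq : 0 ≤ q) (hpq : p + q ≤ 1) :
    ∫⁻ ω, U ω ^ p * Z ω ^ q ∂P ≤ (∫⁻ ω, U ω ∂P) ^ p * (∫⁻ ω, Z ω ∂P) ^ q := by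
  have := ENNReal.lintegral_prod_norm_pow_le (μ := P) Finset.univ (f := ![U, Z, fun _ => 1])
    (p := ![p, q, 1 - p - q])
    (by
      intro i _
      fin_cases i
      exacts [hU.aemeasurable, hZ.aemeasurable, aemeasurable_const])
    (by simp [Fin.sum_univ_three])
    (by
      intro i _
      fin_cases i
      exacts [hp, hq, by simp; linarith])
  simpa [Fin.prod_univ_three] using this

/-- Interpolation between a bound on the expectation and a decaying bound on a fractional moment. -/
lemma lintegral_rpow_le_of_le [IsProbabilityMeasure P] {X U Y Z : Ω → ℝ≥0∞} (hU : Measurable U)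
    (hY : Measurable Y) (hZ : Measurable Z) (h1 : ∀ᵐ ω ∂P, X ω ≤ U ω)
    (h2 : ∀ᵐ ω ∂P, X ω ≤ U ω * (Z ω + Y ω ^ (3 / 2 : ℝ))) {M D r : ℝ} (hM : 1 ≤ M) (hD : 1 ≤ D)
    (hUi : ∫⁻ ω, U ω ∂P ≤ ENNReal.ofReal M)
    (hZi : ∫⁻ ω, Z ω ∂P ≤ ENNReal.ofReal (D * Real.exp (-r)))
    (hYi : ∫⁻ ω, Y ω ∂P ≤ ENNReal.ofReal (D * Real.exp (-(2 / 3 * r)))) {σ : ℝ} (hσ : 2 / 5 ≤ σ)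
    (hσ1 : σ ≤ 1) :
    ∫⁻ ω, X ω ^ σ ∂P ≤ ENNReal.ofReal (2 * M * D * Real.exp (-(2 / 3 * (1 - σ) * r))) := by
  -- A majorant of `X ^ (2/5)` made of measurable functions, so that no measurability of `X` is
  -- required.
  set W : Ω → ℝ≥0∞ := fun ω =>
    U ω ^ (2 / 5 : ℝ) * Z ω ^ (2 / 5 : ℝ) + U ω ^ (2 / 5 : ℝ) * Y ω ^ (3 / 5 : ℝ) with hW
  have hWm : Measurable W := ((hU.pow_const _).mul (hZ.pow_const _)).add
    ((hU.pow_const _).mul (hY.pow_const _))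
  have hXW : ∀ᵐ ω ∂P, X ω ^ (2 / 5 : ℝ) ≤ W ω := by
    filter_upwards [h2] with ω h
    refine (ENNReal.rpow_le_rpow h (by norm_num)).trans ?_
    rw [ENNReal.mul_rpow_of_nonneg _ _ (by norm_num), hW]
    simp only
    rw [← mul_add]
    refine mul_le_mul_right ((ENNReal.rpow_add_le_add_rpow _ _ (by norm_num) (by norm_num)).trans
      (le_of_eq ?_)) _
    rw [← ENNReal.rpow_mul]
    norm_num
  have hM0 : 0 ≤ M := by linarith
  have hD0 : 0 ≤ D := by linarith
  have hroot : ∀ {x p : ℝ}, 1 ≤ x → 0 ≤ p → p ≤ 1 → x ^ p ≤ x := fun hx hp hp1 => by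
    simpa using Real.rpow_le_rpow_of_exponent_le hx hp1
  -- Used with `(p, t) = (2/5, r)` and `(3/5, 2 r / 3)`: both terms of `W` decay with the same rate
  -- `2 r / 5`.
  have hprod : ∀ {Q : Ω → ℝ≥0∞} (_ : Measurable Q) {p t : ℝ}, 0 ≤ p → p ≤ 3 / 5 →
      t * p = 2 / 5 * r → ∫⁻ ω, Q ω ∂P ≤ ENNReal.ofReal (D * Real.exp (-t)) →
      ∫⁻ ω, U ω ^ (2 / 5 : ℝ) * Q ω ^ p ∂P
        ≤ ENNReal.ofReal (M * D * Real.exp (-(2 / 5 * r))) := by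
    intro Q hQ p t hp hp1 ht hQi
    refine (lintegral_rpow_mul_le hU hQ (by norm_num) hp (by linarith)).trans ?_
    refine (mul_le_mul' (ENNReal.rpow_le_rpow hUi (by norm_num))
      (ENNReal.rpow_le_rpow hQi hp)).trans ?_
    rw [ENNReal.ofReal_rpow_of_nonneg hM0 (by norm_num),
      ENNReal.ofReal_rpow_of_nonneg (by positivity) hp, ← ENNReal.ofReal_mul (by positivity),
      Real.mul_rpow hD0 (Real.exp_pos _).le, ← Real.exp_mul, mul_assoc M,
      show -t * p = -(2 / 5 * r) by rw [← ht]; ring]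
    refine ENNReal.ofReal_le_ofReal ?_
    have e1 := hroot hM (p := 2 / 5) (by norm_num) (by norm_num)
    have e2 := hroot hD hp (by linarith)
    gcongr
  have hWi : ∫⁻ ω, W ω ∂P ≤ ENNReal.ofReal (2 * M * D * Real.exp (-(2 / 5 * r))) := by
    simp only [hW]
    rw [lintegral_add_left (f := fun ω => U ω ^ (2 / 5 : ℝ) * Z ω ^ (2 / 5 : ℝ))
      ((hU.pow_const _).mul (hZ.pow_const _))]
    refine (add_le_add (hprod hZ (p := 2 / 5) (t := r) (by norm_num) (by norm_num) (by ring) hZi)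
      (hprod hY (p := 3 / 5) (t := 2 / 3 * r) (by norm_num) le_rfl (by ring) hYi)).trans
      (le_of_eq ?_)
    rw [← ENNReal.ofReal_add (by positivity) (by positivity)]
    congr 1
    ring
  -- Chosen so that `σ = (2/5) θ + (1 - θ)`; the resulting rate is `(2/5) θ r = (2/3) (1 - σ) r`,
  -- and `θ ≤ 1` is the condition `σ ≥ 2/5`.
  set θ : ℝ := 5 / 3 * (1 - σ) with hθ
  have hθ0 : 0 ≤ θ := by rw [hθ]; linarith
  have hθ1 : 0 ≤ 1 - θ := by rw [hθ]; linarith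
  calc ∫⁻ ω, X ω ^ σ ∂P ≤ ∫⁻ ω, W ω ^ θ * U ω ^ (1 - θ) ∂P := by
        refine lintegral_mono_ae ?_
        filter_upwards [hXW, h1] with ω h3 h4
        rw [show σ = 2 / 5 * θ + (1 - θ) by rw [hθ]; ring,
          ENNReal.rpow_add_of_nonneg _ _ (by positivity) hθ1, ENNReal.rpow_mul]
        gcongr
    _ ≤ (∫⁻ ω, W ω ∂P) ^ θ * (∫⁻ ω, U ω ∂P) ^ (1 - θ) :=
        ENNReal.lintegral_mul_norm_pow_le hWm.aemeasurable hU.aemeasurable hθ0 hθ1 (by ring)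
    _ ≤ ENNReal.ofReal (2 * M * D * Real.exp (-(2 / 5 * r))) ^ θ
          * ENNReal.ofReal (2 * M * D) ^ (1 - θ) := by
        gcongr
        refine hUi.trans (ENNReal.ofReal_le_ofReal ?_)
        nlinarith
    _ = _ := by
        have hMD : 0 < 2 * M * D := by positivity
        rw [ENNReal.ofReal_rpow_of_nonneg (by positivity) hθ0,
          ENNReal.ofReal_rpow_of_nonneg hMD.le hθ1, ← ENNReal.ofReal_mul (by positivity),
          Real.mul_rpow hMD.le (Real.exp_pos _).le, ← Real.exp_mul, mul_right_comm,
          ← Real.rpow_add hMD]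
        congr 2
        · rw [add_sub_cancel, Real.rpow_one]
        · rw [hθ]
          congr 1
          ring

end Expectations

end TonksGirardeau

/-! ### Assembly of the main theorem. -/

theorem theorem1 {Ω : Type*} [MeasurableSpace Ω] (P : Measure Ω) [IsProbabilityMeasure P]
    (V : Ω → ℝ → ℝ) (hVmeas : Measurable (Function.uncurry V))
    (hV : ∃ K : ℝ≥0, ∀ n : ℕ, 1 ≤ n →
      ∫⁻ ω, (∫⁻ x in TonksGirardeau.cell n, ‖V ω x‖ₑ) ∂P ≤ K)
    (E : ℤˣ → ℕ → Ω → ℕ → ℝ) (φ : ℤˣ → ℕ → Ω → ℕ → ℝ → ℂ)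
    (hφmeas : ∀ (s : ℤˣ) (L j : ℕ), Measurable fun p : Ω × ℝ => φ s L p.1 j p.2)
    (hφ : ∀ (s : ℤˣ) (L : ℕ), 1 ≤ L →
      ∀ᵐ ω ∂P, TonksGirardeau.IsEigenbasis (V ω) s (L : ℝ) (E s L ω) (φ s L ω))
    (J : Set ℝ) (C ℓ ξ : ℝ) (hC : 0 < C) (hℓ : 0 < ℓ) (hξ0 : 0 < ξ) (hξ1 : ξ ≤ 1)
    (hECL : TonksGirardeau.ECL P E φ J C ℓ ξ) :
    ∃ A : ℝ, 0 < A ∧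
      ∀ (L : ℕ) (S : Ω → Finset ℕ),
        (∀ k : ℕ, MeasurableSet {ω | k ∈ S ω}) →
        (∀ᵐ ω ∂P, ∀ k ∈ S ω, E (TonksGirardeau.bcSign (S ω).card) L ω k ∈ J) →
        ∀ n m : ℕ, 1 ≤ n → n ≤ L → 1 ≤ m → m ≤ L →
        ∀ σ : ℝ, 2 / 5 ≤ σ → σ < 1 →
          ∫⁻ ω, TonksGirardeau.localHS
              (TonksGirardeau.gammaKernel (L : ℝ)
                (φ (TonksGirardeau.bcSign (S ω).card) L ω) (S ω)) n m ^ σ ∂P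
            ≤ ENNReal.ofReal (A * Real.exp
                (-(2 / 3 * (1 - σ) * (TonksGirardeau.torusDist L n m ^ ξ / (2 * ℓ) ^ ξ)))) := by
  open TonksGirardeau in
  set T : ℝ := ∑' j : ℕ, Real.exp (-(spareRate ℓ ξ * (j : ℝ) ^ ξ)) with hT
  -- `M` bounds the expectation of the prefactor, each of the two diagonal correlators contributing
  -- `2 * C`. The `+ 1` in `D` only secures `D ≥ 1`, so that roots of `D` are at most `D`.
  set M : ℝ := 600 * Real.exp 3 * (2 + 4 * C) with hM
  set D : ℝ := 64 * C * T ^ 2 + 1 with hD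
  have hM1 : 1 ≤ M := by
    have := Real.add_one_le_exp (3 : ℝ)
    rw [hM]
    nlinarith
  have hD1 : 1 ≤ D := by
    have : 0 ≤ 64 * C * T ^ 2 := by positivity
    linarith
  refine ⟨2 * M * D, by positivity, ?_⟩
  intro L S hS hJ n m hn1 hn hm1 hm σ hσ hσ1
  have hn' := Finset.mem_Icc.2 ⟨hn1, hn⟩
  have hm' := Finset.mem_Icc.2 ⟨hm1, hm⟩
  rw [torusDist_eq hn hm]
  set d : ℝ := (td L n m : ℝ) with hd
  have hd0 : 0 ≤ d := Nat.cast_nonneg _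
  have hbasis : ∀ᵐ ω ∂P, IsEigenbasis (V ω) (bcSign (S ω).card) L
      (E (bcSign (S ω).card) L ω) (φ (bcSign (S ω).card) L ω) := by
    filter_upwards [hφ 1 L (hn1.trans hn), hφ (-1) L (hn1.trans hn)] with ω h1 h2
    rcases Int.units_eq_one_or (bcSign (S ω).card) with h | h <;> rw [h]
    exacts [h1, h2]
  have hbound := fun (ω : Ω) (h : IsEigenbasis (V ω) (bcSign (S ω).card) L
      (E (bcSign (S ω).card) L ω) (φ (bcSign (S ω).card) L ω)) =>
    (h.orthoFamily (S ω)).localHS_gammaKernel_le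
      (fun k => (hφmeas _ L k).comp measurable_prodMk_left) hn' hm'
  have hmeas : ∀ c a, Measurable fun ω => selCor (φ (bcSign (S ω).card) L ω) (S ω) c a :=
    fun c a => measurable_selCor (φ := fun s => φ s L) (fun s j => hφmeas s L j) hS c a
  have hmeas' : ∀ k, Measurable fun ω => selFar (φ (bcSign (S ω).card) L ω) (S ω) L n m k :=
    fun k => measurable_selFar (φ := fun s => φ s L) (fun s j => hφmeas s L j) hS L n m k
  have hfar := fun k => lintegral_selFar_le hφmeas hC.le hℓ hξ0 hECL hS hJ hn hm k
  rw [← hT, ← hd] at hfar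
  have hcor : ∀ c ∈ Finset.Icc 1 L, ∫⁻ ω, selCor (φ (bcSign (S ω).card) L ω) (S ω) c c ∂P
      ≤ ENNReal.ofReal (2 * C) := by
    intro c hc
    refine (lintegral_selCor_le hC.le hECL hS hJ hc hc).trans (ENNReal.ofReal_le_ofReal ?_)
    refine mul_le_of_le_one_right (by positivity) (Real.exp_le_one_iff.2 (neg_nonpos.2 ?_))
    positivity
  refine lintegral_rpow_le_of_le (((hmeas n n).const_add 2 |>.add (hmeas m m)).const_mul
    (ENNReal.ofReal (600 * Real.exp 3))) (hmeas' 2) (hmeas' 3)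
    (hbasis.mono fun ω h => (hbound ω h).1)
    (hbasis.mono fun ω h => (hbound ω h).2) hM1 hD1 ?_ ?_ ?_ hσ hσ1.le
  · rw [lintegral_const_mul _ (((hmeas n n).const_add 2).add (hmeas m m))]
    simp only [Pi.add_apply]
    rw [lintegral_add_right _ (hmeas m m), lintegral_add_right _ (hmeas n n), hM,
      ENNReal.ofReal_mul (show 0 ≤ 600 * Real.exp 3 by positivity)]
    refine mul_le_mul_right ((add_le_add (add_le_add (le_of_eq ?_) (hcor n hn')) (hcor m hm')).trans
      (le_of_eq ?_ : ENNReal.ofReal 2 + ENNReal.ofReal (2 * C) + ENNReal.ofReal (2 * C) ≤ _)) _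
    · simp
    · rw [← ENNReal.ofReal_add (by norm_num) (by positivity),
        ← ENNReal.ofReal_add (by positivity) (by positivity)]
      congr 1
      ring
  · refine (hfar 3).trans (ENNReal.ofReal_le_ofReal ?_)
    -- For `k = 3` the rate is exact, as `3/6 = 1/2`.
    have e1 : (((3 : ℕ) : ℝ) * d / 6) ^ ξ / ℓ ^ ξ = d ^ ξ / (2 * ℓ) ^ ξ := by
      rw [← Real.div_rpow (by positivity) hℓ.le, ← Real.div_rpow hd0 (by positivity)]
      congr 1
      push_cast
      field_simp
      ring
    rw [e1]
    gcongr
    linarith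
  · refine (hfar 2).trans (ENNReal.ofReal_le_ofReal ?_)
    -- For `k = 2` one has `2/6 = (2/3) * (1/2)`, and `(2/3) ^ ξ ≥ 2/3` because `ξ ≤ 1`.
    have e1 : 2 / 3 * (d ^ ξ / (2 * ℓ) ^ ξ) ≤ (((2 : ℕ) : ℝ) * d / 6) ^ ξ / ℓ ^ ξ := by
      have e2 : (((2 : ℕ) : ℝ) * d / 6) ^ ξ / ℓ ^ ξ = (2 / 3 : ℝ) ^ ξ * (d ^ ξ / (2 * ℓ) ^ ξ) := by
        rw [← Real.div_rpow (by positivity) hℓ.le, ← Real.div_rpow hd0 (by positivity),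
          ← Real.mul_rpow (by norm_num) (by positivity)]
        congr 1
        push_cast
        field_simp
        ring
      rw [e2]
      gcongr
      simpa using Real.rpow_le_rpow_of_exponent_ge (by norm_num : (0 : ℝ) < 2 / 3) (by norm_num) hξ1
    gcongr
    linarith
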